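/- Let $(\mathcal M,\mathbf g)$ be a real-analytic Riemannian manifold with Levi-Civita connection $\nabla^{\mathbf g}$, let $\mathrm W$ be an analytic field of $\mathbf g$-symmetric endomorphisms of $T\mathcal M$, put $\mathrm{II}:=\mathbf g(\mathrm W\,\cdot,\cdot)$, and let $U$ be a nowhere vanishing analytic vector field on $\mathcal M$ with $$\nabla^{\mathbf g}U+u\,\mathrm W=0,\qquad u:=\sqrt{\mathbf g(U,U)}>0 .$$ Let $\lambda$ be a positive analytic function on $\mathbb R\times\mathcal M$, and $\lambda_t:=\lambda(t,\cdot)$. Then there are an open neighbourhood $\overline{\mathcal U}$ of $\{0\}\times\mathcal M$ in $\mathbb R\times\mathcal M$ and analytic families, defined on $\overline{\mathcal U}$, of Riemannian metrics $\mathbf g_t$, vector fields $U_t$ and functions $u_t$ on (open subsets of) $\mathcal M$ such that $$\overline{\mathbf g}=-\lambda^2dt^2+\mathbf g_t$$ is an analytic Lorentzian metric on $\overline{\mathcal U}$, the analytic vector field $V=\frac{u_t}{\lambda}\partial_t-U_t$ is null (i.e. $V\neq0$ everywhere and $\overline{\mathbf g}(V,V)=0$) and parallel for the Levi-Civita connection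 of $\overline{\mathbf g}$, and the initial conditions $$\mathbf g_0=\mathbf g,\quad \dot{\mathbf g}_0=-2\lambda_0\,\mathrm{II},\quad U_0=U,\quad \dot U_0=u\,\mathrm{grad}^{\mathbf g}\lambda_0+\lambda_0\mathrm W(U),\quad u_0=u,\quad \dot u_0=d\lambda_0(U)$$ hold, where a dot denotes the $t$-derivative. The triple $(\mathbf g_t,U_t,u_t)$, and hence the metric $\overline{\mathbf g}$, is unique on $\overline{\mathcal U}$ with these properties. Moreover $(\mathbf g_t,U_t,u_t)$ solves on $\overline{\mathcal U}$ the following system, for all $X,Y\in T\mathcal M$: $$\begin{aligned} \ddot{\mathbf g}_t(X,Y)={}&\tfrac{\lambda^2}{u_t}\Big(d^{\nabla^t}\!\big(\tfrac{\dot{\mathbf g}_t}{\lambda}\big)(U_t,X,Y)+d^{\nabla^t}\!\big(\tfrac{\dot{\mathbf g}_t}{\lambda}\big)(U_t,Y,X)\Big)+\tfrac12\dot{\mathbf g}_t(X,\dot{\mathbf g}_t^\sharp(Y))+\partial_t(\log\lambda)\,\dot{\mathbf g}_t(X,Y)\\ &+2\lambda\,\mathrm{Hess}^t(\lambda)(X,Y)+2\tfrac{\lambda^2}{u_t^2}\mathrm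 R_t(X,U_t,U_t,Y)+\tfrac1{2u_t^2}\big(\dot{\mathbf g}_t(X,Y)\dot{\mathbf g}_t(U_t,U_t)-\dot{\mathbf g}_t(X,U_t)\dot{\mathbf g}_t(Y,U_t)\big),\\ \mathbf g_t(\ddot U_t,X)={}&-\tfrac{\lambda^2}{2u_t}d^{\nabla^t}\!\big(\tfrac{\dot{\mathbf g}_t}{\lambda}\big)(U_t,X,U_t)-\tfrac12\partial_t(\log\lambda)\,\dot{\mathbf g}_t(U_t,X)-\lambda\,\mathrm{Hess}^t(\lambda)(U_t,X)-\dot{\mathbf g}_t(\dot U_t,X)\\ &+u_t\,\mathbf g_t(\partial_t(\mathrm{grad}^t\lambda),X)+\tfrac{u_t}2\dot{\mathbf g}_t(\mathrm{grad}^t\lambda,X)+\big(2\dot u_t-d\lambda_t(U_t)\big)d\lambda_t(X),\\ \ddot u_t={}&\mathbf g_t(\partial_t(\mathrm{grad}^t\lambda),U_t)+2\,d\lambda_t(\dot U_t)+\tfrac32\dot{\mathbf g}_t(\mathrm{grad}^t\lambda,U_t)-u_t\,\mathbf g_t(\mathrm{grad}^t\lambda,\mathrm{grad}^t\lambda). \end{aligned}$$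 Here $\nabla^t$, $\mathrm{grad}^t$, $\mathrm{Hess}^t$ and $\mathrm R_t$ are the Levi-Civita connection, gradient, Hessian and curvature of $\mathbf g_t$ (all acting on functions of $x$ at fixed $t$), with $\mathrm R_t(X,Y)=[\nabla^t_X,\nabla^t_Y]-\nabla^t_{[X,Y]}$ and $\mathrm R_t(X,Y,Z,Z')=\mathbf g_t(\mathrm R_t(X,Y)Z,Z')$; $d^{\nabla^t}h(X,Y,Z)=(\nabla^t_Xh)(Y,Z)-(\nabla^t_Yh)(X,Z)$; and $\mathbf g_t(X,\dot{\mathbf g}_t^\sharp(Y))=\dot{\mathbf g}_t(X,Y)$. -/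

import Mathlib

open Bundle Manifold
open scoped ContDiff Manifold Topology

noncomputable section

/-! ### Pseudo-Riemannian geometry in coordinates

`G : E → E → E → ℝ` is a field of symmetric nondegenerate bilinear forms on (an open subset of) a
finite-dimensional vector space: `G y v w` is the product of the vectors `v`, `w` at `y`. -/

namespace LocalGeom

variable {E : Type*} [NormedAddCommGroup E] [NormedSpace ℝ E]

/-- The metric dual of the linear form `α` with respect to the nondegenerate bilinear form `B`:
the vector `v` with `B v w = α w` for all `w`. -/
def sharp (B : E → E → ℝ) (α : E → ℝ) : E :=
  Classical.epsilon fun v => ∀ w, B v w = α w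

/-- Christoffel symbols of the second kind: `Γ_y(v, w)` is the vector determined by
`2 G(Γ(v, w), z) = ∂_v G(w, z) + ∂_w G(v, z) - ∂_z G(v, w)`. -/
def christoffel (G : E → E → E → ℝ) (y v w : E) : E :=
  sharp (G y) fun z =>
    (1 / 2) * (fderiv ℝ (fun p => G p w z) y v + fderiv ℝ (fun p => G p v z) y w
      - fderiv ℝ (fun p => G p v w) y z)

/-- Levi-Civita covariant derivative `(∇_v X)(y)`. -/
def cov (G : E → E → E → ℝ) (X : E → E) (y v : E) : E :=
  fderiv ℝ X y v + christoffel G y v (X y)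

/-- Covariant derivative `(∇_v h)(a, b)` of a field `h` of bilinear forms. -/
def covForm (G h : E → E → E → ℝ) (y v a b : E) : ℝ :=
  fderiv ℝ (fun p => h p a b) y v - h y (christoffel G y v a) b - h y a (christoffel G y v b)

/-- Riemann curvature `R(v, w) a = ∇_v ∇_w a - ∇_w ∇_v a` (for the constant extensions of the
three vectors, whose brackets vanish). -/
def curv (G : E → E → E → ℝ) (y v w a : E) : E :=
  cov G (fun p => cov G (fun _ => a) p w) y v - cov G (fun p => cov G (fun _ => a) p v) y w

/-- Hessian `(∇ df)(v, w)`. -/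
def hess (G : E → E → E → ℝ) (f : E → ℝ) (y v w : E) : ℝ :=
  fderiv ℝ (fun p => fderiv ℝ f p w) y v - fderiv ℝ f y (christoffel G y v w)

end LocalGeom

/-! ### The same notions on manifolds

At a point `x` everything is computed in the preferred chart around `x`; the tangent space at `x`
is identified with the model space through that same chart. -/

namespace Geom

section General

variable {E : Type*} [NormedAddCommGroup E] [NormedSpace ℝ E]
  {H : Type*} [TopologicalSpace H] (I : ModelWithCorners ℝ E H)
  {M : Type*} [TopologicalSpace M] [ChartedSpace H M]

/-- Vector fields. -/
abbrev VecField (M : Type*) [TopologicalSpace M] [ChartedSpace H M] : Type _ :=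
  (x : M) → TangentSpace I x

/-- Fields of real-valued functions of two tangent vectors, used for fields of bilinear forms. -/
abbrev FormField (M : Type*) [TopologicalSpace M] [ChartedSpace H M] : Type _ :=
  (x : M) → TangentSpace I x → TangentSpace I x → ℝ

/-- Fields of continuous bilinear forms on the tangent spaces. -/
abbrev BilinField (M : Type*) [TopologicalSpace M] [ChartedSpace H M] : Type _ :=
  (x : M) → TangentSpace I x →L[ℝ] TangentSpace I x →L[ℝ] ℝ

variable {I}

/-- Forget continuity and linearity. -/
def BilinField.form (g : BilinField I M) : FormField I M := fun x v w => g x v w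

/-- The differential of a function. -/
def diff (f : M → ℝ) (x : M) (X : TangentSpace I x) : ℝ :=
  (mfderiv I 𝓘(ℝ, ℝ) f x X : ℝ)

/-- The gradient `grad f` with respect to `g`: `g(grad f, X) = df(X)`. -/
def grad (g : FormField I M) (f : M → ℝ) (x : M) : TangentSpace I x :=
  LocalGeom.sharp (E := E) (g x) (diff (I := I) f x)

/-- The endomorphism `h^♯` with `g(h^♯(Y), X) = h(Y, X)`. -/
def sharpEnd (g h : FormField I M) (x : M) (Y : TangentSpace I x) : TangentSpace I x :=
  LocalGeom.sharp (E := E) (g x) (h x Y)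

/-- A bilinear form is Lorentzian: symmetric, negative on some vector and positive definite on
the orthogonal complement of that vector. -/
def IsLorentzian (g : FormField I M) (x : M) : Prop :=
  (∀ v w, g x v w = g x w v) ∧
    ∃ τ, g x τ τ < 0 ∧ ∀ v, g x τ v = 0 → v ≠ 0 → 0 < g x v v

/-- A nonzero vector of length zero at every point of `s`. -/
def IsNullOn (g : FormField I M) (V : VecField I M) (s : Set M) : Prop :=
  ∀ x ∈ s, V x ≠ 0 ∧ g x (V x) (V x) = 0

variable [IsManifold I 1 M]

/-- A vector field in the coordinates given by the preferred chart around `x₀`. -/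
def vecInChart (x₀ : M) (X : VecField I M) (y : E) : E :=
  (trivializationAt E (TangentSpace I) x₀).continuousLinearMapAt ℝ ((extChartAt I x₀).symm y)
    (X ((extChartAt I x₀).symm y))

/-- A field of bilinear forms in the coordinates given by the preferred chart around `x₀`. -/
def formInChart (x₀ : M) (h : FormField I M) (y v w : E) : ℝ :=
  h ((extChartAt I x₀).symm y)
    ((trivializationAt E (TangentSpace I) x₀).symmL ℝ ((extChartAt I x₀).symm y) v)
    ((trivializationAt E (TangentSpace I) x₀).symmL ℝ ((extChartAt I x₀).symm y) w)

/-- `(∇_v X)(x)` for the Levi-Civita connection of `g`. -/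
def cov (g : FormField I M) (X : VecField I M) (x : M) (v : TangentSpace I x) :
    TangentSpace I x :=
  LocalGeom.cov (E := E) (formInChart x g) (vecInChart x X) (extChartAt I x x) v

/-- `(∇_v h)(a, b)` for a field `h` of bilinear forms and the Levi-Civita connection of `g`. -/
def covForm (g h : FormField I M) (x : M) (v a b : TangentSpace I x) : ℝ :=
  LocalGeom.covForm (E := E) (formInChart x g) (formInChart x h) (extChartAt I x x) v a b

/-- `d^∇ h (X, Y, Z) = (∇_X h)(Y, Z) - (∇_Y h)(X, Z)`. -/
def dNabla (g h : FormField I M) (x : M) (X Y Z : TangentSpace I x) : ℝ :=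
  covForm g h x X Y Z - covForm g h x Y X Z

/-- The curvature tensor `R(X, Y) Z` of `g`, with `R(X, Y) = [∇_X, ∇_Y] - ∇_[X, Y]`. -/
def curv (g : FormField I M) (x : M) (X Y Z : TangentSpace I x) : TangentSpace I x :=
  LocalGeom.curv (E := E) (formInChart x g) (extChartAt I x x) X Y Z

/-- `R(X, Y, Z, Z') = g(R(X, Y) Z, Z')`. -/
def riem (g : FormField I M) (x : M) (X Y Z Z' : TangentSpace I x) : ℝ :=
  g x (curv g x X Y Z) Z'

/-- The Hessian of `f` with respect to `g`. -/
def hess (g : FormField I M) (f : M → ℝ) (x : M) (X Y : TangentSpace I x) : ℝ :=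
  LocalGeom.hess (E := E) (formInChart x g) (fun y => f ((extChartAt I x).symm y)) (extChartAt I x x) X Y

/-- `V` is parallel on `s` for the Levi-Civita connection of `g`. -/
def IsParallelOn (g : FormField I M) (V : VecField I M) (s : Set M) : Prop :=
  ∀ x ∈ s, ∀ v, cov g V x v = 0

end General

/-! ### One-parameter families on `M` and the metric `-λ² dt² + g_t` on `ℝ × M` -/

section Families

variable {E : Type*} [NormedAddCommGroup E] [NormedSpace ℝ E]
  {M : Type*} [TopologicalSpace M] [ChartedSpace E M]

/-- The model of `ℝ × M`. -/
abbrev spaceTimeModel (E : Type*) [NormedAddCommGroup E] [NormedSpace ℝ E] :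
    ModelWithCorners ℝ (ℝ × E) (ModelProd ℝ E) := 𝓘(ℝ, ℝ).prod 𝓘(ℝ, E)

/-- The `t`-derivative of a family of functions. -/
def dotFun (f : ℝ → M → ℝ) (t : ℝ) (x : M) : ℝ := deriv (fun s => f s x) t

/-- The `t`-derivative of a family of fields of bilinear forms. -/
def dotForm (h : ℝ → FormField 𝓘(ℝ, E) M) (t : ℝ) : FormField 𝓘(ℝ, E) M :=
  fun x v w => deriv (fun s => h s x v w) t

/-- The `t`-derivative `[∂_t, X_t]` of a family of vector fields on `M`. -/
def dotVec (X : ℝ → VecField 𝓘(ℝ, E) M) (t : ℝ) : VecField 𝓘(ℝ, E) M :=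
  fun x => (deriv (fun s => (X s x : E)) t : E)

/-- The bilinear form `-λ² dt² + g_t` on `ℝ × M`, the tangent space at `(t, x)` being the product
of `ℝ` and the tangent space of `M` at `x`. -/
def lorentzMetric (lam : ℝ → M → ℝ) (g : ℝ → BilinField 𝓘(ℝ, E) M) :
    BilinField (spaceTimeModel E) (ℝ × M) := fun q =>
  let gq : E →L[ℝ] E →L[ℝ] ℝ := g q.1 q.2
  ((-(lam q.1 q.2 ^ 2)) •
      (ContinuousLinearMap.fst ℝ ℝ E).smulRight (ContinuousLinearMap.fst ℝ ℝ E)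
    + gq.bilinearComp (ContinuousLinearMap.snd ℝ ℝ E) (ContinuousLinearMap.snd ℝ ℝ E) :
    (ℝ × E) →L[ℝ] (ℝ × E) →L[ℝ] ℝ)

/-- The vector field `V = (u_t / λ) ∂_t - U_t` on `ℝ × M`. -/
def nullField (lam : ℝ → M → ℝ) (U : ℝ → VecField 𝓘(ℝ, E) M) (u : ℝ → M → ℝ) :
    VecField (spaceTimeModel E) (ℝ × M) := fun q =>
  ((u q.1 q.2 / lam q.1 q.2, -(U q.1 q.2 : E)) : ℝ × E)

variable [IsManifold 𝓘(ℝ, E) ω M]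

/-- The evolution system for `(g_t, U_t, u_t)` at the point `(t, x)`. -/
structure EvolutionAt (lam : ℝ → M → ℝ) (g : ℝ → FormField 𝓘(ℝ, E) M)
    (U : ℝ → VecField 𝓘(ℝ, E) M) (u : ℝ → M → ℝ) (t : ℝ) (x : M) : Prop where
  metric_eq : ∀ X Y : TangentSpace 𝓘(ℝ, E) x,
    dotForm (dotForm g) t x X Y =
      (lam t x) ^ 2 / u t x *
          (dNabla (g t) (fun z v w => dotForm g t z v w / lam t z) x (U t x) X Y
            + dNabla (g t) (fun z v w => dotForm g t z v w / lam t z) x (U t x) Y X)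
        + 1 / 2 * dotForm g t x X (sharpEnd (g t) (dotForm g t) x Y)
        + dotFun (fun s z => Real.log (lam s z)) t x * dotForm g t x X Y
        + 2 * lam t x * hess (g t) (lam t) x X Y
        + 2 * ((lam t x) ^ 2 / (u t x) ^ 2) * riem (g t) x X (U t x) (U t x) Y
        + 1 / (2 * (u t x) ^ 2) *
          (dotForm g t x X Y * dotForm g t x (U t x) (U t x)
            - dotForm g t x X (U t x) * dotForm g t x Y (U t x))
  vector_eq : ∀ X : TangentSpace 𝓘(ℝ, E) x,
    g t x (dotVec (dotVec U) t x) X =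
      - ((lam t x) ^ 2 / (2 * u t x)) *
          dNabla (g t) (fun z v w => dotForm g t z v w / lam t z) x (U t x) X (U t x)
        - 1 / 2 * dotFun (fun s z => Real.log (lam s z)) t x * dotForm g t x (U t x) X
        - lam t x * hess (g t) (lam t) x (U t x) X
        - dotForm g t x (dotVec U t x) X
        + u t x * g t x (dotVec (fun s => grad (g s) (lam s)) t x) X
        + u t x / 2 * dotForm g t x (grad (g t) (lam t) x) X
        + (2 * dotFun u t x - diff (lam t) x (U t x)) * diff (lam t) x X
  scalar_eq :
    dotFun (dotFun u) t x =
      g t x (dotVec (fun s => grad (g s) (lam s)) t x) (U t x)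
        + 2 * diff (lam t) x (dotVec U t x)
        + 3 / 2 * dotForm g t x (grad (g t) (lam t) x) (U t x)
        - u t x * g t x (grad (g t) (lam t) x) (grad (g t) (lam t) x)

/-- The initial conditions for `(g_t, U_t, u_t)` at `t = 0`. -/
structure InitialConditions (g₀ : BilinField 𝓘(ℝ, E) M)
    (W : (x : M) → TangentSpace 𝓘(ℝ, E) x →L[ℝ] TangentSpace 𝓘(ℝ, E) x)
    (U₀ : VecField 𝓘(ℝ, E) M) (u₀ : M → ℝ) (lam : ℝ → M → ℝ)
    (g : ℝ → BilinField 𝓘(ℝ, E) M) (U : ℝ → VecField 𝓘(ℝ, E) M) (u : ℝ → M → ℝ) : Prop where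
  metric : ∀ x, g 0 x = g₀ x
  metric_dot : ∀ x, ∀ X Y : TangentSpace 𝓘(ℝ, E) x,
    dotForm (fun t => (g t).form) 0 x X Y = -2 * lam 0 x * g₀ x (W x X) Y
  vector : ∀ x, U 0 x = U₀ x
  vector_dot : ∀ x, dotVec U 0 x = u₀ x • grad g₀.form (lam 0) x + lam 0 x • W x (U₀ x)
  scalar : ∀ x, u 0 x = u₀ x
  scalar_dot : ∀ x, dotFun u 0 x = diff (lam 0) x (U₀ x)

/-- Analytic families of Riemannian metrics `g_t`, vector fields `U_t` and functions `u_t`,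
defined on the open subset `𝓤` of `ℝ × M`, for which `-λ² dt² + g_t` has the parallel null vector
field `(u_t / λ) ∂_t - U_t`. Values outside `𝓤` are irrelevant. -/
structure IsParallelNullFamily (lam : ℝ → M → ℝ) (𝓤 : Set (ℝ × M))
    (g : ℝ → BilinField 𝓘(ℝ, E) M) (U : ℝ → VecField 𝓘(ℝ, E) M) (u : ℝ → M → ℝ) : Prop where
  symm : ∀ q ∈ 𝓤, ∀ v w : TangentSpace 𝓘(ℝ, E) q.2, g q.1 q.2 v w = g q.1 q.2 w v
  pos : ∀ q ∈ 𝓤, ∀ v : TangentSpace 𝓘(ℝ, E) q.2, v ≠ 0 → 0 < g q.1 q.2 v v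
  analytic_metric : ContMDiffOn (spaceTimeModel E)
    (𝓘(ℝ, E).prod 𝓘(ℝ, E →L[ℝ] E →L[ℝ] ℝ)) ω
    (fun q : ℝ × M => TotalSpace.mk' (E →L[ℝ] E →L[ℝ] ℝ)
      (E := fun x : M => TangentSpace 𝓘(ℝ, E) x →L[ℝ] TangentSpace 𝓘(ℝ, E) x →L[ℝ] ℝ)
      q.2 (g q.1 q.2)) 𝓤
  analytic_vector : ContMDiffOn (spaceTimeModel E) 𝓘(ℝ, E).tangent ω
    (fun q : ℝ × M => (⟨q.2, U q.1 q.2⟩ : TangentBundle 𝓘(ℝ, E) M)) 𝓤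
  analytic_scalar : ContMDiffOn (spaceTimeModel E) 𝓘(ℝ, ℝ) ω
    (fun q : ℝ × M => u q.1 q.2) 𝓤
  null : IsNullOn (lorentzMetric lam g).form (nullField lam U u) 𝓤
  parallel : IsParallelOn (lorentzMetric lam g).form (nullField lam U u) 𝓤

/-- `h` is an analytic Lorentzian metric on the open subset `𝓤` of `ℝ × M`. -/
structure IsAnalyticLorentzMetricOn (h : BilinField (spaceTimeModel E) (ℝ × M))
    (𝓤 : Set (ℝ × M)) : Prop where
  lorentzian : ∀ q ∈ 𝓤, IsLorentzian h.form q
  analytic : ContMDiffOn (spaceTimeModel E)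
    ((spaceTimeModel E).prod 𝓘(ℝ, (ℝ × E) →L[ℝ] (ℝ × E) →L[ℝ] ℝ)) ω
    (fun q : ℝ × M => TotalSpace.mk' ((ℝ × E) →L[ℝ] (ℝ × E) →L[ℝ] ℝ)
      (E := fun q : ℝ × M => TangentSpace (spaceTimeModel E) q →L[ℝ]
        TangentSpace (spaceTimeModel E) q →L[ℝ] ℝ) q (h q)) 𝓤

/-- `V` is an analytic vector field on the open subset `𝓤` of `ℝ × M`. -/
def IsAnalyticVecFieldOn (V : VecField (spaceTimeModel E) (ℝ × M)) (𝓤 : Set (ℝ × M)) : Prop :=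
  ContMDiffOn (spaceTimeModel E) (spaceTimeModel E).tangent ω
    (fun q : ℝ × M => (⟨q, V q⟩ : TangentBundle (spaceTimeModel E) (ℝ × M))) 𝓤

end Families

end Geom

end

section

set_option maxSynthPendingDepth 3
set_option linter.unusedSectionVars false

noncomputable section

/-! Splitting the Koszul formula of `-λ² dt² + g_t` into time and space components shows that `V =
(u/λ) ∂_t - U` is parallel exactly when `u̇ = dλ(U)`, `g(U̇, ·) = u dλ - ½ ġ(U, ·)`, `ġ(·, U) = 2λ
du` and `u ġ = 2λ g(∇U, ·)` (`koszul_lorentzForm_eq_zero_iff`). It is null exactly when `u ≠ 0` and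
`u² = g(U, U)` (`null_iff`). For the one-form `β = g(U, ·)` these equations imply the first order
quasilinear system `β̇ = d(λu)`, `u̇ = dλ(U)`, `ġ = (λ/u) L_U g` (`ParallelFamily.system`), which is
solved for the time derivatives. Cauchy–Kovalevskaya therefore gives local existence and uniqueness
for `(β, u, g)`.

Conversely, a solution of the system satisfies the overdetermined equations as soon as `β` is
closed, `g` is symmetric and `u² = g(U, U)` (`parallelAt_of_system`). All three properties propagate
from `t = 0`: the exterior derivative of `β` is constant in time because `β̇` is exact, while the
antisymmetric part of `g` and the function `u² - g(U, U)` solve homogeneous linear transport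
equations (`exists_parallelFamily`). At `t = 0` closedness comes from the constraint: `∇U = -uW`
with `W` symmetric. The initial values of the time derivatives are the parallel equations read at `t
= 0`.

The second order system is not used to construct the solution; it is a consequence. With `h = ġ/λ`,
the time derivative of `u h = 2 g(∇U, ·)` gives an evolution equation for `ġ`, and the
antisymmetrized space derivative gives a Codazzi type identity (`codazzi`) that produces the
curvature term. The equations for `U` and `u` follow by differentiating the parallel equations once
more in time.

The Cauchy–Kovalevskaya theorem is proved by a fixed point argument in an `ℓ¹` space of power
series. The monomials are weighted by the binomial coefficient of total degree over time degree; for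
this norm products are bounded and, decisively, so is `w ↦ ∫ f ∂ₗw dt` (`count_mul_weight_le`), so
that no derivative is lost. After rescaling, the integrated equation reads `w = ε Φ(ε, w)` with `Φ`
analytic, and has a solution for some small `ε > 0` (`exists_eq_smul`). Uniqueness holds because the
equation determines all Taylor coefficients in time.

On the manifold, uniqueness along the fibres `{t | (t, x) ∈ 𝓤}` lets the local solutions be glued to
one on a neighbourhood of `{0} × M` (`IsInitialData.exists_family`). -/

/-! ### Bounded operators on `ℓ¹` spaces defined by their values on the basis vectors -/

section EllOne

variable {σ τ : Type*} {F G F₁ F₂ F₃ : Type*}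
  [NormedAddCommGroup F] [NormedSpace ℝ F] [NormedAddCommGroup G] [NormedSpace ℝ G]
  [NormedAddCommGroup F₁] [NormedSpace ℝ F₁] [NormedAddCommGroup F₂] [NormedSpace ℝ F₂]
  [NormedAddCommGroup F₃] [NormedSpace ℝ F₃]

/-- Summable families of vectors. -/
abbrev EllOne (σ F : Type*) [NormedAddCommGroup F] : Type _ := lp (fun _ : σ => F) 1

namespace EllOne

lemma hasSum_norm' {F : Type*} [NormedAddCommGroup F] (f : EllOne σ F) : HasSum (fun i => ‖f i‖) ‖f‖ := by
  simpa using lp.hasSum_norm (p := 1) (by simp) f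

open Classical in
/-- The basis vector of index `i` with coefficient `v`. -/
def single (i : σ) : F →L[ℝ] EllOne σ F := lp.singleContinuousLinearMap ℝ (fun _ : σ => F) 1 i

lemma norm_single_apply (i : σ) (v : F) : ‖single i v‖ = ‖v‖ := by
  classical
  simp only [single, lp.singleContinuousLinearMap_apply]
  convert lp.norm_single (E := fun _ : σ => F) (p := 1) one_pos i v

lemma norm_single_le (i : σ) : ‖(single i : F →L[ℝ] EllOne σ F)‖ ≤ 1 :=
  ContinuousLinearMap.opNorm_le_bound _ zero_le_one fun v => by rw [norm_single_apply, one_mul]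

lemma single_coe (i : σ) (v : F) [DecidableEq σ] (j : σ) :
    (single i v : EllOne σ F) j = if j = i then v else 0 := by
  simp only [single, lp.singleContinuousLinearMap_apply, lp.single_apply, Pi.single_apply]
  congr

lemma hasSum_single' (f : EllOne σ F) : HasSum (fun i => single i (f i)) f := by
  classical
  have := lp.hasSum_single (E := fun _ : σ => F) (p := 1) (by simp) f
  simp only [single, lp.singleContinuousLinearMap_apply]
  convert this

/-- Finitely supported families are dense in `ℓ¹`. Through this lemma the operator identities for
power series reduce to identities between monomials. -/
lemma clm_ext {A B : EllOne σ F →L[ℝ] G} (h : ∀ i v, A (single i v) = B (single i v)) :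
    A = B := by
  ext f
  have h1 := (hasSum_single' f).mapL A
  have h2 := (hasSum_single' f).mapL B
  simp only [h] at h1
  exact h1.unique h2

lemma clm_ext₂ {A B : EllOne σ F₁ →L[ℝ] EllOne τ F₂ →L[ℝ] G}
    (h : ∀ i j v w, A (single i v) (single j w) = B (single i v) (single j w)) : A = B :=
  clm_ext fun i v => clm_ext fun j w => h i j v w

variable [CompleteSpace G]

lemma summable_lift {T : σ → F →L[ℝ] G} {C : ℝ} (hT : ∀ i, ‖T i‖ ≤ C) (f : EllOne σ F) :
    Summable fun i => T i (f i) :=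
  Summable.of_norm_bounded ((hasSum_norm' f).summable.mul_left C) fun i =>
    (T i).le_of_opNorm_le (hT i) _

/-- The operator on `ℓ¹` which is `T i` on the `i`-th coordinate. -/
def lift (T : σ → F →L[ℝ] G) (C : ℝ) (hT : ∀ i, ‖T i‖ ≤ C) : EllOne σ F →L[ℝ] G :=
  LinearMap.mkContinuous
    { toFun := fun f => ∑' i, T i (f i)
      map_add' := fun f g => by
        rw [← (summable_lift hT f).tsum_add (summable_lift hT g)]
        simp
      map_smul' := fun c f => by
        simp [tsum_const_smul''] } C
    fun f => by
      have h := (hasSum_norm' f).mul_left C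
      exact tsum_of_norm_bounded h fun i => (T i).le_of_opNorm_le (hT i) _

lemma lift_single {T : σ → F →L[ℝ] G} {C : ℝ} (hT : ∀ i, ‖T i‖ ≤ C) (i : σ) (v : F) :
    lift T C hT (single i v) = T i v := by
  classical
  change ∑' j, T j ((single i v : EllOne σ F) j) = _
  rw [tsum_eq_single i]
  · simp [single_coe]
  · intro j hj
    simp [single_coe, hj]

lemma norm_lift_le {T : σ → F →L[ℝ] G} {C : ℝ} (hC : 0 ≤ C) (hT : ∀ i, ‖T i‖ ≤ C) :
    ‖lift T C hT‖ ≤ C :=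
  LinearMap.mkContinuous_norm_le _ hC _

/-- The bilinear operator on `ℓ¹` spaces with values `B i j` on pairs of coordinates. -/
def lift₂ (B : σ → τ → F₁ →L[ℝ] F₂ →L[ℝ] G) (C : ℝ) (hC : 0 ≤ C) (hB : ∀ i j, ‖B i j‖ ≤ C) :
    EllOne σ F₁ →L[ℝ] EllOne τ F₂ →L[ℝ] G :=
  lift (fun i => (lift (fun j => (B i j).flip) C
    (fun j => by rw [ContinuousLinearMap.opNorm_flip]; exact hB i j)).flip) C
    fun i => by
      rw [ContinuousLinearMap.opNorm_flip]
      exact norm_lift_le hC _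

lemma lift₂_single {B : σ → τ → F₁ →L[ℝ] F₂ →L[ℝ] G} {C : ℝ} {hC : 0 ≤ C}
    {hB : ∀ i j, ‖B i j‖ ≤ C} (i : σ) (j : τ) (v : F₁) (w : F₂) :
    lift₂ B C hC hB (single i v) (single j w) = B i j v w := by
  rw [lift₂, lift_single, ContinuousLinearMap.flip_apply, lift_single,
    ContinuousLinearMap.flip_apply]

lemma norm_lift₂_le {B : σ → τ → F₁ →L[ℝ] F₂ →L[ℝ] G} {C : ℝ} {hC : 0 ≤ C}
    {hB : ∀ i j, ‖B i j‖ ≤ C} : ‖lift₂ B C hC hB‖ ≤ C :=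
  norm_lift_le hC _

variable [CompleteSpace F₂]

/-- The operator induced on `ℓ¹` spaces by a linear map of the coefficients. -/
def map (A : F₁ →L[ℝ] F₂) : EllOne σ F₁ →L[ℝ] EllOne σ F₂ :=
  lift (fun i => (single i).comp A) ‖A‖ fun i => by
    refine (ContinuousLinearMap.opNorm_comp_le _ _).trans ?_
    simpa using mul_le_mul_of_nonneg_right (norm_single_le (F := F₂) i) (norm_nonneg A)

lemma map_single (A : F₁ →L[ℝ] F₂) (i : σ) (v : F₁) : map A (single i v) = single i (A v) := by
  rw [map, lift_single, ContinuousLinearMap.comp_apply]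

end EllOne

end EllOne

end

noncomputable section

/-! ### Convergent power series in time and space with weights adapted to the operator
`∫ dt ∂ₓ`

The index `none` stands for the time variable, the indices `some l` for the space variables; the
basis vector of index `s` represents the monomial `z ^ s` multiplied by a binomial coefficient. -/

namespace WeightedSeries

variable {ι : Type*} [DecidableEq ι]

/-- The weight of a monomial of degree `k` in time and total degree `n` is `n.choose k`. -/
def weight (s : Multiset (Option ι)) : ℕ := (Multiset.card s).choose (s.count none)

lemma weight_pos (s : Multiset (Option ι)) : 0 < weight s :=
  Nat.choose_pos (Multiset.count_le_card _ _)

/-- The right side is a Vandermonde sum and the left side is one of its terms. This bounds the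
product of two series by the product of their norms. -/
lemma weight_mul_le (r s : Multiset (Option ι)) : weight r * weight s ≤ weight (r + s) := by
  unfold weight
  rw [Multiset.card_add, Multiset.count_add, Nat.add_choose_eq]
  exact Finset.single_le_sum
    (f := fun ij : ℕ × ℕ => (Multiset.card r).choose ij.1 * (Multiset.card s).choose ij.2)
    (fun _ _ => Nat.zero_le _)
    ((Finset.HasAntidiagonal.mem_antidiagonal (a := (r.count none, s.count none))).2 rfl)

/-- This bound is the reason why series can be evaluated on the polydisc `‖z‖ < 1/2`. -/
lemma weight_le (s : Multiset (Option ι)) : weight s ≤ 2 ^ (Multiset.card s) :=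
  Nat.choose_le_two_pow _ _

/-- In other words, integrating a normalised monomial of degree `n` in time divides it by `n + 1`.
-/
lemma weight_cons (s : Multiset (Option ι)) :
    weight (none ::ₘ s) * (s.count none + 1) = (Multiset.card s + 1) * weight s := by
  unfold weight
  rw [Multiset.card_cons, Multiset.count_cons_self]
  exact (Nat.add_one_mul_choose_eq _ _).symm

lemma count_add_count_le_card (s : Multiset (Option ι)) (l : ι) :
    s.count none + s.count (some l) ≤ Multiset.card s := by
  induction s using Multiset.induction_on with
  | empty => simp
  | cons a s ih =>
    rcases eq_or_ne a none with rfl | ha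
    · simp; omega
    · rcases eq_or_ne a (some l) with rfl | hb
      · simp; omega
      · rw [Multiset.count_cons_of_ne ha.symm, Multiset.count_cons_of_ne hb.symm,
          Multiset.card_cons]
        omega

/-- The key estimate behind `intMulDeriv`. With `n` the total degree and `k` the time degree of `r +
s`, one has `C(n, k+1) (k+1) = C(n, k) (n - k)`. The exponent of `l`, which the space derivative
produces, is at most `n - k`, so the growth of the weight under time integration absorbs it. -/
lemma count_mul_weight_le (r s : Multiset (Option ι)) (l : ι) :
    s.count (some l) * weight r * weight s ≤
      weight (none ::ₘ (r + s.erase (some l))) * ((r + s.erase (some l)).count none + 1) := by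
  by_cases h : some l ∈ s
  · have hcard : Multiset.card (none ::ₘ (r + s.erase (some l))) = Multiset.card (r + s) := by
      rw [Multiset.card_cons, Multiset.card_add, Multiset.card_add, Multiset.card_erase_of_mem h]
      have := Multiset.card_pos_iff_exists_mem.2 ⟨_, h⟩
      have h2 := Nat.succ_pred_eq_of_pos this
      omega
    have hcount : (r + s.erase (some l)).count none = (r + s).count none := by
      rw [Multiset.count_add, Multiset.count_add, Multiset.count_erase_of_ne (by simp)]
    have hw : weight (none ::ₘ (r + s.erase (some l)))
        = (Multiset.card (r + s)).choose ((r + s).count none + 1) := by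
      rw [weight, hcard, Multiset.count_cons_self, hcount]
    rw [hw, hcount, Nat.choose_succ_right_eq]
    have h1 : s.count (some l) ≤ Multiset.card (r + s) - (r + s).count none := by
      have := count_add_count_le_card (r + s) l
      have h2 : s.count (some l) ≤ (r + s).count (some l) := by simp
      omega
    calc s.count (some l) * weight r * weight s
        = (weight r * weight s) * s.count (some l) := by ring
      _ ≤ weight (r + s) * (Multiset.card (r + s) - (r + s).count none) :=
        Nat.mul_le_mul (weight_mul_le r s) h1
  · simp [Multiset.count_eq_zero_of_notMem h]


variable {F F₁ F₂ F₃ : Type*} [NormedAddCommGroup F] [NormedSpace ℝ F] [CompleteSpace F]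
  [NormedAddCommGroup F₁] [NormedSpace ℝ F₁]
  [NormedAddCommGroup F₂] [NormedSpace ℝ F₂]
  [NormedAddCommGroup F₃] [NormedSpace ℝ F₃] [CompleteSpace F₃]

open EllOne

lemma norm_smul_single_comp_le {σ F : Type*} [NormedAddCommGroup F] [NormedSpace ℝ F] {c : ℝ}
    (hc0 : 0 ≤ c) (hc : c ≤ 1) (m : F₁ →L[ℝ] F₂ →L[ℝ] F) (i : σ) :
    ‖c • (ContinuousLinearMap.compL ℝ F₂ F (EllOne σ F) (single i)).comp m‖ ≤ ‖m‖ := by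
  rw [norm_smul, Real.norm_of_nonneg hc0]
  have h : ‖(ContinuousLinearMap.compL ℝ F₂ F (EllOne σ F) (single i)).comp m‖ ≤ ‖m‖ := by
    refine (ContinuousLinearMap.opNorm_comp_le _ _).trans ?_
    have h1 : ‖ContinuousLinearMap.compL ℝ F₂ F (EllOne σ F) (single i)‖ ≤ 1 := by
      refine ((ContinuousLinearMap.compL ℝ F₂ F (EllOne σ F)).le_opNorm _).trans ?_
      exact mul_le_one₀ (ContinuousLinearMap.norm_compL_le _ _ _ _) (norm_nonneg _)
        (norm_single_le i)
    simpa using mul_le_mul_of_nonneg_right h1 (norm_nonneg m)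
  exact (mul_le_of_le_one_left (norm_nonneg _) hc).trans h

/-- The product of two series, with coefficients multiplied by `m`. -/
def mul (m : F₁ →L[ℝ] F₂ →L[ℝ] F) : EllOne (Multiset (Option ι)) F₁ →L[ℝ]
    EllOne (Multiset (Option ι)) F₂ →L[ℝ] EllOne (Multiset (Option ι)) F :=
  lift₂ (fun r s => ((weight r * weight s : ℝ) / weight (r + s)) •
    (ContinuousLinearMap.compL ℝ F₂ F _ (single (r + s))).comp m) ‖m‖ (norm_nonneg _)
    fun r s => norm_smul_single_comp_le (by positivity) (div_le_one_of_le₀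
      (by exact_mod_cast weight_mul_le r s) (by positivity)) _ _

lemma mul_single (m : F₁ →L[ℝ] F₂ →L[ℝ] F) (r s : Multiset (Option ι)) (v : F₁) (w : F₂) :
    mul m (single r v) (single s w) =
      ((weight r * weight s : ℝ) / weight (r + s)) • single (r + s) (m v w) := by
  rw [mul, lift₂_single]
  simp

lemma norm_mul_le (m : F₁ →L[ℝ] F₂ →L[ℝ] F) : ‖mul (ι := ι) m‖ ≤ ‖m‖ :=
  norm_lift₂_le

/-- The series `∫ m(f, ∂ₗ w) dt`. -/
def intMulDeriv (m : F₁ →L[ℝ] F₂ →L[ℝ] F) (l : ι) : EllOne (Multiset (Option ι)) F₁ →L[ℝ]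
    EllOne (Multiset (Option ι)) F₂ →L[ℝ] EllOne (Multiset (Option ι)) F :=
  lift₂ (fun r s => ((s.count (some l) * weight r * weight s : ℝ) /
      (weight (none ::ₘ (r + s.erase (some l))) * ((r + s.erase (some l)).count none + 1))) •
    (ContinuousLinearMap.compL ℝ F₂ F _ (single (none ::ₘ (r + s.erase (some l))))).comp m)
    ‖m‖ (norm_nonneg _)
    fun r s => norm_smul_single_comp_le (by positivity) (div_le_one_of_le₀
      (by exact_mod_cast count_mul_weight_le r s l) (by positivity)) _ _

lemma intMulDeriv_single (m : F₁ →L[ℝ] F₂ →L[ℝ] F) (l : ι) (r s : Multiset (Option ι))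
    (v : F₁) (w : F₂) : intMulDeriv m l (single r v) (single s w) =
      ((s.count (some l) * weight r * weight s : ℝ) /
      (weight (none ::ₘ (r + s.erase (some l))) * ((r + s.erase (some l)).count none + 1))) •
      single (none ::ₘ (r + s.erase (some l))) (m v w) := by
  rw [intMulDeriv, lift₂_single]
  simp

/-- The series `∫ f dt`. -/
def int : EllOne (Multiset (Option ι)) F →L[ℝ] EllOne (Multiset (Option ι)) F :=
  lift (fun s => ((weight s : ℝ) / (weight (none ::ₘ s) * (s.count none + 1))) •
    single (none ::ₘ s)) 1 fun s => by
      rw [norm_smul, Real.norm_of_nonneg (by positivity)]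
      refine mul_le_one₀ (div_le_one_of_le₀ ?_ (by positivity)) (norm_nonneg _) (norm_single_le _)
      have h := weight_cons s
      have : weight s ≤ weight (none ::ₘ s) * (s.count none + 1) := by
        rw [h]; exact Nat.le_mul_of_pos_left _ (Nat.succ_pos _)
      exact_mod_cast this

lemma int_single (s : Multiset (Option ι)) (v : F) : int (single s v) =
    ((weight s : ℝ) / (weight (none ::ₘ s) * (s.count none + 1))) • single (none ::ₘ s) v := by
  rw [int, lift_single]
  simp

/-- The monomial `z ^ s`. -/
def monomial (s : Multiset (Option ι)) (z : Option ι → ℝ) : ℝ := (s.map z).prod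


/-- A multilinear map of `n` variables with diagonal the monomial `z ^ s` of degree `n`. -/
def monomialMultilinear (n : ℕ) (s : Multiset (Option ι)) :
    ContinuousMultilinearMap ℝ (fun _ : Fin n => Option ι → ℝ) ℝ :=
  (ContinuousMultilinearMap.mkPiAlgebraFin ℝ n ℝ).compContinuousLinearMap
    -- The default `none` is never reached when `s` has degree `n`.
    fun j => ContinuousLinearMap.proj (s.toList.getD j none)

lemma monomialMultilinear_diag {n : ℕ} {s : Multiset (Option ι)} (hs : Multiset.card s = n)
    (z : Option ι → ℝ) : monomialMultilinear n s (fun _ => z) = monomial s z := by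
  have h : (List.ofFn fun j : Fin n => z (s.toList.getD j none)) = s.toList.map z := by
    apply List.ext_getElem
    · simp [hs]
    · intro i h1 h2
      have : i < s.toList.length := by simpa using h2
      simp [List.getElem?_eq_getElem this]
  simp only [monomialMultilinear, ContinuousMultilinearMap.compContinuousLinearMap_apply,
    ContinuousMultilinearMap.mkPiAlgebraFin_apply, ContinuousLinearMap.proj_apply, h, monomial]
  conv_rhs => rw [← Multiset.coe_toList s]
  rw [Multiset.map_coe, Multiset.prod_coe]

variable [Fintype ι]

lemma norm_monomialMultilinear_le (n : ℕ) (s : Multiset (Option ι)) :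
    ‖monomialMultilinear n s‖ ≤ 1 := by
  refine (ContinuousMultilinearMap.norm_compContinuousLinearMap_le _ _).trans ?_
  rw [ContinuousMultilinearMap.norm_mkPiAlgebraFin, one_mul]
  refine Finset.prod_le_one (fun _ _ => norm_nonneg _) fun j _ => ?_
  exact ContinuousLinearMap.opNorm_le_bound _ zero_le_one fun z => by
    simpa using norm_le_pi_norm z _

/-- The power series of the evaluation of weighted series. -/
def evalSeries (F : Type*) [NormedAddCommGroup F] [NormedSpace ℝ F] [CompleteSpace F] :
    FormalMultilinearSeries ℝ (Option ι → ℝ) (EllOne (Multiset (Option ι)) F →L[ℝ] F) :=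
  fun n => (lift (fun s => if Multiset.card s = n then
      (weight s : ℝ) • ContinuousMultilinearMap.smulRightL ℝ _ F (monomialMultilinear n s) else 0)
    (2 ^ n) fun s => by
      split_ifs with h
      · rw [norm_smul, Real.norm_of_nonneg (by positivity)]
        have h1 : ‖ContinuousMultilinearMap.smulRightL ℝ _ F (monomialMultilinear n s)‖ ≤ 1 := by
          refine (ContinuousLinearMap.le_opNorm _ _).trans ?_
          exact mul_le_one₀ ContinuousMultilinearMap.norm_smulRightL_le (norm_nonneg _)
            (norm_monomialMultilinear_le n s)
        have h2 : (weight s : ℝ) ≤ 2 ^ n := by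
          rw [← h]; exact_mod_cast weight_le s
        calc _ ≤ (2 : ℝ) ^ n * 1 := by gcongr
          _ = 2 ^ n := mul_one _
      · simp).flipMultilinear

lemma norm_evalSeries_le (n : ℕ) : ‖evalSeries (ι := ι) F n‖ ≤ 2 ^ n := by
  refine ContinuousMultilinearMap.opNorm_le_bound (by positivity) fun m => ?_
  refine ContinuousLinearMap.opNorm_le_bound _ (by positivity) fun f => ?_
  simp only [evalSeries, ContinuousLinearMap.flipMultilinear_apply_apply]
  refine (ContinuousMultilinearMap.le_opNorm _ _).trans ?_
  rw [mul_right_comm]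
  gcongr
  exact ContinuousLinearMap.le_of_opNorm_le _ (norm_lift_le (by positivity) _) _

lemma le_radius_evalSeries : ENNReal.ofReal (1 / 2) ≤ (evalSeries (ι := ι) F).radius := by
  refine FormalMultilinearSeries.le_radius_of_bound _ 1 fun n => ?_
  calc ‖evalSeries (ι := ι) F n‖ * ((Real.toNNReal (1/2) : NNReal) : ℝ) ^ n
      ≤ 2 ^ n * (1 / 2) ^ n := by
        rw [Real.coe_toNNReal _ (by norm_num)]
        gcongr
        exact norm_evalSeries_le n
    _ = 1 := by rw [← mul_pow]; norm_num

/-- The sum of a weighted series at the point `z`. -/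
def eval (z : Option ι → ℝ) : EllOne (Multiset (Option ι)) F →L[ℝ] F :=
  (evalSeries F).sum z

lemma hasFPowerSeriesOnBall_eval :
    HasFPowerSeriesOnBall (eval (F := F)) (evalSeries (ι := ι) F) 0 (evalSeries (ι := ι) F).radius :=
  FormalMultilinearSeries.hasFPowerSeriesOnBall _
    (lt_of_lt_of_le (by simp) le_radius_evalSeries)

lemma mem_radius {z : Option ι → ℝ} (hz : ‖z‖ < 1 / 2) :
    z ∈ Metric.eball (0 : Option ι → ℝ) (evalSeries (ι := ι) F).radius := by
  refine Metric.eball_subset_eball le_radius_evalSeries ?_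
  rw [Metric.eball_ofReal]
  simpa using hz

/-- Analyticity is in the operator norm, so applying `eval` to a fixed series gives an analytic
function of `z`. -/
lemma analyticAt_eval {z : Option ι → ℝ} (hz : ‖z‖ < 1 / 2) :
    AnalyticAt ℝ (eval (F := F)) z :=
  hasFPowerSeriesOnBall_eval.analyticAt_of_mem (mem_radius hz)

lemma eval_single {z : Option ι → ℝ} (hz : ‖z‖ < 1 / 2) (s : Multiset (Option ι)) (v : F) :
    eval z (single s v) = (weight s * monomial s z) • v := by
  have h := (hasFPowerSeriesOnBall_eval (F := F)).hasSum (mem_radius hz)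
  rw [zero_add] at h
  have h1 := h.mapL (ContinuousLinearMap.apply ℝ F (single s v))
  simp only [ContinuousLinearMap.apply_apply] at h1
  refine h1.unique ?_
  -- Only the homogeneous term of degree `card s` sees the basis vector of index `s`.
  convert hasSum_single (Multiset.card s) ?_ using 1
  · simp only [evalSeries, ContinuousLinearMap.flipMultilinear_apply_apply, lift_single]
    simp [monomialMultilinear_diag rfl, smul_smul]
  · intro n hn
    simp only [evalSeries, ContinuousLinearMap.flipMultilinear_apply_apply, lift_single]
    simp [hn.symm]

end WeightedSeries

end

/-! ### Evaluation of weighted series, and composition of series with analytic maps -/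

noncomputable section

namespace WeightedSeries

open EllOne

variable {ι : Type*}

lemma monomial_cons (a : Option ι) (s : Multiset (Option ι)) (z : Option ι → ℝ) :
    monomial (a ::ₘ s) z = z a * monomial s z := by
  simp [monomial]

lemma monomial_add (r s : Multiset (Option ι)) (z : Option ι → ℝ) :
    monomial (r + s) z = monomial r z * monomial s z := by
  simp [monomial]

variable [Fintype ι]

lemma abs_monomial_le (s : Multiset (Option ι)) (z : Option ι → ℝ) :
    |monomial s z| ≤ ‖z‖ ^ Multiset.card s := by
  induction s using Multiset.induction_on with
  | empty => simp [monomial]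
  | cons a s ih =>
    rw [monomial_cons, abs_mul, Multiset.card_cons, pow_succ']
    exact mul_le_mul (norm_le_pi_norm z a) ih (abs_nonneg _) (norm_nonneg _)

lemma differentiable_monomial (s : Multiset (Option ι)) : Differentiable ℝ (monomial s) := by
  induction s using Multiset.induction_on with
  | empty =>
    have : (monomial (0 : Multiset (Option ι))) = fun _ => (1 : ℝ) := by ext; simp [monomial]
    rw [this]
    fun_prop
  | cons a s ih =>
    have : monomial (a ::ₘ s) = fun z => z a * monomial s z := funext (monomial_cons a s)
    rw [this]
    fun_prop

variable [DecidableEq ι]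

lemma fderiv_monomial (s : Multiset (Option ι)) (z : Option ι → ℝ) (l : Option ι) :
    fderiv ℝ (monomial s) z (Pi.single l 1) = s.count l * monomial (s.erase l) z := by
  induction s using Multiset.induction_on with
  | empty =>
    have : (monomial (0 : Multiset (Option ι))) = fun _ => (1 : ℝ) := by ext; simp [monomial]
    simp [this]
  | cons a s ih =>
    have h1 : monomial (a ::ₘ s) = fun z => z a * monomial s z := funext (monomial_cons a s)
    have h2 : DifferentiableAt ℝ (fun z : Option ι → ℝ => z a) z := by fun_prop
    have h3 : fderiv ℝ (fun z : Option ι → ℝ => z a) z = ContinuousLinearMap.proj a :=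
      (ContinuousLinearMap.proj (R := ℝ) (φ := fun _ : Option ι => ℝ) a).fderiv
    rw [h1, fderiv_fun_mul h2 (differentiable_monomial s z), h3]
    simp only [add_apply, smul_apply, ih,
      ContinuousLinearMap.proj_apply, smul_eq_mul]
    rcases eq_or_ne a l with rfl | hal
    · rw [Pi.single_eq_same, Multiset.count_cons_self, Multiset.erase_cons_head]
      by_cases has : a ∈ s
      · have : monomial s z = z a * monomial (s.erase a) z := by
          rw [← monomial_cons, Multiset.cons_erase has]
        rw [this]; push_cast; ring
      · simp [Multiset.count_eq_zero_of_notMem has]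
    · rw [Pi.single_eq_of_ne hal, Multiset.count_cons_of_ne hal.symm,
        Multiset.erase_cons_tail s hal, monomial_cons]
      ring

variable {F F₁ F₂ : Type*} [NormedAddCommGroup F] [NormedSpace ℝ F] [CompleteSpace F]
  [NormedAddCommGroup F₁] [NormedSpace ℝ F₁] [CompleteSpace F₁]
  [NormedAddCommGroup F₂] [NormedSpace ℝ F₂] [CompleteSpace F₂]

lemma abs_weight_mul_monomial_le {z : Option ι → ℝ} (hz : ‖z‖ < 1 / 2)
    (s : Multiset (Option ι)) : |weight s * monomial s z| ≤ 1 := by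
  rw [abs_mul, Nat.abs_cast]
  calc (weight s : ℝ) * |monomial s z| ≤ 2 ^ Multiset.card s * ‖z‖ ^ Multiset.card s := by
        gcongr
        · exact_mod_cast weight_le s
        · exact abs_monomial_le s z
    _ = (2 * ‖z‖) ^ Multiset.card s := (mul_pow _ _ _).symm
    _ ≤ 1 := pow_le_one₀ (by positivity) (by linarith)

lemma norm_eval_le {z : Option ι → ℝ} (hz : ‖z‖ < 1 / 2) :
    ‖(eval z : EllOne (Multiset (Option ι)) F →L[ℝ] F)‖ ≤ 1 := by
  have hb : ∀ s : Multiset (Option ι),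
      ‖(weight s * monomial s z) • ContinuousLinearMap.id ℝ F‖ ≤ 1 := fun s => by
    rw [norm_smul, Real.norm_eq_abs]
    exact mul_le_one₀ (abs_weight_mul_monomial_le hz s) (norm_nonneg _)
      ContinuousLinearMap.norm_id_le
  have : (eval z : EllOne (Multiset (Option ι)) F →L[ℝ] F) = lift _ 1 hb :=
    clm_ext fun s v => by rw [eval_single hz, lift_single]; simp
  rw [this]
  exact norm_lift_le zero_le_one hb

lemma norm_eval_apply_le {z : Option ι → ℝ} (hz : ‖z‖ < 1 / 2)
    (w : EllOne (Multiset (Option ι)) F) : ‖eval z w‖ ≤ ‖w‖ := by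
  have h := (eval (F := F) z).le_opNorm w
  have h1 := norm_eval_le (F := F) hz
  nlinarith [norm_nonneg w]

lemma eval_mul {z : Option ι → ℝ} (hz : ‖z‖ < 1 / 2) (m : F₁ →L[ℝ] F₂ →L[ℝ] F)
    (f : EllOne (Multiset (Option ι)) F₁) (g : EllOne (Multiset (Option ι)) F₂) :
    eval z (mul m f g) = m (eval z f) (eval z g) := by
  have : (ContinuousLinearMap.compL ℝ _ _ _ (eval z)).comp (mul m) =
      m.bilinearComp (eval z) (eval z) := clm_ext₂ fun r s v w => by
    have hw : (weight (r + s) : ℝ) ≠ 0 := by exact_mod_cast (weight_pos _).ne'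
    simp only [ContinuousLinearMap.comp_apply, ContinuousLinearMap.compL_apply, mul_single,
      map_smul, eval_single hz, monomial_add, ContinuousLinearMap.bilinearComp_apply, smul_smul,
      smul_apply]
    congr 1
    field_simp
  exact congr($this f g)

lemma eval_map {z : Option ι → ℝ} (hz : ‖z‖ < 1 / 2) (A : F₁ →L[ℝ] F₂)
    (f : EllOne (Multiset (Option ι)) F₁) : eval z (EllOne.map A f) = A (eval z f) := by
  have : (eval z).comp (EllOne.map A) = A.comp (eval z) := clm_ext fun s v => by
    simp [map_single, eval_single hz]
  exact congr($this f)

lemma fderiv_eval_single {z : Option ι → ℝ} (hz : ‖z‖ < 1 / 2) (l : Option ι)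
    (s : Multiset (Option ι)) (v : F) :
    fderiv ℝ (eval (F := F)) z (Pi.single l 1) (single s v) =
      (weight s * (s.count l * monomial (s.erase l) z)) • v := by
  have hd := (analyticAt_eval (F := F) hz).differentiableAt
  have h1 : fderiv ℝ (fun z' => eval z' (single s v)) z (Pi.single l 1) =
      fderiv ℝ (eval (F := F)) z (Pi.single l 1) (single s v) := by
    rw [fderiv_clm_apply hd (by fun_prop)]
    simp
  rw [← h1]
  have h2 : (fun z' => eval z' (single s v)) =ᶠ[𝓝 z]
      fun z' => ((weight s : ℝ) * monomial s z') • v := by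
    filter_upwards [(isOpen_lt continuous_norm continuous_const).mem_nhds hz] with z' hz'
    exact eval_single hz' s v
  have h3 : DifferentiableAt ℝ (fun z' => (weight s : ℝ) * monomial s z') z :=
    (differentiable_monomial s z).const_mul _
  rw [h2.fderiv_eq, fderiv_smul_const h3, fderiv_const_mul (differentiable_monomial s z)]
  simp [fderiv_monomial]

/-- The bounded operator `intMulDeriv` really is a time primitive of `m(f, ∂ₗ g)`: on monomials, the
time derivative produces the factor `k + 1` and the weight that its definition divides by. -/
lemma fderiv_eval_intMulDeriv {z : Option ι → ℝ} (hz : ‖z‖ < 1 / 2)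
    (m : F₁ →L[ℝ] F₂ →L[ℝ] F) (l : ι)
    (f : EllOne (Multiset (Option ι)) F₁) (g : EllOne (Multiset (Option ι)) F₂) :
    fderiv ℝ (eval (F := F)) z (Pi.single none 1) (intMulDeriv m l f g) =
      m (eval z f) (fderiv ℝ (eval (F := F₂)) z (Pi.single (some l) 1) g) := by
  have : (ContinuousLinearMap.compL ℝ _ _ _ (fderiv ℝ (eval (F := F)) z
      (Pi.single none 1))).comp (intMulDeriv m l) =
      m.bilinearComp (eval z) (fderiv ℝ (eval (F := F₂)) z (Pi.single (some l) 1)) :=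
    clm_ext₂ fun r s v w => by
    have hw : (weight (none ::ₘ (r + s.erase (some l))) : ℝ) ≠ 0 := by
      exact_mod_cast (weight_pos _).ne'
    have hc : ((r + s.erase (some l)).count none : ℝ) + 1 ≠ 0 := by positivity
    simp only [ContinuousLinearMap.comp_apply, ContinuousLinearMap.compL_apply,
      intMulDeriv_single, map_smul, fderiv_eval_single hz, eval_single hz,
      ContinuousLinearMap.bilinearComp_apply, smul_smul,
      smul_apply, Multiset.count_cons_self, Multiset.erase_cons_head,
      monomial_add, Nat.cast_add, Nat.cast_one]
    congr 1
    field_simp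
  exact congr($this f g)

lemma fderiv_eval_int {z : Option ι → ℝ} (hz : ‖z‖ < 1 / 2)
    (f : EllOne (Multiset (Option ι)) F) :
    fderiv ℝ (eval (F := F)) z (Pi.single none 1) (int f) = eval z f := by
  have : (fderiv ℝ (eval (F := F)) z (Pi.single none 1)).comp int = eval z :=
    clm_ext fun s v => by
    have hw : (weight (none ::ₘ s) : ℝ) ≠ 0 := by exact_mod_cast (weight_pos _).ne'
    have hc : (s.count none : ℝ) + 1 ≠ 0 := by positivity
    simp only [ContinuousLinearMap.comp_apply, int_single, map_smul, fderiv_eval_single hz,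
      eval_single hz, smul_smul, Multiset.count_cons_self, Multiset.erase_cons_head,
      Nat.cast_add, Nat.cast_one]
    congr 1
    field_simp
  exact congr($this f)

/-- Every monomial produced by the integration contains the time variable. Hence the constructed
solution has zero initial values. -/
lemma eval_intMulDeriv_of_none {z : Option ι → ℝ} (hz : ‖z‖ < 1 / 2) (h0 : z none = 0)
    (m : F₁ →L[ℝ] F₂ →L[ℝ] F) (l : ι)
    (f : EllOne (Multiset (Option ι)) F₁) (g : EllOne (Multiset (Option ι)) F₂) :
    eval z (intMulDeriv m l f g) = 0 := by
  have : (ContinuousLinearMap.compL ℝ _ _ _ (eval z)).comp (intMulDeriv m l) = 0 :=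
    clm_ext₂ fun r s v w => by
      simp [intMulDeriv_single, eval_single hz, monomial_cons, h0]
  exact congr($this f g)

lemma eval_int_of_none {z : Option ι → ℝ} (hz : ‖z‖ < 1 / 2) (h0 : z none = 0)
    (f : EllOne (Multiset (Option ι)) F) : eval z (int f) = 0 := by
  have : (eval z).comp (int (F := F)) = 0 := clm_ext fun s v => by
    simp [int_single, eval_single hz, monomial_cons, h0]
  exact congr($this f)

/-- The value of multilinear maps of zero variables. -/
def curryCoeffZero : (F₁ [×0]→L[ℝ] F₂) →L[ℝ] F₂ :=
  (continuousMultilinearCurryFin0 ℝ F₁ F₂).toContinuousLinearEquiv.toContinuousLinearMap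

/-- Fixing the first argument of multilinear maps. -/
def curryCoeff (n : ℕ) : (F₁ [×(n + 1)]→L[ℝ] F₂) →L[ℝ] F₁ →L[ℝ] (F₁ [×n]→L[ℝ] F₂) :=
  (continuousMultilinearCurryLeftEquiv ℝ
    (fun _ : Fin (n + 1) => F₁) F₂).toContinuousLinearEquiv.toContinuousLinearMap

lemma norm_curryCoeff_le (n : ℕ) : ‖curryCoeff (F₁ := F₁) (F₂ := F₂) n‖ ≤ 1 :=
  ContinuousLinearMap.opNorm_le_bound _ zero_le_one fun q => by
    rw [one_mul]
    exact ((continuousMultilinearCurryLeftEquiv ℝ (fun _ : Fin (n + 1) => F₁) F₂).norm_map q).le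

/-- Superposition of multilinear maps: the coefficients of the series are multilinear maps, which
are applied to `n` series. -/
def liftMultilinear : (n : ℕ) → EllOne (Multiset (Option ι)) (F₁ [×n]→L[ℝ] F₂) →L[ℝ]
    (EllOne (Multiset (Option ι)) F₁) [×n]→L[ℝ] (EllOne (Multiset (Option ι)) F₂)
  | 0 => ((continuousMultilinearCurryFin0 ℝ (EllOne (Multiset (Option ι)) F₁)
      (EllOne (Multiset (Option ι)) F₂)).symm.toContinuousLinearEquiv.toContinuousLinearMap).comp
      (EllOne.map curryCoeffZero)
  | n + 1 => ((continuousMultilinearCurryLeftEquiv ℝ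
      (fun _ : Fin (n + 1) => EllOne (Multiset (Option ι)) F₁)
      (EllOne (Multiset (Option ι)) F₂)).symm.toContinuousLinearEquiv.toContinuousLinearMap).comp
      ((ContinuousLinearMap.compL ℝ (EllOne (Multiset (Option ι)) F₁)
          (EllOne (Multiset (Option ι)) (F₁ [×n]→L[ℝ] F₂)) _ (liftMultilinear n)).comp
        (mul (curryCoeff n)))

lemma liftMultilinear_zero_apply (q : EllOne (Multiset (Option ι)) (F₁ [×0]→L[ℝ] F₂))
    (w : Fin 0 → EllOne (Multiset (Option ι)) F₁) :
    liftMultilinear 0 q w = EllOne.map curryCoeffZero q := by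
  rw [liftMultilinear]
  rfl

lemma liftMultilinear_succ_apply (n : ℕ)
    (q : EllOne (Multiset (Option ι)) (F₁ [×(n + 1)]→L[ℝ] F₂))
    (w : Fin (n + 1) → EllOne (Multiset (Option ι)) F₁) : liftMultilinear (n + 1) q w =
      liftMultilinear n (mul (curryCoeff n) q (w 0)) (Fin.tail w) := by
  rw [liftMultilinear]
  rfl

/-- Currying is isometric and `mul` does not increase norms, so absorbing the arguments one at a
time costs no constant. The superposition operator therefore has at least the radius of convergence
of the original power series. -/
lemma norm_liftMultilinear_le (n : ℕ) (q : EllOne (Multiset (Option ι)) (F₁ [×n]→L[ℝ] F₂)) :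
    ‖liftMultilinear n q‖ ≤ ‖q‖ := by
  refine ContinuousMultilinearMap.opNorm_le_bound (norm_nonneg _) fun w => ?_
  induction n with
  | zero =>
    rw [liftMultilinear_zero_apply]
    refine (ContinuousLinearMap.le_opNorm _ _).trans ?_
    rw [Finset.univ_eq_empty, Finset.prod_empty, mul_one]
    refine mul_le_of_le_one_left (norm_nonneg _) ?_
    refine (norm_lift_le (norm_nonneg _) _).trans ?_
    refine ContinuousLinearMap.opNorm_le_bound _ zero_le_one fun q => ?_
    rw [one_mul]
    exact ((continuousMultilinearCurryFin0 ℝ F₁ F₂).norm_map q).le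
  | succ n ih =>
    rw [liftMultilinear_succ_apply]
    refine (ih _ _).trans ?_
    rw [Fin.prod_univ_succ, ← mul_assoc]
    refine mul_le_mul_of_nonneg_right ?_ (Finset.prod_nonneg fun _ _ => norm_nonneg _)
    refine (ContinuousLinearMap.le_opNorm₂ _ _ _).trans ?_
    have : ‖mul (ι := ι) (curryCoeff (F₁ := F₁) (F₂ := F₂) n)‖ ≤ 1 :=
      (norm_mul_le _).trans (norm_curryCoeff_le n)
    refine mul_le_mul_of_nonneg_right ?_ (norm_nonneg _)
    exact mul_le_of_le_one_left (norm_nonneg _) this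

lemma eval_liftMultilinear {z : Option ι → ℝ} (hz : ‖z‖ < 1 / 2) (n : ℕ)
    (q : EllOne (Multiset (Option ι)) (F₁ [×n]→L[ℝ] F₂))
    (w : Fin n → EllOne (Multiset (Option ι)) F₁) :
    eval z (liftMultilinear n q w) = eval z q (fun i => eval z (w i)) := by
  induction n with
  | zero =>
    rw [liftMultilinear_zero_apply, eval_map hz]
    change eval z q 0 = _
    congr 1
    exact Subsingleton.elim _ _
  | succ n ih =>
    rw [liftMultilinear_succ_apply, ih, eval_mul hz]
    change eval z q (Fin.cons _ _) = _
    congr 1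
    ext i
    refine Fin.cases rfl (fun j => rfl) i

/-- The power series of the superposition operator `w ↦ A ∘ w` associated with the power series
of `A`. -/
def superposition (p : FormalMultilinearSeries ℝ F₁ F₂) : FormalMultilinearSeries ℝ
    (EllOne (Multiset (Option ι)) F₁) (EllOne (Multiset (Option ι)) F₂) :=
  fun n => liftMultilinear n (single 0 (p n))

lemma radius_le_radius_superposition (p : FormalMultilinearSeries ℝ F₁ F₂) :
    p.radius ≤ (superposition (ι := ι) p).radius :=
  FormalMultilinearSeries.radius_le_of_le fun n => by
    refine (norm_liftMultilinear_le _ _).trans ?_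
    rw [norm_single_apply]

lemma mem_eball_zero_coe {G : Type*} [NormedAddCommGroup G] {w : G} {r : NNReal} (hw : ‖w‖ < r) :
    w ∈ Metric.eball (0 : G) r := by
  simpa [Metric.eball_coe] using hw

/-- Evaluation at `z` commutes with products, hence with every term of the power series; being of
norm at most one, it keeps the argument inside the ball of convergence of `A`. -/
lemma eval_superposition_sum {A : F₁ → F₂} {p : FormalMultilinearSeries ℝ F₁ F₂} {r : NNReal}
    (hp : HasFPowerSeriesOnBall A p 0 r) {z : Option ι → ℝ} (hz : ‖z‖ < 1 / 2)
    {w : EllOne (Multiset (Option ι)) F₁} (hw : ‖w‖ < r) :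
    eval z ((superposition p).sum w) = A (eval z w) := by
  have hrad : (r : ENNReal) ≤ (superposition (ι := ι) p).radius :=
    hp.r_le.trans (radius_le_radius_superposition p)
  have h0 : HasSum (fun n => superposition p n fun _ => w) ((superposition p).sum w) :=
    (superposition (ι := ι) p).hasSum (Metric.eball_subset_eball hrad (mem_eball_zero_coe hw))
  have h1 : HasSum (fun n => eval z (superposition p n fun _ => w))
      (eval z ((superposition p).sum w)) :=
    h0.map (eval z) (eval z).continuous
  have hw' : ‖eval z w‖ < r := (norm_eval_apply_le hz w).trans_lt hw
  have h2 := hp.hasSum (mem_eball_zero_coe hw')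
  rw [zero_add] at h2
  refine h1.unique ?_
  have h3 : ∀ n, eval z (superposition p n fun _ => w) = p n fun _ => eval z w := fun n => by
    rw [superposition, eval_liftMultilinear hz, eval_single hz]
    simp [weight, monomial]
  simpa only [h3] using h2

/-- Analytic maps act on series with small coefficients. -/
lemma exists_superposition {A : F₁ → F₂} (hA : AnalyticAt ℝ A 0) :
    ∃ (r : ℝ) (𝒜 : EllOne (Multiset (Option ι)) F₁ → EllOne (Multiset (Option ι)) F₂), 0 < r ∧
      (∀ w, ‖w‖ < r → AnalyticAt ℝ 𝒜 w) ∧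
      ∀ z : Option ι → ℝ, ‖z‖ < 1 / 2 → ∀ w, ‖w‖ < r → eval z (𝒜 w) = A (eval z w) := by
  obtain ⟨p, R, hp⟩ := hA
  obtain ⟨r, hr0, hrR⟩ := ENNReal.lt_iff_exists_nnreal_btwn.1 hp.r_pos
  have hr0' : 0 < (r : ℝ) := by exact_mod_cast hr0
  have hp' := hp.mono hr0 hrR.le
  have hrad : (r : ENNReal) ≤ (superposition (ι := ι) p).radius :=
    hp'.r_le.trans (radius_le_radius_superposition p)
  have hfp := (superposition (ι := ι) p).hasFPowerSeriesOnBall (hr0.trans_le hrad)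
  refine ⟨r, (superposition p).sum, hr0', fun w hw => hfp.analyticAt_of_mem
    (Metric.eball_subset_eball hrad (mem_eball_zero_coe hw)),
    fun z hz w hw => eval_superposition_sum hp' hz hw⟩

end WeightedSeries

end

/-! ### The Cauchy–Kovalevskaya theorem with zero initial values -/

noncomputable section

namespace CauchyKovalevskaya

open EllOne WeightedSeries Filter

variable {ι : Type*} [Fintype ι] [DecidableEq ι]
  {E F : Type*} [NormedAddCommGroup E] [NormedSpace ℝ E] [FiniteDimensional ℝ E]
  [NormedAddCommGroup F] [NormedSpace ℝ F] [CompleteSpace F]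

/-- Equations `w = ε Φ(ε, w)` have solutions for small `ε`. -/
lemma exists_eq_smul {Λ : Type*} [NormedAddCommGroup Λ] [NormedSpace ℝ Λ] [CompleteSpace Λ]
    {Φ : ℝ × Λ → Λ} (hΦ : AnalyticAt ℝ Φ 0) {s : Set (ℝ × Λ)} (hs : s ∈ 𝓝 0) :
    ∃ ε > 0, ∃ w, (ε, w) ∈ s ∧ w = ε • Φ (ε, w) := by
  set H : ℝ × Λ → ℝ × Λ := fun q => (q.1, q.2 - q.1 • Φ q) with hH
  have h1 := hΦ.hasStrictFDerivAt
  have h2 : HasStrictFDerivAt H ((ContinuousLinearMap.fst ℝ ℝ Λ).prod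
      (ContinuousLinearMap.snd ℝ ℝ Λ - ((0 : ℝ × Λ).1 • fderiv ℝ Φ 0 +
        (ContinuousLinearMap.fst ℝ ℝ Λ).smulRight (Φ 0)))) 0 :=
    hasStrictFDerivAt_fst.prodMk (hasStrictFDerivAt_snd.sub (hasStrictFDerivAt_fst.smul h1))
  -- At the origin the term containing the derivative of `Φ` is multiplied by `ε = 0`, so the
  -- derivative of `H` is `(ε, w) ↦ (ε, w - ε Φ(0))`, which is onto. Thus `H` is open at the origin
  -- and `(ε, 0)` lies in its image for small `ε`.
  have h3 := h2.map_nhds_eq_of_surj (LinearMap.range_eq_top.2 fun q => by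
    refine ⟨(q.1, q.2 + q.1 • Φ 0), ?_⟩
    ext <;> simp)
  have h4 : H 0 = 0 := by simp [hH]
  rw [h4] at h3
  have h5 : H '' s ∈ 𝓝 (0 : ℝ × Λ) := by
    rw [← h3]; exact image_mem_map hs
  have h6 : Tendsto (fun ε : ℝ => ((ε, 0) : ℝ × Λ)) (𝓝[>] 0) (𝓝 0) := by
    have : Continuous (fun ε : ℝ => ((ε, 0) : ℝ × Λ)) := by fun_prop
    exact (this.tendsto 0).mono_left nhdsWithin_le_nhds
  obtain ⟨ε, hε, hε0⟩ := ((h6.eventually h5).and self_mem_nhdsWithin).exists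
  obtain ⟨⟨ε', w⟩, hq, hqe⟩ := hε
  simp only [hH, Prod.mk.injEq] at hqe
  obtain ⟨rfl, hw⟩ := hqe
  exact ⟨ε', hε0, w, hq, by rwa [sub_eq_zero] at hw⟩

/-- Rescaled coordinates. -/
def coords (B : Module.Basis ι ℝ E) (ε δ : ℝ) : ℝ × E →L[ℝ] (Option ι → ℝ) :=
  ContinuousLinearMap.pi fun o => o.elim (ε⁻¹ • ContinuousLinearMap.fst ℝ ℝ E)
    fun l => δ⁻¹ • (LinearMap.toContinuousLinearMap (B.coord l)).comp
      (ContinuousLinearMap.snd ℝ ℝ E)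

lemma coords_none (B : Module.Basis ι ℝ E) (ε δ : ℝ) (p : ℝ × E) :
    coords B ε δ p none = ε⁻¹ * p.1 := by
  simp [coords]

lemma coords_some (B : Module.Basis ι ℝ E) (ε δ : ℝ) (p : ℝ × E) (l : ι) :
    coords B ε δ p (some l) = δ⁻¹ * B.repr p.2 l := by
  simp [coords]

lemma coords_time (B : Module.Basis ι ℝ E) (ε δ : ℝ) :
    coords B ε δ (1, 0) = ε⁻¹ • (Pi.single none 1 : Option ι → ℝ) := by
  ext o
  cases o with
  | none => simp [coords_none]
  | some l => simp [coords_some]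

lemma coords_space (B : Module.Basis ι ℝ E) (ε δ : ℝ) (v : E) :
    coords B ε δ (0, v) =
      ∑ l, (δ⁻¹ * B.repr v l) • (Pi.single (some l) 1 : Option ι → ℝ) := by
  ext o
  cases o with
  | none => simp [coords_none]
  | some l => simp [coords_some, Finset.sum_apply, Pi.single_apply]

/-- The series of the coordinate function of time. -/
def timeSeries (ι E : Type*) [NormedAddCommGroup E] [NormedSpace ℝ E] :
    EllOne (Multiset (Option ι)) (ℝ × E) := single {none} (1, 0)

/-- The series of the coordinate function of space. -/
def spaceSeries (B : Module.Basis ι ℝ E) : EllOne (Multiset (Option ι)) (ℝ × E) :=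
  ∑ l, single {some l} (0, B l)

lemma eval_timeSeries {z : Option ι → ℝ} (hz : ‖z‖ < 1 / 2) :
    eval z (timeSeries ι E) = (z none, 0) := by
  have := FiniteDimensional.complete ℝ E
  rw [timeSeries, eval_single hz]
  simp [weight, monomial]

lemma eval_spaceSeries (B : Module.Basis ι ℝ E) {z : Option ι → ℝ} (hz : ‖z‖ < 1 / 2) :
    eval z (spaceSeries B) = (0, ∑ l, z (some l) • B l) := by
  have := FiniteDimensional.complete ℝ E
  rw [spaceSeries, map_sum]
  simp only [eval_single hz]
  ext <;> simp [weight, monomial, Prod.fst_sum, Prod.snd_sum]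

/-- Contraction of an operator on `E →L[ℝ] F` with the `l`-th coordinate form. -/
def contraction (F : Type*) [NormedAddCommGroup F] [NormedSpace ℝ F]
    (B : Module.Basis ι ℝ E) (l : ι) : ((E →L[ℝ] F) →L[ℝ] F) →L[ℝ] F →L[ℝ] F :=
  (ContinuousLinearMap.compL ℝ F (E →L[ℝ] F) F).flip
    (ContinuousLinearMap.smulRightL ℝ E F (LinearMap.toContinuousLinearMap (B.coord l)))

lemma contraction_apply (B : Module.Basis ι ℝ E) (l : ι) (A : (E →L[ℝ] F) →L[ℝ] F) (v : F) :
    contraction F B l A v =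
      A ((LinearMap.toContinuousLinearMap (B.coord l)).smulRight v) := rfl

/-- A series solving the integrated equation gives a solution of the differential equation. -/
lemma solution_of_series (B : Module.Basis ι ℝ E)
    (A : (ℝ × E) × F → (E →L[ℝ] F) →L[ℝ] F) (b : (ℝ × E) × F → F) {ε δ : ℝ} (hε : ε ≠ 0)
    (η : EllOne (Multiset (Option ι)) F)
    (a : EllOne (Multiset (Option ι)) ((E →L[ℝ] F) →L[ℝ] F))
    (β : EllOne (Multiset (Option ι)) F)
    (hη : η = ε • (δ⁻¹ • ∑ l, intMulDeriv (contraction F B l) l a η + int β))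
    (ha : ∀ p, ‖coords B ε δ p‖ < 1 / 2 →
      eval (coords B ε δ p) a = A (p, eval (coords B ε δ p) η))
    (hβ : ∀ p, ‖coords B ε δ p‖ < 1 / 2 →
      eval (coords B ε δ p) β = b (p, eval (coords B ε δ p) η)) :
    ∃ w : ℝ × E → F, AnalyticAt ℝ w 0 ∧ (∀ᶠ y in 𝓝 (0 : E), w (0, y) = 0) ∧
      ∀ᶠ p in 𝓝 (0 : ℝ × E), fderiv ℝ w p (1, 0) =
        A (p, w p) ((fderiv ℝ w p).comp (ContinuousLinearMap.inr ℝ ℝ E)) + b (p, w p) := by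
  have hsmall : ∀ᶠ p in 𝓝 (0 : ℝ × E), ‖coords B ε δ p‖ < 1 / 2 := by
    have : Continuous fun p => ‖coords B ε δ p‖ := by fun_prop
    refine (this.tendsto 0).eventually_lt_const ?_
    simp
  have hη' : ∀ z : Option ι → ℝ, ‖z‖ < 1 / 2 → ∀ A' : EllOne (Multiset (Option ι)) F →L[ℝ] F,
      A' η = ε • (δ⁻¹ • ∑ l, A' (intMulDeriv (contraction F B l) l a η) + A' (int β)) := by
    intro z hz A'
    conv_lhs => rw [hη]
    simp only [map_smul, map_add, map_sum]
  refine ⟨fun p => eval (coords B ε δ p) η, ?_, ?_, ?_⟩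
  · have h0 : ‖coords B ε δ 0‖ < 1 / 2 := by simp
    have h1 : AnalyticAt ℝ (fun p => eval (F := F) (coords B ε δ p)) 0 :=
      (analyticAt_eval h0).comp ((coords B ε δ).analyticAt 0)
    exact ((ContinuousLinearMap.apply ℝ F η).analyticAt _).comp h1
  · have h0 : Tendsto (fun y : E => ((0, y) : ℝ × E)) (𝓝 0) (𝓝 0) := by
      have : Continuous (fun y : E => ((0, y) : ℝ × E)) := by fun_prop
      exact this.tendsto 0
    filter_upwards [h0.eventually hsmall] with y hy
    have hn : coords B ε δ (0, y) none = 0 := by simp [coords_none]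
    rw [hη' _ hy]
    simp [eval_intMulDeriv_of_none hy hn, eval_int_of_none hy hn]
  · filter_upwards [hsmall] with p hp
    set z := coords B ε δ p with hz
    have hd := (analyticAt_eval (F := F) hp).differentiableAt
    have hD : ∀ v, fderiv ℝ (fun p => eval (F := F) (coords B ε δ p) η) p v =
        fderiv ℝ (eval (F := F)) z (coords B ε δ v) η := by
      intro v
      have h1 : HasFDerivAt (fun p => eval (F := F) (coords B ε δ p))
          ((fderiv ℝ (eval (F := F)) z).comp (coords B ε δ)) p :=
        hd.hasFDerivAt.comp p (coords B ε δ).hasFDerivAt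
      have h2 := ((ContinuousLinearMap.apply ℝ F η).hasFDerivAt (x := eval z)).comp p h1
      have h3 : (fun p => eval (F := F) (coords B ε δ p) η) =
        (ContinuousLinearMap.apply ℝ F η) ∘ fun p => eval (F := F) (coords B ε δ p) := rfl
      rw [h3, h2.fderiv]
      rfl
    -- The space derivative is expanded in the coordinate forms of `B`; this matches the sum over
    -- `l` of the terms `contraction F B l`.
    have hx : (fderiv ℝ (fun p => eval (F := F) (coords B ε δ p) η) p).comp
        (ContinuousLinearMap.inr ℝ ℝ E) = δ⁻¹ • ∑ l,
        (LinearMap.toContinuousLinearMap (B.coord l)).smulRight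
          (fderiv ℝ (eval (F := F)) z (Pi.single (some l) 1) η) := by
      ext v
      simp only [ContinuousLinearMap.comp_apply, ContinuousLinearMap.inr_apply, hD, coords_space,
        map_sum, map_smul, sum_apply, smul_apply, ContinuousLinearMap.smulRight_apply,
        Finset.smul_sum, smul_smul]
      rfl
    rw [hx, hD, coords_time, map_smul, smul_apply, hη' z hp, smul_smul, inv_mul_cancel₀ hε,
      one_smul, fderiv_eval_int hp, hβ p hp, map_smul, map_sum]
    congr 2
    refine Finset.sum_congr rfl fun l _ => ?_
    rw [fderiv_eval_intMulDeriv hp, contraction_apply, ha p hp]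

/-- The Cauchy–Kovalevskaya theorem for quasilinear first order systems with zero initial
values. -/
theorem exists_solution_zero (A : (ℝ × E) × F → (E →L[ℝ] F) →L[ℝ] F) (b : (ℝ × E) × F → F)
    (hA : AnalyticAt ℝ A 0) (hb : AnalyticAt ℝ b 0) :
    ∃ w : ℝ × E → F, AnalyticAt ℝ w 0 ∧ (∀ᶠ y in 𝓝 (0 : E), w (0, y) = 0) ∧
      ∀ᶠ p in 𝓝 (0 : ℝ × E), fderiv ℝ w p (1, 0) =
        A (p, w p) ((fderiv ℝ w p).comp (ContinuousLinearMap.inr ℝ ℝ E)) + b (p, w p) := by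
  have := FiniteDimensional.complete ℝ E
  set B := Module.finBasis ℝ E
  set ι := Fin (Module.finrank ℝ E)
  obtain ⟨r₁, 𝒜, hr₁, h𝒜, h𝒜e⟩ := exists_superposition (ι := ι) hA
  obtain ⟨r₂, 𝒷, hr₂, h𝒷, h𝒷e⟩ := exists_superposition (ι := ι) hb
  set L₁ := EllOne.map (σ := Multiset (Option ι)) (ContinuousLinearMap.inl ℝ (ℝ × E) F)
  set L₂ := EllOne.map (σ := Multiset (Option ι)) (ContinuousLinearMap.inr ℝ (ℝ × E) F)
  -- The scale `δ` of space makes the series of the rescaled space coordinate small enough for the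
  -- superposition operators of `A` and `b` to be analytic near it.
  obtain ⟨δ, hδ, hδ₁, hδ₂⟩ : ∃ δ : ℝ, 0 < δ ∧ ‖L₁ (δ • spaceSeries B)‖ < r₁ ∧
      ‖L₁ (δ • spaceSeries B)‖ < r₂ := by
    have h1 : Tendsto (fun δ : ℝ => ‖L₁ (δ • spaceSeries B)‖) (𝓝[>] 0) (𝓝 0) := by
      have : Continuous fun δ : ℝ => ‖L₁ (δ • spaceSeries B)‖ := by fun_prop
      have := (this.tendsto 0).mono_left (nhdsWithin_le_nhds (s := Set.Ioi 0))
      simpa using this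
    obtain ⟨δ, ⟨h, h'⟩, h''⟩ := (((h1.eventually_lt_const hr₁).and
      (h1.eventually_lt_const hr₂)).and self_mem_nhdsWithin).exists
    exact ⟨δ, h'', h, h'⟩
  -- The series of `((ε τ, δ ζ), w)`: the scale `ε` of time enters as a variable, because it is also
  -- the small parameter of the fixed point equation.
  set arg : ℝ × EllOne (Multiset (Option ι)) F → EllOne (Multiset (Option ι)) ((ℝ × E) × F) :=
    fun q => L₁ (q.1 • timeSeries ι E + δ • spaceSeries B) + L₂ q.2 with harg
  have harg0 : arg 0 = L₁ (δ • spaceSeries B) := by simp [harg]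
  have hargc : Continuous arg := by fun_prop
  have harga : AnalyticAt ℝ arg 0 := by
    have h1 : AnalyticAt ℝ (fun q : ℝ × EllOne (Multiset (Option ι)) F =>
        q.1 • timeSeries ι E + δ • spaceSeries B) 0 :=
      (analyticAt_fst.smul analyticAt_const).add analyticAt_const
    exact ((L₁.analyticAt _).comp h1).add ((L₂.analyticAt _).comp analyticAt_snd)
  have hs : {q | ‖arg q‖ < r₁ ∧ ‖arg q‖ < r₂} ∈ 𝓝 0 := by
    have : Tendsto (fun q => ‖arg q‖) (𝓝 0) (𝓝 ‖arg 0‖) := hargc.norm.tendsto 0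
    rw [harg0] at this
    exact (this.eventually_lt_const hδ₁).and (this.eventually_lt_const hδ₂)
  -- In the variables `t = ε τ`, `x = δ ζ` the equation becomes `∂_τ w = ε (δ⁻¹ A ∂_ζ w + b)`; its
  -- time integral is `w = ε Φ(ε, w)`.
  set Φ : ℝ × EllOne (Multiset (Option ι)) F → EllOne (Multiset (Option ι)) F := fun q =>
    δ⁻¹ • ∑ l, intMulDeriv (contraction F B l) l (𝒜 (arg q)) q.2 + int (𝒷 (arg q)) with hΦ
  have hΦa : AnalyticAt ℝ Φ 0 := by
    have h1 : AnalyticAt ℝ (fun q => 𝒜 (arg q)) 0 :=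
      AnalyticAt.comp (h𝒜 _ (by rw [harg0]; exact hδ₁)) harga
    have h2 : AnalyticAt ℝ (fun q => 𝒷 (arg q)) 0 :=
      AnalyticAt.comp (h𝒷 _ (by rw [harg0]; exact hδ₂)) harga
    have h3 : ∀ l, AnalyticAt ℝ (fun q : ℝ × EllOne (Multiset (Option ι)) F =>
        intMulDeriv (contraction F B l) l (𝒜 (arg q)) q.2) 0 := fun l =>
      ((intMulDeriv (contraction F B l) l).analyticAt_bilinear _).comp₂ h1 analyticAt_snd
    have h4 : AnalyticAt ℝ (fun q => int (𝒷 (arg q))) 0 :=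
      ((int (ι := ι) (F := F)).analyticAt _).comp h2
    have h5 : AnalyticAt ℝ (fun q : ℝ × EllOne (Multiset (Option ι)) F =>
        ∑ l, intMulDeriv (contraction F B l) l (𝒜 (arg q)) q.2) 0 :=
      Finset.analyticAt_fun_sum _ fun l _ => h3 l
    exact (analyticAt_const.fun_smul h5).fun_add h4
  obtain ⟨ε, hε, η, ⟨hq₁, hq₂⟩, hη⟩ := exists_eq_smul hΦa hs
  -- Evaluation at the rescaled coordinates of `p` undoes the rescaling and returns `p` itself as
  -- argument of `A` and `b`.
  have heval : ∀ p, ‖coords B ε δ p‖ < 1 / 2 →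
      eval (coords B ε δ p) (arg (ε, η)) = (p, eval (coords B ε δ p) η) := by
    intro p hp
    simp only [harg, map_add, L₁, L₂, eval_map hp]
    simp only [map_smul, eval_timeSeries hp, eval_spaceSeries B hp, coords_none, coords_some]
    have hsum : ∑ l, (δ⁻¹ * B.repr p.2 l) • B l = δ⁻¹ • p.2 := by
      simp_rw [mul_smul, ← Finset.smul_sum, B.sum_repr]
    rw [hsum]
    refine Prod.ext (Prod.ext ?_ ?_) ?_
    · simp [hε.ne']
    · simp [hδ.ne']
    · simp
  refine solution_of_series B A b hε.ne' η (𝒜 (arg (ε, η))) (𝒷 (arg (ε, η))) hη ?_ ?_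
  · intro p hp
    rw [h𝒜e _ hp _ hq₁, heval p hp]
  · intro p hp
    rw [h𝒷e _ hp _ hq₂, heval p hp]

end CauchyKovalevskaya

end

/-! ### The Cauchy–Kovalevskaya theorem with general initial values -/

noncomputable section

lemma AnalyticAt.clm_app {D F G : Type*} [NormedAddCommGroup D] [NormedSpace ℝ D]
    [NormedAddCommGroup F] [NormedSpace ℝ F] [NormedAddCommGroup G] [NormedSpace ℝ G]
    {c : D → F →L[ℝ] G} {u : D → F} {x : D} (hc : AnalyticAt ℝ c x) (hu : AnalyticAt ℝ u x) :
    AnalyticAt ℝ (fun x => c x (u x)) x :=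
  ((ContinuousLinearMap.id ℝ (F →L[ℝ] G)).analyticAt_bilinear _).comp₂ hc hu

lemma AnalyticAt.clm_const {D F G : Type*} [NormedAddCommGroup D] [NormedSpace ℝ D]
    [NormedAddCommGroup F] [NormedSpace ℝ F] [NormedAddCommGroup G] [NormedSpace ℝ G]
    (L : F →L[ℝ] G) {u : D → F} {x : D} (hu : AnalyticAt ℝ u x) :
    AnalyticAt ℝ (fun x => L (u x)) x :=
  (L.analyticAt _).comp hu

namespace CauchyKovalevskaya

open Filter

section Existence

variable {E F : Type*} [NormedAddCommGroup E] [NormedSpace ℝ E] [FiniteDimensional ℝ E]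
  [NormedAddCommGroup F] [NormedSpace ℝ F] [CompleteSpace F]

/-- The Cauchy–Kovalevskaya theorem for quasilinear first order systems. -/
theorem exists_solution (A : (ℝ × E) × F → (E →L[ℝ] F) →L[ℝ] F) (b : (ℝ × E) × F → F)
    (y₀ : E) (w₀ : E → F) (hw₀ : AnalyticAt ℝ w₀ y₀) (hA : AnalyticAt ℝ A ((0, y₀), w₀ y₀))
    (hb : AnalyticAt ℝ b ((0, y₀), w₀ y₀)) :
    ∃ w : ℝ × E → F, AnalyticAt ℝ w (0, y₀) ∧ (∀ᶠ y in 𝓝 y₀, w (0, y) = w₀ y) ∧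
      ∀ᶠ p in 𝓝 ((0 : ℝ), y₀), fderiv ℝ w p (1, 0) =
        A (p, w p) ((fderiv ℝ w p).comp (ContinuousLinearMap.inr ℝ ℝ E)) + b (p, w p) := by
  have := FiniteDimensional.complete ℝ E
  -- The base point is translated to the origin and the unknown is replaced by its difference from
  -- `w₀`; the inhomogeneity then acquires the term `A(∂w₀)`.
  set θ : (ℝ × E) × F → (ℝ × E) × F :=
    fun q => (q.1 + (0, y₀), w₀ (q.1.2 + y₀) + q.2) with hθ
  have h0 : AnalyticAt ℝ (fun q : (ℝ × E) × F => q.1.2 + y₀) 0 :=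
    (AnalyticAt.clm_const (ContinuousLinearMap.snd ℝ ℝ E) analyticAt_fst).fun_add analyticAt_const
  have hw₀' : AnalyticAt ℝ w₀ ((0 : (ℝ × E) × F).1.2 + y₀) := by simpa using hw₀
  have h1 : AnalyticAt ℝ (fun q : (ℝ × E) × F => w₀ (q.1.2 + y₀)) 0 :=
    AnalyticAt.comp (g := w₀) (f := fun q : (ℝ × E) × F => q.1.2 + y₀) hw₀' h0
  have h1' : AnalyticAt ℝ (fun q : (ℝ × E) × F => fderiv ℝ w₀ (q.1.2 + y₀)) 0 :=
    AnalyticAt.comp (g := fderiv ℝ w₀) (f := fun q : (ℝ × E) × F => q.1.2 + y₀) hw₀'.fderiv h0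
  have hθa : AnalyticAt ℝ θ 0 :=
    (analyticAt_fst.fun_add analyticAt_const).prod (h1.fun_add analyticAt_snd)
  have hθ0 : θ 0 = ((0, y₀), w₀ y₀) := by simp [hθ]
  have hA' : AnalyticAt ℝ (fun q => A (θ q)) 0 :=
    AnalyticAt.comp (g := A) (by rwa [hθ0]) hθa
  have hb' : AnalyticAt ℝ (fun q => b (θ q)) 0 :=
    AnalyticAt.comp (g := b) (by rwa [hθ0]) hθa
  obtain ⟨w, hw, hwi, hwe⟩ := exists_solution_zero (fun q => A (θ q))
    (fun q => A (θ q) (fderiv ℝ w₀ (q.1.2 + y₀)) + b (θ q)) hA' ((hA'.clm_app h1').fun_add hb')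
  have hT : Tendsto (fun p : ℝ × E => p - (0, y₀)) (𝓝 (0, y₀)) (𝓝 0) := by
    have : Continuous (fun p : ℝ × E => p - (0, y₀)) := by fun_prop
    simpa using this.tendsto (0, y₀)
  have hw' : AnalyticAt ℝ w (((0, y₀) : ℝ × E) - (0, y₀)) := by simpa using hw
  refine ⟨fun p => w₀ p.2 + w (p - (0, y₀)), ?_, ?_, ?_⟩
  · have h2 : AnalyticAt ℝ (fun p : ℝ × E => w₀ p.2) (0, y₀) :=
      AnalyticAt.comp (g := w₀) hw₀ analyticAt_snd
    have h3 : AnalyticAt ℝ (fun p : ℝ × E => w (p - (0, y₀))) (0, y₀) :=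
      AnalyticAt.comp (g := w) hw' (analyticAt_id.fun_sub analyticAt_const)
    exact h2.fun_add h3
  · have h2 : Tendsto (fun y : E => y - y₀) (𝓝 y₀) (𝓝 0) := by
      have : Continuous (fun y : E => y - y₀) := by fun_prop
      simpa using this.tendsto y₀
    filter_upwards [h2.eventually hwi] with y hy
    simp [hy]
  · have h2 : ∀ᶠ p in 𝓝 ((0 : ℝ), y₀), DifferentiableAt ℝ w₀ p.2 :=
      (continuous_snd.tendsto ((0 : ℝ), y₀)).eventually
        (hw₀.eventually_analyticAt.mono fun y hy => hy.differentiableAt)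
    have h3 : ∀ᶠ p in 𝓝 ((0 : ℝ), y₀), DifferentiableAt ℝ w (p - (0, y₀)) :=
      hT.eventually (hw.eventually_analyticAt.mono fun y hy => hy.differentiableAt)
    filter_upwards [hT.eventually hwe, h2, h3] with p hp hp2 hp3
    have h4 : HasFDerivAt (fun p : ℝ × E => w₀ p.2 + w (p - (0, y₀)))
        ((fderiv ℝ w₀ p.2).comp (ContinuousLinearMap.snd ℝ ℝ E) + fderiv ℝ w (p - (0, y₀))) p := by
      refine HasFDerivAt.add (hp2.hasFDerivAt.comp p hasFDerivAt_snd) ?_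
      exact hp3.hasFDerivAt.comp p ((hasFDerivAt_id p).sub_const _)
    have h5 : θ (p - (0, y₀), w (p - (0, y₀))) = (p, w₀ p.2 + w (p - (0, y₀))) := by
      simp [hθ]
    have h6 : (p - (0, y₀)).2 + y₀ = p.2 := by simp
    rw [h5, h6] at hp
    rw [h4.fderiv]
    simp only [add_apply, ContinuousLinearMap.comp_apply, ContinuousLinearMap.coe_snd', map_zero,
      zero_add, hp]
    have h7 : ((fderiv ℝ w₀ p.2).comp (ContinuousLinearMap.snd ℝ ℝ E) +
        fderiv ℝ w (p - (0, y₀))).comp (ContinuousLinearMap.inr ℝ ℝ E) = fderiv ℝ w₀ p.2 +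
        (fderiv ℝ w (p - (0, y₀))).comp (ContinuousLinearMap.inr ℝ ℝ E) := by
      ext v; simp
    rw [h7, map_add]
    abel

end Existence

/-! ### Uniqueness for quasilinear systems through Taylor coefficients in time -/

section Uniqueness

universe u

variable {E F F₁ F₂ : Type u} [NormedAddCommGroup E] [NormedSpace ℝ E]
  [NormedAddCommGroup F] [NormedSpace ℝ F] [CompleteSpace F]
  [NormedAddCommGroup F₁] [NormedSpace ℝ F₁] [CompleteSpace F₁]
  [NormedAddCommGroup F₂] [NormedSpace ℝ F₂] [CompleteSpace F₂]

/-- Partial derivative in time. -/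
def dt {G : Type*} [NormedAddCommGroup G] [NormedSpace ℝ G] (f : ℝ × E → G) (p : ℝ × E) : G :=
  fderiv ℝ f p (1, 0)

/-- Partial derivative in space. -/
def dx {G : Type*} [NormedAddCommGroup G] [NormedSpace ℝ G] (f : ℝ × E → G) (p : ℝ × E) :
    E →L[ℝ] G :=
  (fderiv ℝ f p).comp (ContinuousLinearMap.inr ℝ ℝ E)

lemma dx_apply {G : Type*} [NormedAddCommGroup G] [NormedSpace ℝ G] (f : ℝ × E → G) (p : ℝ × E)
    (v : E) : dx f p v = fderiv ℝ f p (0, v) := rfl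

section

variable {G : Type*} [NormedAddCommGroup G] [NormedSpace ℝ G] [CompleteSpace G]

lemma analyticAt_dt {f : ℝ × E → G} {p : ℝ × E} (hf : AnalyticAt ℝ f p) :
    AnalyticAt ℝ (dt f) p :=
  hf.fderiv.clm_app analyticAt_const

lemma analyticAt_dx {f : ℝ × E → G} {p : ℝ × E} (hf : AnalyticAt ℝ f p) :
    AnalyticAt ℝ (dx f) p :=
  AnalyticAt.clm_const ((ContinuousLinearMap.compL ℝ E (ℝ × E) G).flip
    (ContinuousLinearMap.inr ℝ ℝ E)) hf.fderiv

lemma fderiv_fderiv_apply {f : ℝ × E → G} {p : ℝ × E} (hf : AnalyticAt ℝ f p) (v w : ℝ × E) :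
    fderiv ℝ (fun q => fderiv ℝ f q v) p w = fderiv ℝ (fderiv ℝ f) p w v := by
  rw [fderiv_clm_apply hf.fderiv.differentiableAt (differentiableAt_const _)]
  simp

lemma fderiv_fderiv_comm {f : ℝ × E → G} {p : ℝ × E} (hf : AnalyticAt ℝ f p) (v w : ℝ × E) :
    fderiv ℝ (fun q => fderiv ℝ f q v) p w = fderiv ℝ (fun q => fderiv ℝ f q w) p v := by
  rw [fderiv_fderiv_apply hf, fderiv_fderiv_apply hf]
  exact (hf.contDiffAt (n := ω)).isSymmSndFDerivAt_of_omega w v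

lemma dt_dx {f : ℝ × E → G} {p : ℝ × E} (hf : AnalyticAt ℝ f p) :
    dt (dx f) p = dx (dt f) p := by
  ext v
  have h : dt (dx f) p v = dt (fun q => dx f q v) p := by
    unfold dt
    rw [fderiv_clm_apply (analyticAt_dx hf).differentiableAt (differentiableAt_const _)]
    simp
  rw [h, dx_apply]
  exact fderiv_fderiv_comm hf (0, v) (1, 0)

end

/-- Equality of the Taylor polynomials of degree less than `n` in time at time zero. -/
def TimeJetEq (s : Set E) : ℕ → (ℝ × E → F) → (ℝ × E → F) → Prop
  | 0, _, _ => True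
  | n + 1, f, g => (∀ y ∈ s, f (0, y) = g (0, y)) ∧ TimeJetEq s n (dt f) (dt g)

namespace TimeJetEq

variable {s : Set E} {S : Set (ℝ × E)} {n : ℕ}

lemma refl (f : ℝ × E → F) : TimeJetEq s n f f := by
  induction n generalizing f with
  | zero => trivial
  | succ n ih => exact ⟨fun _ _ => rfl, ih _⟩

lemma congr (hS : IsOpen S) (hs : ∀ y ∈ s, ((0 : ℝ), y) ∈ S) {f f' g g' : ℝ × E → F}
    (hf : Set.EqOn f f' S) (hg : Set.EqOn g g' S) (h : TimeJetEq s n f g) :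
    TimeJetEq s n f' g' := by
  induction n generalizing f f' g g' with
  | zero => trivial
  | succ n ih =>
    have key : ∀ {f f' : ℝ × E → F}, Set.EqOn f f' S → Set.EqOn (dt f) (dt f') S :=
      fun {f f'} h p hp => by
        unfold dt
        rw [(h.eventuallyEq_of_mem (hS.mem_nhds hp)).fderiv_eq]
    refine ⟨fun y hy => ?_, ih (key hf) (key hg) h.2⟩
    rw [← hf (hs y hy), ← hg (hs y hy)]
    exact h.1 y hy

lemma of_succ {f g : ℝ × E → F} (h : TimeJetEq s (n + 1) f g) : TimeJetEq s n f g := by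
  induction n generalizing f g with
  | zero => trivial
  | succ n ih => exact ⟨h.1, ih h.2⟩

lemma add {f₁ f₂ g₁ g₂ : ℝ × E → F} (hS : IsOpen S) (hs : ∀ y ∈ s, ((0 : ℝ), y) ∈ S)
    (hf₁ : AnalyticOnNhd ℝ f₁ S) (hf₂ : AnalyticOnNhd ℝ f₂ S)
    (hg₁ : AnalyticOnNhd ℝ g₁ S) (hg₂ : AnalyticOnNhd ℝ g₂ S)
    (h₁ : TimeJetEq s n f₁ g₁) (h₂ : TimeJetEq s n f₂ g₂) :
    TimeJetEq s n (fun p => f₁ p + f₂ p) (fun p => g₁ p + g₂ p) := by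
  induction n generalizing f₁ f₂ g₁ g₂ with
  | zero => trivial
  | succ n ih =>
    have key : ∀ {f g : ℝ × E → F}, AnalyticOnNhd ℝ f S → AnalyticOnNhd ℝ g S →
        Set.EqOn (fun p => dt f p + dt g p) (dt fun p => f p + g p) S := fun hf hg p hp => by
      simp only [dt]
      rw [fderiv_fun_add (hf p hp).differentiableAt (hg p hp).differentiableAt]
      rfl
    refine ⟨fun y hy => by simp only [h₁.1 y hy, h₂.1 y hy], ?_⟩
    exact congr hS hs (key hf₁ hf₂) (key hg₁ hg₂) (ih (fun p hp => analyticAt_dt (hf₁ p hp))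
      (fun p hp => analyticAt_dt (hf₂ p hp)) (fun p hp => analyticAt_dt (hg₁ p hp))
      (fun p hp => analyticAt_dt (hg₂ p hp)) h₁.2 h₂.2)

lemma bilin (m : F₁ →L[ℝ] F₂ →L[ℝ] F) {f₁ g₁ : ℝ × E → F₁} {f₂ g₂ : ℝ × E → F₂}
    (hS : IsOpen S) (hs : ∀ y ∈ s, ((0 : ℝ), y) ∈ S)
    (hf₁ : AnalyticOnNhd ℝ f₁ S) (hf₂ : AnalyticOnNhd ℝ f₂ S)
    (hg₁ : AnalyticOnNhd ℝ g₁ S) (hg₂ : AnalyticOnNhd ℝ g₂ S)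
    (h₁ : TimeJetEq s n f₁ g₁) (h₂ : TimeJetEq s n f₂ g₂) :
    TimeJetEq s n (fun p => m (f₁ p) (f₂ p)) (fun p => m (g₁ p) (g₂ p)) := by
  induction n generalizing f₁ f₂ g₁ g₂ with
  | zero => trivial
  | succ n ih =>
    have hm : ∀ {f : ℝ × E → F₁} {g : ℝ × E → F₂}, AnalyticOnNhd ℝ f S → AnalyticOnNhd ℝ g S →
        AnalyticOnNhd ℝ (fun p => m (f p) (g p)) S := fun hf hg p hp =>
      (m.analyticAt_bilinear _).comp₂ (hf p hp) (hg p hp)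
    have hd : ∀ {G : Type u} [NormedAddCommGroup G] [NormedSpace ℝ G] [CompleteSpace G]
        {f : ℝ × E → G}, AnalyticOnNhd ℝ f S → AnalyticOnNhd ℝ (dt f) S := fun hf p hp =>
      analyticAt_dt (hf p hp)
    have key : ∀ {f : ℝ × E → F₁} {g : ℝ × E → F₂}, AnalyticOnNhd ℝ f S → AnalyticOnNhd ℝ g S →
        Set.EqOn (fun p => m (f p) (dt g p) + m (dt f p) (g p)) (dt fun p => m (f p) (g p)) S :=
      fun hf hg p hp => by
        simp only [dt]
        rw [m.fderiv_of_bilinear (hf p hp).differentiableAt (hg p hp).differentiableAt]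
        rfl
    refine ⟨fun y hy => by simp only [h₁.1 y hy, h₂.1 y hy], ?_⟩
    exact congr hS hs (key hf₁ hf₂) (key hg₁ hg₂) (add hS hs (hm hf₁ (hd hf₂))
      (hm (hd hf₁) hf₂) (hm hg₁ (hd hg₂)) (hm (hd hg₁) hg₂)
      (ih hf₁ (hd hf₂) hg₁ (hd hg₂) h₁.of_succ h₂.2)
      (ih (hd hf₁) hf₂ (hd hg₁) hg₂ h₁.2 h₂.of_succ))

/-- By the chain rule the time derivative of `Θ ∘ f` is `Θ'(f)` applied to `dt f`, and the induction
hypothesis is used for `Θ'`. The target thus changes from `F₂` to `F₁ →L[ℝ] F₂`, which is possible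
because all spaces lie in one universe. -/
lemma comp {Θ : F₁ → F₂} {f g : ℝ × E → F₁} (hS : IsOpen S) (hs : ∀ y ∈ s, ((0 : ℝ), y) ∈ S)
    (hf : AnalyticOnNhd ℝ f S) (hg : AnalyticOnNhd ℝ g S)
    (hΘf : ∀ p ∈ S, AnalyticAt ℝ Θ (f p)) (hΘg : ∀ p ∈ S, AnalyticAt ℝ Θ (g p))
    (h : TimeJetEq s n f g) : TimeJetEq s n (fun p => Θ (f p)) (fun p => Θ (g p)) := by
  induction n generalizing F₂ with
  | zero => trivial
  | succ n ih =>
    have key : ∀ {f : ℝ × E → F₁}, AnalyticOnNhd ℝ f S → (∀ p ∈ S, AnalyticAt ℝ Θ (f p)) →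
        Set.EqOn (fun p => ContinuousLinearMap.id ℝ (F₁ →L[ℝ] F₂) (fderiv ℝ Θ (f p)) (dt f p))
          (dt fun p => Θ (f p)) S := fun {f} hf hΘ p hp => by
      simp only [dt]
      have := (hΘ p hp).differentiableAt.hasFDerivAt.comp p
        (hf p hp).differentiableAt.hasFDerivAt
      rw [show (fun p => Θ (f p)) = Θ ∘ f from rfl, this.fderiv]
      rfl
    have hd : ∀ {f : ℝ × E → F₁}, AnalyticOnNhd ℝ f S → (∀ p ∈ S, AnalyticAt ℝ Θ (f p)) →
        AnalyticOnNhd ℝ (fun p => fderiv ℝ Θ (f p)) S := fun {f} hf hΘ p hp =>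
      AnalyticAt.comp (g := fderiv ℝ Θ) (hΘ p hp).fderiv (hf p hp)
    refine ⟨fun y hy => by simp only [h.1 y hy], ?_⟩
    exact congr hS hs (key hf hΘf) (key hg hΘg) (bilin _ hS hs (hd hf hΘf)
      (fun p hp => analyticAt_dt (hf p hp)) (hd hg hΘg) (fun p hp => analyticAt_dt (hg p hp))
      (ih (Θ := fderiv ℝ Θ) (fun p hp => (hΘf p hp).fderiv) (fun p hp => (hΘg p hp).fderiv)
        h.of_succ) h.2)

lemma clm (L : F₁ →L[ℝ] F₂) {f g : ℝ × E → F₁} (hS : IsOpen S)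
    (hs : ∀ y ∈ s, ((0 : ℝ), y) ∈ S) (hf : AnalyticOnNhd ℝ f S) (hg : AnalyticOnNhd ℝ g S)
    (h : TimeJetEq s n f g) : TimeJetEq s n (fun p => L (f p)) (fun p => L (g p)) :=
  comp hS hs hf hg (fun _ _ => L.analyticAt _) (fun _ _ => L.analyticAt _) h

lemma prodMk {f₁ g₁ : ℝ × E → F₁} {f₂ g₂ : ℝ × E → F₂}
    (hS : IsOpen S) (hs : ∀ y ∈ s, ((0 : ℝ), y) ∈ S)
    (hf₁ : AnalyticOnNhd ℝ f₁ S) (hf₂ : AnalyticOnNhd ℝ f₂ S)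
    (hg₁ : AnalyticOnNhd ℝ g₁ S) (hg₂ : AnalyticOnNhd ℝ g₂ S)
    (h₁ : TimeJetEq s n f₁ g₁) (h₂ : TimeJetEq s n f₂ g₂) :
    TimeJetEq s n (fun p => (f₁ p, f₂ p)) (fun p => (g₁ p, g₂ p)) := by
  have h := add hS hs
    (fun p hp => AnalyticAt.clm_const (ContinuousLinearMap.inl ℝ F₁ F₂) (hf₁ p hp))
    (fun p hp => AnalyticAt.clm_const (ContinuousLinearMap.inr ℝ F₁ F₂) (hf₂ p hp))
    (fun p hp => AnalyticAt.clm_const (ContinuousLinearMap.inl ℝ F₁ F₂) (hg₁ p hp))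
    (fun p hp => AnalyticAt.clm_const (ContinuousLinearMap.inr ℝ F₁ F₂) (hg₂ p hp))
    (clm _ hS hs hf₁ hg₁ h₁) (clm _ hS hs hf₂ hg₂ h₂)
  simpa using h

/-- At time zero the space derivative depends only on the restriction to the slice, and it commutes
with `dt`. Openness of `s` is needed to differentiate the equality of initial values. No order in
time is lost, which is what makes the induction in `timeJetEq_of_solution` work. -/
lemma dx {f g : ℝ × E → F} (hS : IsOpen S) (hs : ∀ y ∈ s, ((0 : ℝ), y) ∈ S) (hso : IsOpen s)
    (hf : AnalyticOnNhd ℝ f S) (hg : AnalyticOnNhd ℝ g S) (h : TimeJetEq s n f g) :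
    TimeJetEq s n (dx f) (dx g) := by
  induction n generalizing f g with
  | zero => trivial
  | succ n ih =>
    have key : ∀ {f : ℝ × E → F} (y : E), AnalyticAt ℝ f (0, y) →
        CauchyKovalevskaya.dx f (0, y) = fderiv ℝ (fun y => f (0, y)) y := fun {f} y hf => by
      have h1 : HasFDerivAt (fun y : E => ((0 : ℝ), y)) (ContinuousLinearMap.inr ℝ ℝ E) y :=
        (hasFDerivAt_const (0 : ℝ) y).prodMk (hasFDerivAt_id y)
      exact (hf.differentiableAt.hasFDerivAt.comp y h1).fderiv.symm
    refine ⟨fun y hy => ?_, ?_⟩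
    · rw [key y (hf _ (hs y hy)), key y (hg _ (hs y hy))]
      refine Filter.EventuallyEq.fderiv_eq ?_
      filter_upwards [hso.mem_nhds hy] with y' hy' using h.1 y' hy'
    · exact congr hS hs (fun p hp => (dt_dx (hf p hp)).symm) (fun p hp => (dt_dx (hg p hp)).symm)
        (ih (fun p hp => analyticAt_dt (hf p hp)) (fun p hp => analyticAt_dt (hg p hp)) h.2)

end TimeJetEq

variable {s : Set E} {S : Set (ℝ × E)}

/-- Solutions of a quasilinear first order system with the same initial values have the same
Taylor coefficients in time. -/
theorem timeJetEq_of_solution (hS : IsOpen S) (hs : ∀ y ∈ s, ((0 : ℝ), y) ∈ S) (hso : IsOpen s)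
    {A : (ℝ × E) × F → (E →L[ℝ] F) →L[ℝ] F} {b : (ℝ × E) × F → F} {w₁ w₂ : ℝ × E → F}
    [CompleteSpace E]
    (hw₁ : AnalyticOnNhd ℝ w₁ S) (hw₂ : AnalyticOnNhd ℝ w₂ S)
    (hA₁ : ∀ p ∈ S, AnalyticAt ℝ A (p, w₁ p)) (hA₂ : ∀ p ∈ S, AnalyticAt ℝ A (p, w₂ p))
    (hb₁ : ∀ p ∈ S, AnalyticAt ℝ b (p, w₁ p)) (hb₂ : ∀ p ∈ S, AnalyticAt ℝ b (p, w₂ p))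
    (he₁ : ∀ p ∈ S, dt w₁ p = A (p, w₁ p) (dx w₁ p) + b (p, w₁ p))
    (he₂ : ∀ p ∈ S, dt w₂ p = A (p, w₂ p) (dx w₂ p) + b (p, w₂ p))
    (hi : ∀ y ∈ s, w₁ (0, y) = w₂ (0, y)) (n : ℕ) : TimeJetEq s n w₁ w₂ := by
  induction n with
  | zero => trivial
  | succ n ih =>
    refine ⟨hi, ?_⟩
    have hid : AnalyticOnNhd ℝ (fun p : ℝ × E => p) S := fun p _ => analyticAt_id
    have hp₁ : AnalyticOnNhd ℝ (fun p => (p, w₁ p)) S := fun p hp => (hid p hp).prod (hw₁ p hp)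
    have hp₂ : AnalyticOnNhd ℝ (fun p => (p, w₂ p)) S := fun p hp => (hid p hp).prod (hw₂ p hp)
    have hpair := TimeJetEq.prodMk hS hs hid hw₁ hid hw₂ (TimeJetEq.refl _) ih
    have hAc := hpair.comp hS hs hp₁ hp₂ hA₁ hA₂
    have hbc := hpair.comp hS hs hp₁ hp₂ hb₁ hb₂
    have hA₁' : AnalyticOnNhd ℝ (fun p => A (p, w₁ p)) S := fun p hp =>
      AnalyticAt.comp (g := A) (hA₁ p hp) (hp₁ p hp)
    have hA₂' : AnalyticOnNhd ℝ (fun p => A (p, w₂ p)) S := fun p hp =>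
      AnalyticAt.comp (g := A) (hA₂ p hp) (hp₂ p hp)
    have hb₁' : AnalyticOnNhd ℝ (fun p => b (p, w₁ p)) S := fun p hp =>
      AnalyticAt.comp (g := b) (hb₁ p hp) (hp₁ p hp)
    have hb₂' : AnalyticOnNhd ℝ (fun p => b (p, w₂ p)) S := fun p hp =>
      AnalyticAt.comp (g := b) (hb₂ p hp) (hp₂ p hp)
    have hd₁ : AnalyticOnNhd ℝ (dx w₁) S := fun p hp => analyticAt_dx (hw₁ p hp)
    have hd₂ : AnalyticOnNhd ℝ (dx w₂) S := fun p hp => analyticAt_dx (hw₂ p hp)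
    have hm := TimeJetEq.bilin (ContinuousLinearMap.id ℝ ((E →L[ℝ] F) →L[ℝ] F)) hS hs hA₁' hd₁
      hA₂' hd₂ hAc (ih.dx hS hs hso hw₁ hw₂)
    -- The right hand side contains no time derivative, so its jet of order `n` is determined by
    -- that of the solution; by the equation it is the jet of order `n` of `dt w`.
    exact TimeJetEq.congr hS hs (fun p hp => (he₁ p hp).symm) (fun p hp => (he₂ p hp).symm)
      (hm.add hS hs (fun p hp => (hA₁' p hp).clm_app (hd₁ p hp)) hb₁'
        (fun p hp => (hA₂' p hp).clm_app (hd₂ p hp)) hb₂' hbc)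

lemma analyticAt_slice {f : ℝ × E → F} {t : ℝ} {y : E} (hf : AnalyticAt ℝ f (t, y)) :
    AnalyticAt ℝ (fun t => f (t, y)) t :=
  AnalyticAt.comp (g := f) (f := fun t => (t, y)) hf (analyticAt_id.prod analyticAt_const)

lemma deriv_slice {G : Type*} [NormedAddCommGroup G] [NormedSpace ℝ G] {f : ℝ × E → G} {t : ℝ}
    {y : E} (hf : DifferentiableAt ℝ f (t, y)) : deriv (fun t => f (t, y)) t = dt f (t, y) := by
  have h1 : HasDerivAt (fun t : ℝ => (t, y)) ((1 : ℝ), (0 : E)) t :=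
    (hasDerivAt_id t).prodMk (hasDerivAt_const t y)
  exact (hf.hasFDerivAt.comp_hasDerivAt t h1).deriv

lemma TimeJetEq.iteratedDeriv_eq {f g : ℝ × E → F} {y : E} (hy : y ∈ s)
    (hf : AnalyticAt ℝ f (0, y)) (hg : AnalyticAt ℝ g (0, y)) {n : ℕ}
    (h : TimeJetEq s (n + 1) f g) :
    iteratedDeriv n (fun t => f (t, y)) 0 = iteratedDeriv n (fun t => g (t, y)) 0 := by
  induction n generalizing f g with
  | zero => simpa using h.1 y hy
  | succ n ih =>
    have key : ∀ {f : ℝ × E → F}, AnalyticAt ℝ f (0, y) →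
        deriv (fun t => f (t, y)) =ᶠ[𝓝 0] fun t => dt f (t, y) := fun {f} hf => by
      have h1 : Tendsto (fun t : ℝ => (t, y)) (𝓝 0) (𝓝 (0, y)) :=
        Continuous.tendsto (by fun_prop) 0
      filter_upwards [h1.eventually hf.eventually_analyticAt] with t ht
      exact deriv_slice ht.differentiableAt
    rw [iteratedDeriv_succ', iteratedDeriv_succ', (key hf).iteratedDeriv_eq n,
      (key hg).iteratedDeriv_eq n]
    exact ih (analyticAt_dt hf) (analyticAt_dt hg) h.2

/-- Analytic functions with the same Taylor coefficients in time agree along intervals. -/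
theorem eqOn_of_timeJetEq {f g : ℝ × E → F} {y : E} (hy : y ∈ s) {J : Set ℝ}
    (hJ : IsPreconnected J) (h0 : (0 : ℝ) ∈ J) (hf : ∀ t ∈ J, AnalyticAt ℝ f (t, y))
    (hg : ∀ t ∈ J, AnalyticAt ℝ g (t, y)) (h : ∀ n, TimeJetEq s n f g) :
    ∀ t ∈ J, f (t, y) = g (t, y) := by
  have hf' : AnalyticOnNhd ℝ (fun t => f (t, y)) J := fun t ht => analyticAt_slice (hf t ht)
  have hg' : AnalyticOnNhd ℝ (fun t => g (t, y)) J := fun t ht => analyticAt_slice (hg t ht)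
  have hd : AnalyticAt ℝ (fun t => f (t, y) - g (t, y)) 0 := (hf' 0 h0).fun_sub (hg' 0 h0)
  have hz : ∀ k, iteratedDeriv k (fun t => f (t, y) - g (t, y)) 0 = 0 := fun k => by
    have h1 := iteratedDeriv_fun_sub (n := k) (hf' 0 h0).contDiffAt (hg' 0 h0).contDiffAt
    rw [h1, (h (k + 1)).iteratedDeriv_eq hy (hf 0 h0) (hg 0 h0), sub_self]
  -- All time derivatives of the difference vanish at zero, so its order there is infinite and it
  -- vanishes near zero; the identity theorem spreads this over `J`.
  have htop : analyticOrderAt (fun t => f (t, y) - g (t, y)) 0 = ⊤ :=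
    ENat.eq_top_iff_forall_ge.2 fun n =>
      (natCast_le_analyticOrderAt_iff_iteratedDeriv_eq_zero hd).2 fun i _ => hz i
  have he := analyticOrderAt_eq_top.1 htop
  exact hf'.eqOn_of_preconnected_of_eventuallyEq hg' hJ h0 (he.mono fun t ht => sub_eq_zero.1 ht)

end Uniqueness

end CauchyKovalevskaya

end

/-! ### Koszul formula in coordinates and its naturality -/

noncomputable section

namespace LocalGeom

variable {E : Type*} [NormedAddCommGroup E] [NormedSpace ℝ E] [FiniteDimensional ℝ E]

/-- The bilinear form has trivial left kernel. -/
def Nondeg (B : E →L[ℝ] E →L[ℝ] ℝ) : Prop := ∀ v, (∀ w, B v w = 0) → v = 0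

lemma Nondeg.isInvertible {B : E →L[ℝ] E →L[ℝ] ℝ} (hB : Nondeg B) : B.IsInvertible := by
  have hinj : Function.Injective (B : E →ₗ[ℝ] E →L[ℝ] ℝ) := by
    rw [injective_iff_map_eq_zero]
    intro v hv
    exact hB v fun w => by
      have : B v = 0 := hv
      simp [this]
  have hfin : Module.finrank ℝ E = Module.finrank ℝ (E →L[ℝ] ℝ) := by
    rw [← Subspace.dual_finrank_eq (K := ℝ) (V := E)]
    exact LinearEquiv.finrank_eq LinearMap.toContinuousLinearMap
  let e := (LinearEquiv.ofInjectiveOfFinrankEq (B : E →ₗ[ℝ] E →L[ℝ] ℝ) hinj hfin)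
  refine ⟨e.toContinuousLinearEquiv, ?_⟩
  ext v w
  rfl

lemma Nondeg.apply_inverse {B : E →L[ℝ] E →L[ℝ] ℝ} (hB : Nondeg B) (α : E →L[ℝ] ℝ) :
    B (B.inverse α) = α := by
  obtain ⟨e, he⟩ := hB.isInvertible
  rw [← he, ContinuousLinearMap.inverse_equiv]
  simp

lemma Nondeg.inverse_apply {B : E →L[ℝ] E →L[ℝ] ℝ} (hB : Nondeg B) (v : E) :
    B.inverse (B v) = v := by
  obtain ⟨e, he⟩ := hB.isInvertible
  rw [← he, ContinuousLinearMap.inverse_equiv]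
  simp

lemma Nondeg.eq_of_forall {B : E →L[ℝ] E →L[ℝ] ℝ} (hB : Nondeg B) {v v' : E}
    (h : ∀ w, B v w = B v' w) : v = v' := by
  rw [← sub_eq_zero]
  exact hB _ fun w => by simp [h w]

lemma nondeg_of_pos {B : E →L[ℝ] E →L[ℝ] ℝ} (hB : ∀ v, v ≠ 0 → 0 < B v v) : Nondeg B :=
  fun v hv => by
    by_contra h
    exact (hB v h).ne' (hv v)

/-- Nondegeneracy gives both existence and uniqueness of the dual vector, so the choice made by
`sharp` is forced and depends analytically on the form. -/
lemma sharp_eq_inverse {B : E →L[ℝ] E →L[ℝ] ℝ} (hB : Nondeg B) (α : E →L[ℝ] ℝ) :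
    sharp (fun v w => B v w) (fun w => α w) = B.inverse α := by
  refine hB.eq_of_forall fun w => ?_
  rw [hB.apply_inverse]
  exact Classical.epsilon_spec (p := fun v => ∀ w, B v w = α w)
    ⟨B.inverse α, fun w => by rw [hB.apply_inverse]⟩ w

/-- Christoffel symbols of the first kind of a field of bilinear forms with derivative `D`. -/
def firstKind (D : E →L[ℝ] E →L[ℝ] E →L[ℝ] ℝ) : E →L[ℝ] E →L[ℝ] E →L[ℝ] ℝ :=
  (1 / 2 : ℝ) • (D + D.flip -
    ((ContinuousLinearMap.flipₗᵢ ℝ E E ℝ).toContinuousLinearEquiv.toContinuousLinearMap).comp D.flip)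

lemma firstKind_apply (D : E →L[ℝ] E →L[ℝ] E →L[ℝ] ℝ) (v w z : E) :
    firstKind D v w z = 1 / 2 * (D v w z + D w v z - D z v w) := rfl

/-- Christoffel symbols of the second kind of a form `B` with derivative `D`. -/
def secondKind (B : E →L[ℝ] E →L[ℝ] ℝ) (D : E →L[ℝ] E →L[ℝ] E →L[ℝ] ℝ) : E →L[ℝ] E →L[ℝ] E :=
  (ContinuousLinearMap.compL ℝ E (E →L[ℝ] ℝ) E B.inverse).comp (firstKind D)

lemma secondKind_apply (B : E →L[ℝ] E →L[ℝ] ℝ) (D : E →L[ℝ] E →L[ℝ] E →L[ℝ] ℝ) (v w : E) :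
    secondKind B D v w = B.inverse (firstKind D v w) := rfl

lemma Nondeg.apply_secondKind {B : E →L[ℝ] E →L[ℝ] ℝ} (hB : Nondeg B)
    (D : E →L[ℝ] E →L[ℝ] E →L[ℝ] ℝ) (v w z : E) :
    B (secondKind B D v w) z = 1 / 2 * (D v w z + D w v z - D z v w) := by
  rw [secondKind_apply, hB.apply_inverse, firstKind_apply]

lemma fderiv_bilin_apply {E' : Type*} [NormedAddCommGroup E'] [NormedSpace ℝ E']
    {B : E' → E →L[ℝ] E →L[ℝ] ℝ} {y : E'} (hB : DifferentiableAt ℝ B y)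
    (v w : E) (z : E') : fderiv ℝ (fun p => B p v w) y z = fderiv ℝ B y z v w := by
  have h1 : DifferentiableAt ℝ (fun p => B p v) y := by fun_prop
  rw [fderiv_clm_apply h1 (differentiableAt_const _), fderiv_clm_apply hB (differentiableAt_const _)]
  simp

lemma christoffel_eq {B : E → E →L[ℝ] E →L[ℝ] ℝ} {y : E} (hB : DifferentiableAt ℝ B y)
    (hn : Nondeg (B y)) (v w : E) :
    christoffel (fun p v w => B p v w) y v w = secondKind (B y) (fderiv ℝ B y) v w := by
  rw [secondKind_apply, ← sharp_eq_inverse hn]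
  unfold christoffel
  congr 1
  ext z
  rw [fderiv_bilin_apply hB, fderiv_bilin_apply hB, fderiv_bilin_apply hB, firstKind_apply]

/-- The product of the covariant derivative of `X` in direction `v` with `z`. -/
def koszul (B : E → E →L[ℝ] E →L[ℝ] ℝ) (X : E → E) (y v z : E) : ℝ :=
  B y (fderiv ℝ X y v) z + 1 / 2 * (fderiv ℝ B y v (X y) z + fderiv ℝ B y (X y) v z
    - fderiv ℝ B y z v (X y))

lemma apply_cov {B : E → E →L[ℝ] E →L[ℝ] ℝ} {y : E} (hB : DifferentiableAt ℝ B y)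
    (hn : Nondeg (B y)) (X : E → E) (v z : E) :
    B y (cov (fun p v w => B p v w) X y v) z = koszul B X y v z := by
  rw [cov, christoffel_eq hB hn, map_add, add_apply, hn.apply_secondKind, koszul]

/-- Lowering the index removes the inverse metric, so that parallelism becomes an identity that is
polynomial in the metric, the field and their first derivatives. -/
lemma cov_eq_zero_iff {B : E → E →L[ℝ] E →L[ℝ] ℝ} {y : E} (hB : DifferentiableAt ℝ B y)
    (hn : Nondeg (B y)) (X : E → E) :
    (∀ v, cov (fun p v w => B p v w) X y v = 0) ↔ ∀ v z, koszul B X y v z = 0 := by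
  refine ⟨fun h v z => ?_, fun h v => hn _ fun z => ?_⟩
  · rw [← apply_cov hB hn, h v]; simp
  · rw [apply_cov hB hn, h v z]

/-- The covariant derivative is natural under changes of coordinates. -/
lemma koszul_pullback {B B' : E → E →L[ℝ] E →L[ℝ] ℝ} {X X' : E → E} {ψ : E → E} {y : E}
    (hψ : AnalyticAt ℝ ψ y)
    (hB : DifferentiableAt ℝ B (ψ y)) (hX : DifferentiableAt ℝ X (ψ y))
    (hX' : DifferentiableAt ℝ X' y)
    (hsymm : ∀ v w, B (ψ y) v w = B (ψ y) w v)
    (hBB' : ∀ᶠ p in 𝓝 y, ∀ v w, B' p v w = B (ψ p) (fderiv ℝ ψ p v) (fderiv ℝ ψ p w))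
    (hXX' : ∀ᶠ p in 𝓝 y, X (ψ p) = fderiv ℝ ψ p (X' p)) (v z : E) :
    koszul B' X' y v z = koszul B X (ψ y) (fderiv ℝ ψ y v) (fderiv ℝ ψ y z) := by
  have := FiniteDimensional.complete ℝ E
  have hψd := hψ.differentiableAt
  have hψd2 : DifferentiableAt ℝ (fderiv ℝ ψ) y := hψ.fderiv.differentiableAt
  have hQ : ∀ v w, fderiv ℝ (fderiv ℝ ψ) y v w = fderiv ℝ (fderiv ℝ ψ) y w v := fun v w =>
    (hψ.contDiffAt (n := ω)).isSymmSndFDerivAt_of_omega v w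
  have hBψ : HasFDerivAt (fun p => B (ψ p)) ((fderiv ℝ B (ψ y)).comp (fderiv ℝ ψ y)) y :=
    hB.hasFDerivAt.comp y hψd.hasFDerivAt
  set N : E → E →L[ℝ] E →L[ℝ] ℝ := fun p => (B (ψ p)).bilinearComp (fderiv ℝ ψ p) (fderiv ℝ ψ p)
    with hN
  have hB'N : B' =ᶠ[𝓝 y] N := by
    filter_upwards [hBB'] with p hp
    ext v w
    exact hp v w
  have hNd : DifferentiableAt ℝ N y := by
    have h1 : N = fun p => ((ContinuousLinearMap.compL ℝ E E ℝ).flip (fderiv ℝ ψ p)).comp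
        ((B (ψ p)).comp (fderiv ℝ ψ p)) := rfl
    rw [h1]
    have h2 : DifferentiableAt ℝ (fun p => B (ψ p)) y := hBψ.differentiableAt
    have h3 : DifferentiableAt ℝ (fun p => (ContinuousLinearMap.compL ℝ E E ℝ).flip
      (fderiv ℝ ψ p)) y := (ContinuousLinearMap.differentiableAt _).comp y hψd2
    exact h3.clm_comp (h2.clm_comp hψd2)
  have hB'd : ∀ a w z, fderiv ℝ B' y a w z = fderiv ℝ B (ψ y) (fderiv ℝ ψ y a)
      (fderiv ℝ ψ y w) (fderiv ℝ ψ y z) + B (ψ y) (fderiv ℝ (fderiv ℝ ψ) y a w) (fderiv ℝ ψ y z)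
      + B (ψ y) (fderiv ℝ ψ y w) (fderiv ℝ (fderiv ℝ ψ) y a z) := by
    intro a w z
    rw [hB'N.fderiv_eq, ← fderiv_bilin_apply hNd]
    have h1 : HasFDerivAt (fun p => fderiv ℝ ψ p w) ((fderiv ℝ (fderiv ℝ ψ) y).flip w) y := by
      simpa using hψd2.hasFDerivAt.clm_apply (hasFDerivAt_const w y)
    have h2 : HasFDerivAt (fun p => fderiv ℝ ψ p z) ((fderiv ℝ (fderiv ℝ ψ) y).flip z) y := by
      simpa using hψd2.hasFDerivAt.clm_apply (hasFDerivAt_const z y)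
    have h3 := (hBψ.clm_apply h1).clm_apply h2
    have h4 : (fun p => N p w z) = fun p => B (ψ p) (fderiv ℝ ψ p w) (fderiv ℝ ψ p z) := rfl
    rw [h4, h3.fderiv]
    simp
    ring
  have hX1 : fderiv ℝ X (ψ y) (fderiv ℝ ψ y v) =
      fderiv ℝ (fderiv ℝ ψ) y v (X' y) + fderiv ℝ ψ y (fderiv ℝ X' y v) := by
    have h1 : HasFDerivAt (fun p => X (ψ p)) ((fderiv ℝ X (ψ y)).comp (fderiv ℝ ψ y)) y :=
      hX.hasFDerivAt.comp y hψd.hasFDerivAt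
    have h2 := hψd2.hasFDerivAt.clm_apply hX'.hasFDerivAt
    have h3 := h1.fderiv
    have h5 : (fun p => X (ψ p)) =ᶠ[𝓝 y] fun p => fderiv ℝ ψ p (X' p) := hXX'
    rw [h5.fderiv_eq, h2.fderiv] at h3
    have h4 := congr($h3 v)
    simp at h4
    rw [← h4, add_comm]
  have hX0 : X (ψ y) = fderiv ℝ ψ y (X' y) := hXX'.self_of_nhds
  have hB0 : B' y = N y := hB'N.self_of_nhds
  unfold koszul
  -- Of the six terms with second derivatives of `ψ`, symmetry of `D²ψ` and of `B` leaves only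
  -- `B(D²ψ(v, X'), Dψ z)`. It equals the extra term in the derivative of `X` along `ψ`.
  rw [hB'd, hB'd, hB'd, hX1, hX0, hB0, hQ (X' y) v, hQ (X' y) z, hQ z v,
    hsymm (fderiv ℝ (fderiv ℝ ψ) y v z)]
  simp only [hN, ContinuousLinearMap.bilinearComp_apply, map_add, add_apply]
  ring

end LocalGeom

end

/-! ### The parallel equation for `-λ² dt² + g_t` in coordinates -/

noncomputable section

namespace LocalGeom

open CauchyKovalevskaya

variable {E : Type*} [NormedAddCommGroup E] [NormedSpace ℝ E] [FiniteDimensional ℝ E]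

/-- The form `-λ² dt² + g_t` in coordinates. -/
def lorentzForm (lam : ℝ × E → ℝ) (g : ℝ × E → E →L[ℝ] E →L[ℝ] ℝ) (p : ℝ × E) :
    (ℝ × E) →L[ℝ] (ℝ × E) →L[ℝ] ℝ :=
  (-(lam p ^ 2)) • (ContinuousLinearMap.fst ℝ ℝ E).smulRight (ContinuousLinearMap.fst ℝ ℝ E)
    + (g p).bilinearComp (ContinuousLinearMap.snd ℝ ℝ E) (ContinuousLinearMap.snd ℝ ℝ E)

lemma lorentzForm_apply (lam : ℝ × E → ℝ) (g : ℝ × E → E →L[ℝ] E →L[ℝ] ℝ) (p v w : ℝ × E) :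
    lorentzForm lam g p v w = -(lam p ^ 2) * (v.1 * w.1) + g p v.2 w.2 := by
  simp [lorentzForm, mul_comm, mul_assoc]

/-- The field `(u / λ) ∂_t - U` in coordinates. -/
def nullVec (lam : ℝ × E → ℝ) (U : ℝ × E → E) (u : ℝ × E → ℝ) (p : ℝ × E) : ℝ × E :=
  (u p / lam p, -U p)

/-- The equations expressing that `(u / λ) ∂_t - U` is parallel for `-λ² dt² + g_t`. -/
structure ParallelAt (lam : ℝ × E → ℝ) (g : ℝ × E → E →L[ℝ] E →L[ℝ] ℝ) (U : ℝ × E → E)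
    (u : ℝ × E → ℝ) (p : ℝ × E) : Prop where
  dt_u : dt u p = dx lam p (U p)
  dt_U : ∀ y, g p (dt U p) y = u p * dx lam p y - 1 / 2 * dt g p (U p) y
  dx_u : ∀ x, dt g p x (U p) = 2 * lam p * dx u p x
  dx_U : ∀ x y, u p * dt g p x y = lam p * (2 * g p (dx U p x) y + dx g p x (U p) y
    + dx g p (U p) x y - dx g p y x (U p))

lemma differentiableAt_lorentzForm {lam : ℝ × E → ℝ} {g : ℝ × E → E →L[ℝ] E →L[ℝ] ℝ} {p : ℝ × E}
    (hlam : DifferentiableAt ℝ lam p) (hg : DifferentiableAt ℝ g p) :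
    DifferentiableAt ℝ (lorentzForm lam g) p := by
  have h1 : DifferentiableAt ℝ (fun p => (g p).bilinearComp (ContinuousLinearMap.snd ℝ ℝ E)
      (ContinuousLinearMap.snd ℝ ℝ E)) p := by
    have h2 : (fun p => (g p).bilinearComp (ContinuousLinearMap.snd ℝ ℝ E)
      (ContinuousLinearMap.snd ℝ ℝ E)) = fun p => ((ContinuousLinearMap.compL ℝ (ℝ × E) E ℝ).flip
        (ContinuousLinearMap.snd ℝ ℝ E)).comp ((g p).comp (ContinuousLinearMap.snd ℝ ℝ E)) := rfl
    rw [h2]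
    exact (differentiableAt_const _).clm_comp (hg.clm_comp (differentiableAt_const _))
  unfold lorentzForm
  exact ((hlam.pow 2).neg.smul_const _).add h1

lemma fderiv_lorentzForm {lam : ℝ × E → ℝ} {g : ℝ × E → E →L[ℝ] E →L[ℝ] ℝ} {p : ℝ × E}
    (hlam : DifferentiableAt ℝ lam p) (hg : DifferentiableAt ℝ g p) (a v w : ℝ × E) :
    fderiv ℝ (lorentzForm lam g) p a v w =
      -(2 * lam p * fderiv ℝ lam p a) * (v.1 * w.1) + fderiv ℝ g p a v.2 w.2 := by
  rw [← fderiv_bilin_apply (differentiableAt_lorentzForm hlam hg)]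
  simp only [lorentzForm_apply]
  have h1 : HasFDerivAt (fun p => g p v.2 w.2) (((fderiv ℝ g p).flip v.2).flip w.2) p := by
    simpa using
      (hg.hasFDerivAt.clm_apply (hasFDerivAt_const v.2 p)).clm_apply (hasFDerivAt_const w.2 p)
  have h2 : HasFDerivAt (fun p => -(lam p ^ 2) * (v.1 * w.1) + g p v.2 w.2) _ p :=
    ((hlam.hasFDerivAt.pow 2).neg.mul_const (v.1 * w.1)).add h1
  rw [h2.fderiv]
  simp
  ring

lemma hasFDerivAt_nullVec {lam : ℝ × E → ℝ} {U : ℝ × E → E} {u : ℝ × E → ℝ} {p : ℝ × E}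
    (hlam : DifferentiableAt ℝ lam p) (hU : DifferentiableAt ℝ U p) (hu : DifferentiableAt ℝ u p)
    (h0 : lam p ≠ 0) :
    HasFDerivAt (nullVec lam U u) ((u p • (-(lam p ^ 2)⁻¹ • fderiv ℝ lam p) +
      (lam p)⁻¹ • fderiv ℝ u p).prod (-fderiv ℝ U p)) p := by
  have h1 := hu.hasFDerivAt.fun_mul ((hasDerivAt_inv h0).comp_hasFDerivAt p hlam.hasFDerivAt)
  simp only [Function.comp_apply, ← div_eq_mul_inv] at h1
  exact h1.prodMk hU.hasFDerivAt.neg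

lemma fderiv_eq_dt_add_dx {G : Type*} [NormedAddCommGroup G] [NormedSpace ℝ G] (f : ℝ × E → G)
    (p v : ℝ × E) : fderiv ℝ f p v = v.1 • dt f p + dx f p v.2 := by
  rw [dt, dx_apply, ← map_smul, ← map_add]
  congr 1
  ext <;> simp

/-- The expression is sorted by the time components `a` and `b` of the two arguments. Its four
groups are, up to nonzero factors, the four equations of `ParallelAt`, and they can be separated by
choosing `a`, `b`, `x`, `y`. -/
lemma koszul_lorentzForm {lam : ℝ × E → ℝ} {g : ℝ × E → E →L[ℝ] E →L[ℝ] ℝ} {U : ℝ × E → E}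
    {u : ℝ × E → ℝ} {p : ℝ × E} (hlam : DifferentiableAt ℝ lam p) (hg : DifferentiableAt ℝ g p)
    (hU : DifferentiableAt ℝ U p) (hu : DifferentiableAt ℝ u p) (h0 : lam p ≠ 0)
    (a b : ℝ) (x y : E) :
    koszul (lorentzForm lam g) (nullVec lam U u) p (a, x) (b, y) =
      a * b * (lam p * (dx lam p (U p) - dt u p))
      + a * (u p * dx lam p y - 1 / 2 * dt g p (U p) y - g p (dt U p) y)
      + b * (1 / 2 * dt g p x (U p) - lam p * dx u p x)
      + (1 / 2 * (u p / lam p) * dt g p x y - (g p (dx U p x) y + 1 / 2 * (dx g p x (U p) y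
        + dx g p (U p) x y - dx g p y x (U p)))) := by
  rw [koszul, fderiv_lorentzForm hlam hg, fderiv_lorentzForm hlam hg, fderiv_lorentzForm hlam hg,
    (hasFDerivAt_nullVec hlam hU hu h0).fderiv, lorentzForm_apply]
  simp only [nullVec, ContinuousLinearMap.prod_apply, smul_apply, neg_apply,
    fderiv_eq_dt_add_dx, add_apply, map_add, map_smul, map_neg, smul_eq_mul]
  field_simp
  ring

lemma koszul_lorentzForm_eq_zero_iff {lam : ℝ × E → ℝ} {g : ℝ × E → E →L[ℝ] E →L[ℝ] ℝ}
    {U : ℝ × E → E} {u : ℝ × E → ℝ} {p : ℝ × E} (hlam : DifferentiableAt ℝ lam p)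
    (hg : DifferentiableAt ℝ g p)
    (hU : DifferentiableAt ℝ U p) (hu : DifferentiableAt ℝ u p) (h0 : lam p ≠ 0) :
    (∀ v z, koszul (lorentzForm lam g) (nullVec lam U u) p v z = 0) ↔
      ParallelAt lam g U u p := by
  constructor
  · intro h
    have h' := fun a b x y => (koszul_lorentzForm hlam hg hU hu h0 a b x y).symm.trans
      (h (a, x) (b, y))
    refine ⟨?_, fun y => ?_, fun x => ?_, fun x y => ?_⟩
    · have := h' 1 1 0 0
      simp at this
      rcases this with h | h
      · exact absurd h h0
      · linarith
    · have := h' 1 0 0 y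
      simp at this
      linarith
    · have := h' 0 1 x 0
      simp at this
      linarith
    · have := h' 0 0 x y
      simp only [zero_mul, zero_add, mul_zero] at this
      field_simp at this
      linarith
  · rintro ⟨h1, h2, h3, h4⟩ ⟨a, x⟩ ⟨b, y⟩
    rw [koszul_lorentzForm hlam hg hU hu h0, h1, h2, h3]
    have : 1 / 2 * (u p / lam p) * dt g p x y = g p (dx U p x) y + 1 / 2 * (dx g p x (U p) y
        + dx g p (U p) x y - dx g p y x (U p)) := by
      field_simp
      linarith [h4 x y]
    rw [this]
    ring

lemma nondeg_lorentzForm {lam : ℝ × E → ℝ} {g : ℝ × E → E →L[ℝ] E →L[ℝ] ℝ} {p : ℝ × E}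
    (h0 : lam p ≠ 0) (hg : Nondeg (g p)) : Nondeg (lorentzForm lam g p) := by
  rintro ⟨a, x⟩ h
  have h1 := h (1, 0)
  have h2 := fun y => h (0, y)
  simp only [lorentzForm_apply, mul_one, mul_zero, zero_add, map_zero, add_zero] at h1 h2
  have ha : a = 0 := by simpa [h0] using h1
  rw [ha, hg x h2]
  rfl

end LocalGeom

end

set_option synthInstance.maxHeartbeats 200000
set_option maxHeartbeats 400000

/-! ### Transport equations, and the first order system for `(g(U, ·), u, g)` -/

noncomputable section

namespace CauchyKovalevskaya

universe u

variable {E F : Type u} [NormedAddCommGroup E] [NormedSpace ℝ E] [CompleteSpace E]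
  [NormedAddCommGroup F] [NormedSpace ℝ F] [CompleteSpace F]

/-- Uniqueness for systems on boxes. -/
lemma eqOn_ball_of_solution {y₀ : E} {r : ℝ}
    {A : (ℝ × E) × F → (E →L[ℝ] F) →L[ℝ] F} {b : (ℝ × E) × F → F} {w₁ w₂ : ℝ × E → F}
    (hw₁ : AnalyticOnNhd ℝ w₁ (Metric.ball (0, y₀) r))
    (hw₂ : AnalyticOnNhd ℝ w₂ (Metric.ball (0, y₀) r))
    (hA₁ : ∀ p ∈ Metric.ball ((0 : ℝ), y₀) r, AnalyticAt ℝ A (p, w₁ p))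
    (hA₂ : ∀ p ∈ Metric.ball ((0 : ℝ), y₀) r, AnalyticAt ℝ A (p, w₂ p))
    (hb₁ : ∀ p ∈ Metric.ball ((0 : ℝ), y₀) r, AnalyticAt ℝ b (p, w₁ p))
    (hb₂ : ∀ p ∈ Metric.ball ((0 : ℝ), y₀) r, AnalyticAt ℝ b (p, w₂ p))
    (he₁ : ∀ p ∈ Metric.ball ((0 : ℝ), y₀) r, dt w₁ p = A (p, w₁ p) (dx w₁ p) + b (p, w₁ p))
    (he₂ : ∀ p ∈ Metric.ball ((0 : ℝ), y₀) r, dt w₂ p = A (p, w₂ p) (dx w₂ p) + b (p, w₂ p))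
    (hi : ∀ y ∈ Metric.ball y₀ r, w₁ (0, y) = w₂ (0, y)) :
    ∀ p ∈ Metric.ball ((0 : ℝ), y₀) r, w₁ p = w₂ p := by
  rintro ⟨t, y⟩ hp
  have hball : ∀ {t : ℝ} {y : E}, (t, y) ∈ Metric.ball ((0 : ℝ), y₀) r ↔
      t ∈ Metric.ball (0 : ℝ) r ∧ y ∈ Metric.ball y₀ r := fun {t y} => by
    rw [← ball_prod_same]; rfl
  have hp' := hball.1 hp
  have hr : 0 < r := Metric.pos_of_mem_ball hp
  have h0 : (0 : ℝ) ∈ Metric.ball (0 : ℝ) r := Metric.mem_ball_self hr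
  have hjet := timeJetEq_of_solution (s := Metric.ball y₀ r) Metric.isOpen_ball
    (fun y hy => hball.2 ⟨h0, hy⟩) Metric.isOpen_ball hw₁ hw₂ hA₁ hA₂ hb₁ hb₂ he₁ he₂ hi
  exact eqOn_of_timeJetEq hp'.2 (convex_ball (0 : ℝ) r).isPreconnected h0
    (fun t ht => hw₁ _ (hball.2 ⟨ht, hp'.2⟩)) (fun t ht => hw₂ _ (hball.2 ⟨ht, hp'.2⟩)) hjet t hp'.1

/-- Solutions of transport equations with zero initial values vanish. -/
lemma transport_eq_zero {y₀ : E} {r : ℝ} {f : ℝ × E → F} {c : ℝ × E → E}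
    (hf : AnalyticOnNhd ℝ f (Metric.ball (0, y₀) r))
    (hc : AnalyticOnNhd ℝ c (Metric.ball (0, y₀) r))
    (he : ∀ p ∈ Metric.ball ((0 : ℝ), y₀) r, dt f p = dx f p (c p))
    (hi : ∀ y ∈ Metric.ball y₀ r, f (0, y) = 0) :
    ∀ p ∈ Metric.ball ((0 : ℝ), y₀) r, f p = 0 := by
  have hA : ∀ p ∈ Metric.ball ((0 : ℝ), y₀) r, ∀ w : F, AnalyticAt ℝ
      (fun q : (ℝ × E) × F => (ContinuousLinearMap.id ℝ (E →L[ℝ] F)).flip (c q.1)) (p, w) :=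
    fun p hp w => AnalyticAt.clm_const _
      (AnalyticAt.comp (g := c) (f := Prod.fst) (hc p hp) analyticAt_fst)
  refine eqOn_ball_of_solution (w₂ := fun _ => 0) (b := fun _ => 0) hf
    (fun p _ => analyticAt_const) (fun p hp => hA p hp _) (fun p hp => hA p hp _)
    (fun p _ => analyticAt_const) (fun p _ => analyticAt_const) (fun p hp => ?_) (fun p hp => ?_) hi
  · rw [he p hp, add_zero]; rfl
  · simp [dt, dx]

end CauchyKovalevskaya

namespace LocalGeom

open CauchyKovalevskaya

section SystemCoefficients

variable {E K : Type*} [NormedAddCommGroup E] [NormedSpace ℝ E] [NormedAddCommGroup K]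
  [NormedSpace ℝ K]

/-- For `ev U D = D · · U` and the transposition `τ`, the operator taking `U` and the derivative
`D` of the metric to `(x, y) ↦ D x y U + D y x U - D U x y`. -/
def lowered (τ : (E →L[ℝ] K) →L[ℝ] (E →L[ℝ] K))
    (ev : E →L[ℝ] (E →L[ℝ] E →L[ℝ] K) →L[ℝ] (E →L[ℝ] K)) :
    E →L[ℝ] (E →L[ℝ] E →L[ℝ] K) →L[ℝ] (E →L[ℝ] K) :=
  ev + (ContinuousLinearMap.compL ℝ (E →L[ℝ] E →L[ℝ] K) (E →L[ℝ] K) (E →L[ℝ] K) τ).comp ev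
    - (ContinuousLinearMap.id ℝ (E →L[ℝ] E →L[ℝ] K)).flip

/-- The right hand side of the evolution equation of the metric, up to the factor `λ / u`. -/
def metricRhs (τ : (E →L[ℝ] K) →L[ℝ] (E →L[ℝ] K))
    (ev : E →L[ℝ] (E →L[ℝ] E →L[ℝ] K) →L[ℝ] (E →L[ℝ] K)) :
    E →L[ℝ] (E →L[ℝ] K × ℝ × (E →L[ℝ] K)) →L[ℝ] (E →L[ℝ] K) :=
  ((ContinuousLinearMap.compL ℝ (E →L[ℝ] K × ℝ × (E →L[ℝ] K)) (E →L[ℝ] E →L[ℝ] K)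
      (E →L[ℝ] K)).flip (ContinuousLinearMap.compL ℝ E (K × ℝ × (E →L[ℝ] K)) (E →L[ℝ] K)
    ((ContinuousLinearMap.snd ℝ _ _).comp (ContinuousLinearMap.snd ℝ _ _)))).comp (lowered τ ev)

/-- The linear part of the system for `(g(U, ·), u, g)`. -/
def linearPart (τ : (E →L[ℝ] K) →L[ℝ] (E →L[ℝ] K))
    (ev : E →L[ℝ] (E →L[ℝ] E →L[ℝ] K) →L[ℝ] (E →L[ℝ] K))
    (ι : (E →L[ℝ] ℝ) →L[ℝ] K) (l c : ℝ) (U : E) :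
    (E →L[ℝ] K × ℝ × (E →L[ℝ] K)) →L[ℝ] K × ℝ × (E →L[ℝ] K) :=
  l • (ContinuousLinearMap.inl ℝ K (ℝ × (E →L[ℝ] K))).comp (ι.comp
      (ContinuousLinearMap.compL ℝ E (K × ℝ × (E →L[ℝ] K)) ℝ
        ((ContinuousLinearMap.fst ℝ _ _).comp (ContinuousLinearMap.snd ℝ _ _)))) +
    c • ContinuousLinearMap.compL ℝ (E →L[ℝ] K × ℝ × (E →L[ℝ] K)) (E →L[ℝ] K)
        (K × ℝ × (E →L[ℝ] K))
      ((ContinuousLinearMap.inr ℝ K (ℝ × (E →L[ℝ] K))).comp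
        (ContinuousLinearMap.inr ℝ ℝ (E →L[ℝ] K)))
      ((ContinuousLinearMap.id ℝ (E →L[ℝ] K) + τ).comp
        (ContinuousLinearMap.compL ℝ E (K × ℝ × (E →L[ℝ] K)) K (ContinuousLinearMap.fst ℝ _ _))
          - metricRhs τ ev U)

lemma analyticAt_linearPart {Z : Type*} [NormedAddCommGroup Z] [NormedSpace ℝ Z]
    (τ : (E →L[ℝ] K) →L[ℝ] (E →L[ℝ] K))
    (ev : E →L[ℝ] (E →L[ℝ] E →L[ℝ] K) →L[ℝ] (E →L[ℝ] K)) (ι : (E →L[ℝ] ℝ) →L[ℝ] K)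
    {l c : Z → ℝ} {U : Z → E} {z : Z} (hl : AnalyticAt ℝ l z) (hc : AnalyticAt ℝ c z)
    (hU : AnalyticAt ℝ U z) : AnalyticAt ℝ (fun z => linearPart τ ev ι (l z) (c z) (U z)) z :=
  (hl.fun_smul analyticAt_const).fun_add (hc.fun_smul
    (AnalyticAt.clm_const _ (analyticAt_const.fun_sub (AnalyticAt.clm_const _ hU))))

/-- Here `K` stands for the dual of `E`, `τ` for transposition and `ev` for evaluation in the last
slot. With `b`, `d`, `D` the space derivatives of `β`, `u`, `g`, the last component is `c` times the
symmetrized derivative of `β` minus twice the Christoffel term `g(Γ(x, y), U)`, that is, `c` times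
`L_U g` when `g` is symmetric and `β = g(U, ·)`. -/
lemma linearPart_apply (τ : (E →L[ℝ] K) →L[ℝ] (E →L[ℝ] K))
    (ev : E →L[ℝ] (E →L[ℝ] E →L[ℝ] K) →L[ℝ] (E →L[ℝ] K)) (ι : (E →L[ℝ] ℝ) →L[ℝ] K)
    (l c : ℝ) (U : E) (b : E →L[ℝ] K) (d : E →L[ℝ] ℝ) (D : E →L[ℝ] E →L[ℝ] K) :
    linearPart τ ev ι l c U (b.prod (d.prod D)) =
      (l • ι d, 0, c • (b + τ b - (ev U D + τ (ev U D) - D U))) := by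
  ext1
  · simp [linearPart]
    rfl
  · simp [linearPart, metricRhs, lowered]
    rfl

end SystemCoefficients

section System

variable (E : Type*) [NormedAddCommGroup E] [NormedSpace ℝ E] [FiniteDimensional ℝ E]

/-- Values of the unknowns `(g(U, ·), u, g)`. -/
abbrev Unknowns : Type _ := (E →L[ℝ] ℝ) × ℝ × (E →L[ℝ] E →L[ℝ] ℝ)

/-- Transposition of bilinear forms. -/
def transp : (E →L[ℝ] E →L[ℝ] ℝ) →L[ℝ] (E →L[ℝ] E →L[ℝ] ℝ) :=
  (ContinuousLinearMap.flipₗᵢ ℝ E E ℝ).toContinuousLinearEquiv.toContinuousLinearMap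

/-- The operator taking `U` and the derivative `D` of the metric to the form
`(x, y) ↦ D x y U`. -/
def evalLast : E →L[ℝ] (E →L[ℝ] E →L[ℝ] E →L[ℝ] ℝ) →L[ℝ] (E →L[ℝ] E →L[ℝ] ℝ) :=
  (ContinuousLinearMap.compL ℝ E (E →L[ℝ] E →L[ℝ] ℝ) (E →L[ℝ] ℝ)).comp
    ((ContinuousLinearMap.compL ℝ E (E →L[ℝ] ℝ) ℝ).comp
      (ContinuousLinearMap.id ℝ (E →L[ℝ] ℝ)).flip)

variable {E}

/-- Coefficients of the first order system for `(g(U, ·), u, g)`. -/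
def sysCoeff (lam : ℝ × E → ℝ) (q : (ℝ × E) × Unknowns E) :
    (E →L[ℝ] Unknowns E) →L[ℝ] Unknowns E :=
  linearPart (transp E) (evalLast E) (ContinuousLinearMap.id ℝ _) (lam q.1)
    (lam q.1 * q.2.2.1⁻¹) (q.2.2.2.inverse q.2.1)

/-- Inhomogeneity of the first order system for `(g(U, ·), u, g)`. -/
def sysInhom (lam : ℝ × E → ℝ) (q : (ℝ × E) × Unknowns E) : Unknowns E :=
  (q.2.2.1 • dx lam q.1, dx lam q.1 (q.2.2.2.inverse q.2.1), 0)

lemma analyticAt_inverse_apply {q : (ℝ × E) × Unknowns E} (hg : Nondeg q.2.2.2) :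
    AnalyticAt ℝ (fun q : (ℝ × E) × Unknowns E => q.2.2.2.inverse q.2.1) q := by
  have := FiniteDimensional.complete ℝ E
  have h1 : AnalyticAt ℝ (fun q : (ℝ × E) × Unknowns E => q.2.2.2) q :=
    (((ContinuousLinearMap.snd ℝ ℝ (E →L[ℝ] E →L[ℝ] ℝ)).comp
      (ContinuousLinearMap.snd ℝ (E →L[ℝ] ℝ) _)).comp
      (ContinuousLinearMap.snd ℝ (ℝ × E) (Unknowns E))).analyticAt q
  have h2 : AnalyticAt ℝ (fun q : (ℝ × E) × Unknowns E => q.2.1) q :=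
    ((ContinuousLinearMap.fst ℝ (E →L[ℝ] ℝ) (ℝ × (E →L[ℝ] E →L[ℝ] ℝ))).comp
      (ContinuousLinearMap.snd ℝ (ℝ × E) (Unknowns E))).analyticAt q
  have h3 : AnalyticAt ℝ (ContinuousLinearMap.inverse : (E →L[ℝ] E →L[ℝ] ℝ) → _) q.2.2.2 :=
    (hg.isInvertible.contDiffAt_map_inverse (n := ω)).analyticAt
  exact (AnalyticAt.comp (f := fun q : (ℝ × E) × Unknowns E => q.2.2.2) h3 h1).clm_app h2

lemma analyticAt_sysCoeff {lam : ℝ × E → ℝ} {q : (ℝ × E) × Unknowns E}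
    (hlam : AnalyticAt ℝ lam q.1) (hu : q.2.2.1 ≠ 0) (hg : Nondeg q.2.2.2) :
    AnalyticAt ℝ (sysCoeff lam) q := by
  have h1 : AnalyticAt ℝ (fun q : (ℝ × E) × Unknowns E => lam q.1) q :=
    AnalyticAt.comp (g := lam) (f := Prod.fst) hlam analyticAt_fst
  have h2 : AnalyticAt ℝ (fun q : (ℝ × E) × Unknowns E => q.2.2.1) q :=
    (((ContinuousLinearMap.fst ℝ ℝ (E →L[ℝ] E →L[ℝ] ℝ)).comp
      (ContinuousLinearMap.snd ℝ (E →L[ℝ] ℝ) _)).comp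
      (ContinuousLinearMap.snd ℝ (ℝ × E) (Unknowns E))).analyticAt q
  exact analyticAt_linearPart _ _ _ h1 (h1.fun_mul (h2.fun_inv hu)) (analyticAt_inverse_apply hg)

lemma analyticAt_sysInhom {lam : ℝ × E → ℝ} {q : (ℝ × E) × Unknowns E}
    (hlam : AnalyticAt ℝ lam q.1) (hg : Nondeg q.2.2.2) :
    AnalyticAt ℝ (sysInhom lam) q := by
  have h1 : AnalyticAt ℝ (fun q : (ℝ × E) × Unknowns E => dx lam q.1) q :=
    AnalyticAt.comp (g := dx lam) (f := Prod.fst) (analyticAt_dx hlam) analyticAt_fst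
  have h2 : AnalyticAt ℝ (fun q : (ℝ × E) × Unknowns E => q.2.2.1) q :=
    (((ContinuousLinearMap.fst ℝ ℝ (E →L[ℝ] E →L[ℝ] ℝ)).comp
      (ContinuousLinearMap.snd ℝ (E →L[ℝ] ℝ) _)).comp
      (ContinuousLinearMap.snd ℝ (ℝ × E) (Unknowns E))).analyticAt q
  exact (h2.fun_smul h1).prod ((h1.clm_app (analyticAt_inverse_apply hg)).prod analyticAt_const)

/-- The system in components. -/
lemma system_iff {lam : ℝ × E → ℝ} {β : ℝ × E → E →L[ℝ] ℝ} {u : ℝ × E → ℝ}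
    {g : ℝ × E → E →L[ℝ] E →L[ℝ] ℝ} {p : ℝ × E} (hβ : DifferentiableAt ℝ β p)
    (hu : DifferentiableAt ℝ u p) (hg : DifferentiableAt ℝ g p) :
    dt (fun q => ((β q, u q, g q) : Unknowns E)) p =
        sysCoeff lam (p, (β p, u p, g p)) (dx (fun q => ((β q, u q, g q) : Unknowns E)) p) +
        sysInhom lam (p, (β p, u p, g p)) ↔
      (∀ y, dt β p y = lam p * dx u p y + u p * dx lam p y) ∧
      dt u p = dx lam p ((g p).inverse (β p)) ∧
      ∀ x y, dt g p x y = lam p * (u p)⁻¹ * (dx β p x y + dx β p y x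
        - (dx g p x y ((g p).inverse (β p)) + dx g p y x ((g p).inverse (β p))
          - dx g p ((g p).inverse (β p)) x y)) := by
  have hd := hβ.hasFDerivAt.prodMk (hu.hasFDerivAt.prodMk hg.hasFDerivAt)
  have h1 : dt (fun q => ((β q, u q, g q) : Unknowns E)) p = (dt β p, dt u p, dt g p) := by
    simp only [dt, hd.fderiv]
    rfl
  have h2 : dx (fun q => ((β q, u q, g q) : Unknowns E)) p =
      (dx β p).prod ((dx u p).prod (dx g p)) := by
    simp only [dx, hd.fderiv]
    rfl
  rw [h1, h2]
  rw [sysCoeff, linearPart_apply, sysInhom, Prod.mk_add_mk, Prod.mk_add_mk, Prod.mk.injEq,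
    Prod.mk.injEq, zero_add, add_zero]
  refine and_congr ?_ (and_congr Iff.rfl ?_)
  · exact ⟨fun h y => by rw [h]; rfl, fun h => by ext y; exact h y⟩
  · exact ⟨fun h x y => by rw [h]; rfl, fun h => by ext x y; exact h x y⟩

end System

end LocalGeom

end

/-! ### From the parallel equations to the first order system; uniqueness -/

noncomputable section

namespace LocalGeom

open CauchyKovalevskaya Filter

universe u

variable {E : Type u} [NormedAddCommGroup E] [NormedSpace ℝ E] [FiniteDimensional ℝ E]

/-- Positivity needs to be checked only on the unit sphere, which is compact. -/
lemma eventually_pos {B₀ : E →L[ℝ] E →L[ℝ] ℝ} (h : ∀ v, v ≠ 0 → 0 < B₀ v v) :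
    ∀ᶠ B in 𝓝 B₀, ∀ v, v ≠ 0 → 0 < B v v := by
  have := FiniteDimensional.proper ℝ E
  have key : ∀ᶠ B in 𝓝 B₀, ∀ v ∈ Metric.sphere (0 : E) 1, 0 < B v v := by
    refine (isCompact_sphere (0 : E) 1).eventually_forall_of_forall_eventually fun v hv => ?_
    have hc : Continuous fun z : (E →L[ℝ] E →L[ℝ] ℝ) × E => z.1 z.2 z.2 := by fun_prop
    refine hc.continuousAt.eventually (lt_mem_nhds (h v ?_))
    rintro rfl
    simp at hv
  filter_upwards [key] with B hB v hv
  have hn : 0 < ‖v‖ := norm_pos_iff.2 hv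
  have h1 := hB (‖v‖⁻¹ • v) (by simp [norm_smul, hn.ne'])
  simp only [map_smul, smul_apply, smul_eq_mul, ← mul_assoc] at h1
  exact pos_of_mul_pos_right h1 (by positivity)

/-- An analytic family of metrics, vector fields and functions on `S` satisfying the equations for
a parallel null vector field. -/
structure ParallelFamily (lam : ℝ × E → ℝ) (S : Set (ℝ × E)) (g : ℝ × E → E →L[ℝ] E →L[ℝ] ℝ)
    (U : ℝ × E → E) (u : ℝ × E → ℝ) : Prop where
  analytic_g : AnalyticOnNhd ℝ g S
  analytic_U : AnalyticOnNhd ℝ U S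
  analytic_u : AnalyticOnNhd ℝ u S
  symm : ∀ p ∈ S, ∀ v w, g p v w = g p w v
  pos : ∀ p ∈ S, ∀ v, v ≠ 0 → 0 < g p v v
  sq_u : ∀ p ∈ S, u p ^ 2 = g p (U p) (U p)
  u_ne : ∀ p ∈ S, u p ≠ 0
  parallel : ∀ p ∈ S, ParallelAt lam g U u p

lemma fderiv_symm {E' : Type*} [NormedAddCommGroup E'] [NormedSpace ℝ E']
    {g : E' → E →L[ℝ] E →L[ℝ] ℝ} {p : E'}
    (hg : DifferentiableAt ℝ g p) (hs : ∀ᶠ q in 𝓝 p, ∀ v w, g q v w = g q w v) (a : E')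
    (v w : E) : fderiv ℝ g p a v w = fderiv ℝ g p a w v := by
  rw [← fderiv_bilin_apply hg, ← fderiv_bilin_apply hg]
  congr 1
  exact Filter.EventuallyEq.fderiv_eq (by filter_upwards [hs] with q hq using hq v w)

lemma hasFDerivAt_lower {g : ℝ × E → E →L[ℝ] E →L[ℝ] ℝ} {U : ℝ × E → E} {p : ℝ × E}
    (hg : DifferentiableAt ℝ g p) (hU : DifferentiableAt ℝ U p) :
    HasFDerivAt (fun q => g q (U q)) ((g p).comp (fderiv ℝ U p) + (fderiv ℝ g p).flip (U p)) p :=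
  hg.hasFDerivAt.clm_apply hU.hasFDerivAt

lemma fderiv_lower {g : ℝ × E → E →L[ℝ] E →L[ℝ] ℝ} {U : ℝ × E → E} {p : ℝ × E}
    (hg : DifferentiableAt ℝ g p) (hU : DifferentiableAt ℝ U p) (a : ℝ × E) (y : E) :
    fderiv ℝ (fun q => g q (U q)) p a y = g p (fderiv ℝ U p a) y + fderiv ℝ g p a (U p) y := by
  rw [(hasFDerivAt_lower hg hU).fderiv]
  rfl

lemma fderiv_norm_sq {g : ℝ × E → E →L[ℝ] E →L[ℝ] ℝ} {U : ℝ × E → E} {p : ℝ × E}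
    (hg : DifferentiableAt ℝ g p) (hU : DifferentiableAt ℝ U p) (a : ℝ × E)
    (hs : ∀ v w, g p v w = g p w v) :
    fderiv ℝ (fun q => g q (U q) (U q)) p a =
      2 * g p (fderiv ℝ U p a) (U p) + fderiv ℝ g p a (U p) (U p) := by
  rw [((hasFDerivAt_lower hg hU).clm_apply hU.hasFDerivAt).fderiv]
  simp only [add_apply, ContinuousLinearMap.comp_apply, ContinuousLinearMap.flip_apply]
  rw [hs (U p)]
  ring

/-- The equations for a parallel null field imply the first order system for
`(g(U, ·), u, g)`. -/
lemma ParallelFamily.system {lam : ℝ × E → ℝ} {S : Set (ℝ × E)} {g : ℝ × E → E →L[ℝ] E →L[ℝ] ℝ}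
    {U : ℝ × E → E} {u : ℝ × E → ℝ} (h : ParallelFamily lam S g U u) (hS : IsOpen S)
    {p : ℝ × E} (hp : p ∈ S) :
    dt (fun q => ((g q (U q), u q, g q) : Unknowns E)) p =
        sysCoeff lam (p, (g p (U p), u p, g p))
          (dx (fun q => ((g q (U q), u q, g q) : Unknowns E)) p) +
        sysInhom lam (p, (g p (U p), u p, g p)) := by
  have hg := (h.analytic_g p hp).differentiableAt
  have hU := (h.analytic_U p hp).differentiableAt
  have hu := (h.analytic_u p hp).differentiableAt
  have hn := nondeg_of_pos (h.pos p hp)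
  have hs := fderiv_symm hg (by filter_upwards [hS.mem_nhds hp] with q hq using h.symm q hq)
  refine (system_iff (hasFDerivAt_lower hg hU).differentiableAt hu hg).2 ?_
  simp only [hn.inverse_apply]
  obtain ⟨h1, h2, h3, h4⟩ := h.parallel p hp
  have hu0 := h.u_ne p hp
  simp only [dt, dx_apply, fderiv_lower hg hU] at h1 h2 h3 h4 ⊢
  refine ⟨fun y => ?_, h1, fun x y => ?_⟩
  -- `β̇ = g(U̇, ·) + ġ(U, ·) = u dλ + ½ ġ(U, ·) = u dλ + λ du`.
  · rw [h2 y, hs (1, 0) (U p) y, h3]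
    ring
  -- The equation for `ġ` in the system is the mean of the last parallel equation over the two
  -- orders of `x` and `y`.
  · have e1 := h4 x y
    have e2 := h4 y x
    rw [hs (1, 0) y x] at e2
    rw [hs (0, x) y, hs (0, y) x]
    rw [hs (0, y) x] at e1
    rw [hs (0, x) y, hs (0, U p) y x] at e2
    field_simp
    linarith

/-- Uniqueness along the `t`-fibres. -/
theorem ParallelFamily.eq_of_initial {lam : ℝ × E → ℝ} {S : Set (ℝ × E)}
    {g g' : ℝ × E → E →L[ℝ] E →L[ℝ] ℝ} {U U' : ℝ × E → E} {u u' : ℝ × E → ℝ}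
    (h : ParallelFamily lam S g U u) (h' : ParallelFamily lam S g' U' u') (hS : IsOpen S)
    (hlam : AnalyticOnNhd ℝ lam S) {s : Set E} (hs : IsOpen s) (hs0 : ∀ y ∈ s, ((0 : ℝ), y) ∈ S)
    (hi : ∀ y ∈ s, g (0, y) = g' (0, y) ∧ U (0, y) = U' (0, y) ∧ u (0, y) = u' (0, y))
    {y : E} (hy : y ∈ s) {T : Set ℝ} (hT : IsPreconnected T) (h0 : (0 : ℝ) ∈ T)
    (hTS : ∀ t ∈ T, (t, y) ∈ S) {t : ℝ} (ht : t ∈ T) :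
    g (t, y) = g' (t, y) ∧ U (t, y) = U' (t, y) ∧ u (t, y) = u' (t, y) := by
  have := FiniteDimensional.complete ℝ E
  have han : ∀ {g : ℝ × E → E →L[ℝ] E →L[ℝ] ℝ} {U : ℝ × E → E} {u : ℝ × E → ℝ},
      ParallelFamily lam S g U u →
      AnalyticOnNhd ℝ (fun q => ((g q (U q), u q, g q) : Unknowns E)) S := fun {g U u} h p hp =>
    ((h.analytic_g p hp).clm_app (h.analytic_U p hp)).prod
      ((h.analytic_u p hp).prod (h.analytic_g p hp))
  have hA : ∀ {g : ℝ × E → E →L[ℝ] E →L[ℝ] ℝ} {U : ℝ × E → E} {u : ℝ × E → ℝ},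
      ParallelFamily lam S g U u → ∀ p ∈ S,
      AnalyticAt ℝ (sysCoeff lam) (p, ((g p (U p), u p, g p) : Unknowns E)) :=
    fun {g U u} h p hp =>
    analyticAt_sysCoeff (q := (p, (g p (U p), u p, g p))) (hlam p hp) (h.u_ne p hp)
      (nondeg_of_pos (h.pos p hp))
  have hb : ∀ {g : ℝ × E → E →L[ℝ] E →L[ℝ] ℝ} {U : ℝ × E → E} {u : ℝ × E → ℝ},
      ParallelFamily lam S g U u → ∀ p ∈ S,
      AnalyticAt ℝ (sysInhom lam) (p, ((g p (U p), u p, g p) : Unknowns E)) :=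
    fun {g U u} h p hp =>
    analyticAt_sysInhom (q := (p, (g p (U p), u p, g p))) (hlam p hp)
      (nondeg_of_pos (h.pos p hp))
  have hjet := timeJetEq_of_solution hS hs0 hs (han h) (han h') (hA h) (hA h') (hb h) (hb h')
    (fun p hp => h.system hS hp) (fun p hp => h'.system hS hp)
    (fun y hy => by obtain ⟨e1, e2, e3⟩ := hi y hy; simp only [e1, e2, e3])
  have he := eqOn_of_timeJetEq hy hT h0 (fun t ht => han h _ (hTS t ht))
    (fun t ht => han h' _ (hTS t ht)) hjet t ht
  simp only [Prod.mk.injEq] at he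
  obtain ⟨e1, e2, e3⟩ := he
  -- The system determines `β` and `g`; the field `U` is recovered by nondegeneracy.
  refine ⟨e3, (nondeg_of_pos (h.pos _ (hTS t ht))).eq_of_forall fun w => ?_, e2⟩
  rw [e1, e3]

end LocalGeom

end

/-! ### From the first order system back to the parallel equations: propagation of the constraints
-/

noncomputable section

namespace LocalGeom

open CauchyKovalevskaya Filter

universe u

variable {E : Type u} [NormedAddCommGroup E] [NormedSpace ℝ E] [FiniteDimensional ℝ E]

section

variable {G : Type*} [NormedAddCommGroup G] [NormedSpace ℝ G] [CompleteSpace G]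

lemma dx_dx_comm {f : ℝ × E → G} {p : ℝ × E} (hf : AnalyticAt ℝ f p) (v w : E) :
    dx (dx f) p v w = dx (dx f) p w v := by
  have h : ∀ v w : E, dx (dx f) p v w = fderiv ℝ (fun q => fderiv ℝ f q (0, w)) p (0, v) := by
    intro v w
    rw [dx_apply]
    have h1 : (fun q => fderiv ℝ f q (0, w)) = fun q => dx f q w := rfl
    rw [h1, fderiv_clm_apply (analyticAt_dx hf).differentiableAt (differentiableAt_const _)]
    simp
  rw [h, h, fderiv_fderiv_comm hf]

lemma dt_congr {f f' : ℝ × E → G} {p : ℝ × E} (h : f =ᶠ[𝓝 p] f') : dt f p = dt f' p := by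
  rw [dt, dt, h.fderiv_eq]

lemma dx_congr {f f' : ℝ × E → G} {p : ℝ × E} (h : f =ᶠ[𝓝 p] f') : dx f p = dx f' p := by
  rw [dx, dx, h.fderiv_eq]

end

/-- A solution of the first order system for `(g(U, ·), u, g)` with symmetric `dβ` and `g` and
vanishing `u² - g(U, U)` satisfies the equations for a parallel field. -/
lemma parallelAt_of_system {lam : ℝ × E → ℝ} {g : ℝ × E → E →L[ℝ] E →L[ℝ] ℝ}
    {U : ℝ × E → E} {u : ℝ × E → ℝ} {p : ℝ × E} (hg : DifferentiableAt ℝ g p)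
    (hU : DifferentiableAt ℝ U p) (hu : DifferentiableAt ℝ u p) (hu0 : u p ≠ 0)
    (hs : ∀ᶠ q in 𝓝 p, ∀ v w, g q v w = g q w v)
    (hN : ∀ᶠ q in 𝓝 p, u q ^ 2 = g q (U q) (U q))
    (hc : ∀ x y, dx (fun q => g q (U q)) p x y = dx (fun q => g q (U q)) p y x)
    (h1 : ∀ y, dt (fun q => g q (U q)) p y = lam p * dx u p y + u p * dx lam p y)
    (h2 : dt u p = dx lam p (U p))
    (h3 : ∀ x y, dt g p x y = lam p * (u p)⁻¹ * (dx (fun q => g q (U q)) p x y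
        + dx (fun q => g q (U q)) p y x - (dx g p x y (U p) + dx g p y x (U p)
          - dx g p (U p) x y))) :
    ParallelAt lam g U u p := by
  have hsd := fderiv_symm hg hs
  have hNd : ∀ a, 2 * u p * fderiv ℝ u p a =
      2 * g p (fderiv ℝ U p a) (U p) + fderiv ℝ g p a (U p) (U p) := fun a => by
    rw [← fderiv_norm_sq hg hU a hs.self_of_nhds]
    have h4 : (fun q => u q ^ 2) =ᶠ[𝓝 p] fun q => g q (U q) (U q) := hN
    rw [← h4.fderiv_eq, (hu.hasFDerivAt.pow 2).fderiv]
    simp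
  simp only [dt, dx_apply, fderiv_lower hg hU] at h1 h2 h3 hc
  -- Closedness of `β` turns the symmetrized derivative into twice the derivative itself.
  have h4 : ∀ x y, u p * dt g p x y = lam p * (2 * g p (dx U p x) y + dx g p x (U p) y
      + dx g p (U p) x y - dx g p y x (U p)) := fun x y => by
    simp only [dt, dx_apply]
    rw [h3 x y, ← hc x y, hsd (0, x) y]
    field_simp
    ring
  -- For `y = U` the right side of `h4` is `λ` times the derivative of `g(U, U) = u²`; one factor
  -- `u` cancels.
  have h5 : ∀ x, dt g p x (U p) = 2 * lam p * dx u p x := fun x => by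
    have e1 := h4 x (U p)
    have e2 := hNd (0, x)
    simp only [dt, dx_apply] at e1 ⊢
    refine mul_left_cancel₀ hu0 ?_
    rw [e1]
    linear_combination -lam p * e2
  refine ⟨h2, fun y => ?_, h5, h4⟩
  -- The equation of `U̇` is `β̇ = λ du + u dλ` minus `ġ(U, ·)`, where `λ du = ½ ġ(U, ·)`.
  have e1 := h5 y
  simp only [dt, dx_apply] at e1 ⊢
  rw [hsd (1, 0) y] at e1
  linear_combination h1 y - 1 / 2 * e1

/-- Local existence of families with a parallel null field. -/
theorem exists_parallelFamily {lam : ℝ × E → ℝ} {y₀ : E} {g₀ : E → E →L[ℝ] E →L[ℝ] ℝ}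
    {U₀ : E → E} {u₀ : E → ℝ} (hlam : AnalyticAt ℝ lam (0, y₀))
    (hg₀ : AnalyticAt ℝ g₀ y₀) (hU₀ : AnalyticAt ℝ U₀ y₀) (hu₀ : AnalyticAt ℝ u₀ y₀)
    (hu₀' : u₀ y₀ ≠ 0) (hsymm : ∀ᶠ y in 𝓝 y₀, ∀ v w, g₀ y v w = g₀ y w v)
    (hpos : ∀ v, v ≠ 0 → 0 < g₀ y₀ v v)
    (hsq : ∀ᶠ y in 𝓝 y₀, u₀ y ^ 2 = g₀ y (U₀ y) (U₀ y))
    (hclosed : ∀ᶠ y in 𝓝 y₀, ∀ v w, fderiv ℝ (fun y => g₀ y (U₀ y)) y v w =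
      fderiv ℝ (fun y => g₀ y (U₀ y)) y w v) :
    ∃ r > 0, ∃ (g : ℝ × E → E →L[ℝ] E →L[ℝ] ℝ) (U : ℝ × E → E) (u : ℝ × E → ℝ),
      ParallelFamily lam (Metric.ball (0, y₀) r) g U u ∧
      ∀ y ∈ Metric.ball y₀ r, g (0, y) = g₀ y ∧ U (0, y) = U₀ y ∧ u (0, y) = u₀ y := by
  have := FiniteDimensional.complete ℝ E
  obtain ⟨w, hw, hwi, hwe⟩ := exists_solution (sysCoeff lam) (sysInhom lam) y₀
    (fun y => ((g₀ y (U₀ y), u₀ y, g₀ y) : Unknowns E))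
    ((hg₀.clm_app hU₀).prod (hu₀.prod hg₀))
    (analyticAt_sysCoeff (q := ((0, y₀), (g₀ y₀ (U₀ y₀), u₀ y₀, g₀ y₀))) hlam hu₀'
      (nondeg_of_pos hpos))
    (analyticAt_sysInhom (q := ((0, y₀), (g₀ y₀ (U₀ y₀), u₀ y₀, g₀ y₀))) hlam
      (nondeg_of_pos hpos))
  have hw0 : w (0, y₀) = (g₀ y₀ (U₀ y₀), u₀ y₀, g₀ y₀) := hwi.self_of_nhds
  have e1 : ∀ᶠ p in 𝓝 ((0 : ℝ), y₀), (w p).2.1 ≠ 0 :=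
    (continuous_fst.comp continuous_snd).continuousAt.comp hw.continuousAt |>.eventually_ne
      (by simpa [hw0] using hu₀')
  have e2 : ∀ᶠ p in 𝓝 ((0 : ℝ), y₀), ∀ v, v ≠ 0 → 0 < (w p).2.2 v v := by
    have hc : ContinuousAt (fun p => (w p).2.2) ((0 : ℝ), y₀) :=
      (continuous_snd.comp continuous_snd).continuousAt.comp hw.continuousAt
    exact hc.eventually (eventually_pos (by simpa [hw0] using hpos))
  -- The conditions on the initial data are pulled back along the projection to space, so that one
  -- ball in spacetime serves for them and for the solution.
  have e3 : ∀ᶠ p in 𝓝 ((0 : ℝ), y₀), w (0, p.2) = (g₀ p.2 (U₀ p.2), u₀ p.2, g₀ p.2) ∧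
      AnalyticAt ℝ g₀ p.2 ∧ AnalyticAt ℝ U₀ p.2 ∧
      (∀ v w, g₀ p.2 v w = g₀ p.2 w v) ∧ u₀ p.2 ^ 2 = g₀ p.2 (U₀ p.2) (U₀ p.2) ∧
      ∀ v w, fderiv ℝ (fun y => g₀ y (U₀ y)) p.2 v w =
        fderiv ℝ (fun y => g₀ y (U₀ y)) p.2 w v :=
    (continuous_snd.tendsto ((0 : ℝ), y₀)).eventually (hwi.and (hg₀.eventually_analyticAt.and
      (hU₀.eventually_analyticAt.and (hsymm.and (hsq.and hclosed)))))
  obtain ⟨r, hr, hball⟩ := Metric.eventually_nhds_iff_ball.1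
    (e1.and (e2.and (e3.and (hwe.and
      (hw.eventually_analyticAt.and hlam.eventually_analyticAt)))))
  set S := Metric.ball ((0 : ℝ), y₀) r with hSdef
  have hS : IsOpen S := Metric.isOpen_ball
  have hmem : ∀ y ∈ Metric.ball y₀ r, ((0 : ℝ), y) ∈ S := fun y hy => by
    rw [hSdef, ← ball_prod_same]
    exact ⟨Metric.mem_ball_self hr, hy⟩
  set β : ℝ × E → E →L[ℝ] ℝ := fun p => (w p).1 with hβdef
  set u : ℝ × E → ℝ := fun p => (w p).2.1 with hudef
  set g : ℝ × E → E →L[ℝ] E →L[ℝ] ℝ := fun p => (w p).2.2 with hgdef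
  set U : ℝ × E → E := fun p => (g p).inverse (β p) with hUdef
  have hu0 : ∀ p ∈ S, u p ≠ 0 := fun p hp => (hball p hp).1
  have hgpos : ∀ p ∈ S, ∀ v, v ≠ 0 → 0 < g p v v := fun p hp => (hball p hp).2.1
  have hnd : ∀ p ∈ S, Nondeg (g p) := fun p hp => nondeg_of_pos (hgpos p hp)
  have hwa : AnalyticOnNhd ℝ w S := fun p hp => (hball p hp).2.2.2.2.1
  have hlama : AnalyticOnNhd ℝ lam S := fun p hp => (hball p hp).2.2.2.2.2
  have hβa : AnalyticOnNhd ℝ β S := fun p hp => AnalyticAt.clm_const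
    (ContinuousLinearMap.fst ℝ (E →L[ℝ] ℝ) (ℝ × (E →L[ℝ] E →L[ℝ] ℝ))) (hwa p hp)
  have hua : AnalyticOnNhd ℝ u S := fun p hp => AnalyticAt.clm_const
    ((ContinuousLinearMap.fst ℝ ℝ (E →L[ℝ] E →L[ℝ] ℝ)).comp
      (ContinuousLinearMap.snd ℝ (E →L[ℝ] ℝ) (ℝ × (E →L[ℝ] E →L[ℝ] ℝ)))) (hwa p hp)
  have hga : AnalyticOnNhd ℝ g S := fun p hp => AnalyticAt.clm_const
    ((ContinuousLinearMap.snd ℝ ℝ (E →L[ℝ] E →L[ℝ] ℝ)).comp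
      (ContinuousLinearMap.snd ℝ (E →L[ℝ] ℝ) (ℝ × (E →L[ℝ] E →L[ℝ] ℝ)))) (hwa p hp)
  have hUa : AnalyticOnNhd ℝ U S := fun p hp =>
    AnalyticAt.comp (g := fun q : (ℝ × E) × Unknowns E => q.2.2.2.inverse q.2.1)
      (f := fun p => (p, w p)) (analyticAt_inverse_apply (q := (p, w p)) (hnd p hp))
      (analyticAt_id.prod (hwa p hp))
  have hβU : ∀ p ∈ S, g p (U p) = β p := fun p hp => (hnd p hp).apply_inverse _
  have hsys : ∀ p ∈ S, (∀ y, dt β p y = lam p * dx u p y + u p * dx lam p y) ∧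
      dt u p = dx lam p (U p) ∧
      ∀ x y, dt g p x y = lam p * (u p)⁻¹ * (dx β p x y + dx β p y x
        - (dx g p x y (U p) + dx g p y x (U p) - dx g p (U p) x y)) := fun p hp =>
    (system_iff (hβa p hp).differentiableAt (hua p hp).differentiableAt
      (hga p hp).differentiableAt).1 (hball p hp).2.2.2.1
  have hinit : ∀ y ∈ Metric.ball y₀ r, g (0, y) = g₀ y ∧ U (0, y) = U₀ y ∧ u (0, y) = u₀ y ∧
      β (0, y) = g₀ y (U₀ y) := fun y hy => by
    have h0 : w (0, y) = _ := (hball _ (hmem y hy)).2.2.1.1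
    have h1 : g (0, y) = g₀ y := by simp [hgdef, h0]
    have h2 : β (0, y) = g₀ y (U₀ y) := by simp [hβdef, h0]
    refine ⟨h1, ?_, by simp [hudef, h0], h2⟩
    rw [hUdef]
    simp only
    rw [h2, h1, Nondeg.inverse_apply]
    rw [← h1]
    exact hnd _ (hmem y hy)
  -- Since `β̇ = d(λu)` is exact, the antisymmetric part of the derivative of `β` does not depend on
  -- time: this is the transport equation with zero velocity.
  have hclosedS : ∀ p ∈ S, ∀ x y, dx β p x y = dx β p y x := by
    have hfa : AnalyticOnNhd ℝ (fun q => dx β q - transp E (dx β q)) S := fun p hp =>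
      (analyticAt_dx (hβa p hp)).fun_sub (AnalyticAt.clm_const _ (analyticAt_dx (hβa p hp)))
    have h0 := transport_eq_zero (c := fun _ => 0) hfa (fun p _ => analyticAt_const)
      (fun p hp => ?_) (fun y hy => ?_)
    · intro p hp x y
      have h1 := congr($(h0 p hp) x y)
      exact sub_eq_zero.1 h1
    · have hβp := hβa p hp
      have hda := (analyticAt_dx hβp).differentiableAt
      have h1 : dt (fun q => dx β q - transp E (dx β q)) p =
          dt (dx β) p - transp E (dt (dx β) p) := by
        have h : HasFDerivAt (fun q => dx β q - transp E (dx β q)) _ p :=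
          hda.hasFDerivAt.sub ((transp E).hasFDerivAt.comp p hda.hasFDerivAt)
        unfold dt
        rw [h.fderiv]
        rfl
      have h2 : dt β =ᶠ[𝓝 p] dx (fun q => lam q * u q) := by
        filter_upwards [hS.mem_nhds hp] with q hq
        ext y
        rw [(hsys q hq).1 y, dx_apply (fun q => lam q * u q), ((hlama q hq).differentiableAt.hasFDerivAt.fun_mul
          (hua q hq).differentiableAt.hasFDerivAt).fderiv]
        rfl
      rw [h1, dt_dx hβp, dx_congr h2, map_zero]
      ext x y
      exact sub_eq_zero.2 (dx_dx_comm ((hlama p hp).fun_mul (hua p hp)) x y)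
    · ext x z
      obtain ⟨-, hg1, hU1, -, -, hc⟩ := (hball _ (hmem y hy)).2.2.1
      have h1 : dx β (0, y) = fderiv ℝ (fun y => g₀ y (U₀ y)) y := by
        have h2 : HasFDerivAt (fun z : E => ((0 : ℝ), z)) (ContinuousLinearMap.inr ℝ ℝ E) y :=
          (ContinuousLinearMap.inr ℝ ℝ E).hasFDerivAt
        have h3 := (hβa _ (hmem y hy)).differentiableAt.hasFDerivAt.comp y h2
        have h4 : (fun y => g₀ y (U₀ y)) =ᶠ[𝓝 y] β ∘ fun z : E => ((0 : ℝ), z) := by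
          filter_upwards [Metric.isOpen_ball.mem_nhds hy] with z hz
          exact (hinit z hz).2.2.2.symm
        rw [h4.fderiv_eq, h3.fderiv]
        rfl
      show dx β (0, y) x z - dx β (0, y) z x = 0
      rw [h1, sub_eq_zero]
      exact hc x z
  -- In the equation for `ġ` all terms are symmetric in `x`, `y` except the derivative of `g` along
  -- `U`. Hence `g - gᵀ` is transported with velocity `(λ/u) U`.
  have hsymmS : ∀ p ∈ S, ∀ x y, g p x y = g p y x := by
    have hfa : AnalyticOnNhd ℝ (fun q => g q - transp E (g q)) S := fun p hp =>
      (hga p hp).fun_sub (AnalyticAt.clm_const _ (hga p hp))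
    have h0 := transport_eq_zero (c := fun q => (lam q * (u q)⁻¹) • U q) hfa
      (fun p hp => ((hlama p hp).fun_mul ((hua p hp).fun_inv (hu0 p hp))).fun_smul (hUa p hp))
      (fun p hp => ?_) (fun y hy => ?_)
    · intro p hp x y
      have h1 := congr($(h0 p hp) x y)
      exact sub_eq_zero.1 h1
    · have hda := (hga p hp).differentiableAt
      have h1 : ∀ a x y, fderiv ℝ (fun q => g q - transp E (g q)) p a x y =
          fderiv ℝ g p a x y - fderiv ℝ g p a y x := fun a x y => by
        have h : HasFDerivAt (fun q => g q - transp E (g q)) _ p :=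
          hda.hasFDerivAt.sub ((transp E).hasFDerivAt.comp p hda.hasFDerivAt)
        rw [h.fderiv]
        rfl
      ext x y
      have e1 := (hsys p hp).2.2 x y
      have e2 := (hsys p hp).2.2 y x
      have h2 : ∀ a x y, dx (fun q => g q - transp E (g q)) p a x y =
          dx g p a x y - dx g p a y x := fun a x y => by rw [dx_apply, h1]; rfl
      have h3 : dt (fun q => g q - transp E (g q)) p x y = dt g p x y - dt g p y x := h1 _ x y
      rw [map_smul, smul_apply, smul_apply, h2, h3, e1, e2, smul_eq_mul]
      ring
    · rw [(hinit y hy).1]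
      ext x z
      exact sub_eq_zero.2 ((hball _ (hmem y hy)).2.2.1.2.2.2.1 x z)
  -- Contracting the equations for `β̇` and `ġ` with `U` gives `∂_t N = -(λ/u) dN(U)` for `N = u² -
  -- g(U, U)`.
  have hNS : ∀ p ∈ S, u p ^ 2 = g p (U p) (U p) := by
    have hNa : AnalyticOnNhd ℝ (fun q => u q ^ 2 - g q (U q) (U q)) S := fun p hp =>
      ((hua p hp).fun_pow 2).fun_sub (((hga p hp).clm_app (hUa p hp)).clm_app (hUa p hp))
    -- The zero in the second component only puts the values into the universe of `E`, which
    -- `transport_eq_zero` requires.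
    have h0 := transport_eq_zero (f := fun q => ((u q ^ 2 - g q (U q) (U q), 0) : ℝ × E))
      (c := fun q => -((lam q * (u q)⁻¹) • U q)) (fun p hp => (hNa p hp).prod analyticAt_const)
      (fun p hp => (((hlama p hp).fun_mul ((hua p hp).fun_inv (hu0 p hp))).fun_smul
        (hUa p hp)).fun_neg)
      (fun p hp => ?_) (fun y hy => ?_)
    · intro p hp
      exact sub_eq_zero.1 (congrArg Prod.fst (h0 p hp))
    · have hda := (hga p hp).differentiableAt
      have hdU := (hUa p hp).differentiableAt
      have hdu := (hua p hp).differentiableAt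
      -- The derivative of `g(U, U)` is written as `2 (Dβ)(U) - (Dg)(U, U)`, because the system
      -- gives equations for `β` and `g` but none for `U`. This uses the symmetry of `g` established
      -- above.
      have h1 : ∀ a, fderiv ℝ (fun q => ((u q ^ 2 - g q (U q) (U q), 0) : ℝ × E)) p a =
          (2 * u p * fderiv ℝ u p a - (2 * fderiv ℝ β p a (U p) - fderiv ℝ g p a (U p) (U p)),
            0) := fun a => by
        have h2 := ((hdu.hasFDerivAt.pow 2).fun_sub
          ((hasFDerivAt_lower hda hdU).clm_apply hdU.hasFDerivAt).differentiableAt.hasFDerivAt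
          ).prodMk (hasFDerivAt_const (0 : E) p)
        rw [h2.fderiv, ContinuousLinearMap.prod_apply]
        refine Prod.ext ?_ rfl
        have h3 : fderiv ℝ β p a (U p) =
            g p (fderiv ℝ U p a) (U p) + fderiv ℝ g p a (U p) (U p) := by
          have h4 : β =ᶠ[𝓝 p] fun q => g q (U q) := by
            filter_upwards [hS.mem_nhds hp] with q hq using (hβU q hq).symm
          rw [h4.fderiv_eq, fderiv_lower hda hdU]
        have h5 := fderiv_norm_sq hda hdU a (hsymmS p hp)
        rw [h3]
        simp only [sub_apply, h5]
        simp
        ring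
      obtain ⟨s1, s2, s3⟩ := hsys p hp
      have e1 := s1 (U p)
      have e3 := s3 (U p) (U p)
      rw [dx_apply, h1, dt, h1]
      refine Prod.ext ?_ rfl
      simp only [dt, dx_apply] at e1 e3 s2 ⊢
      have hsm : ((0 : ℝ), -((lam p * (u p)⁻¹) • U p)) = -(lam p * (u p)⁻¹) • ((0 : ℝ), U p) := by
        ext <;> simp
      rw [hsm, map_smul, map_smul, map_smul, smul_apply, smul_apply, smul_apply, e1, e3, s2]
      simp only [smul_eq_mul]
      have := hu0 p hp
      field_simp
      ring
    · obtain ⟨i1, i2, i3, -⟩ := hinit y hy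
      rw [i1, i2, i3]
      exact Prod.ext (sub_eq_zero.2 (hball _ (hmem y hy)).2.2.1.2.2.2.2.1) rfl
  refine ⟨r, hr, g, U, u, ⟨hga, hUa, hua, hsymmS, hgpos, hNS, hu0, fun p hp => ?_⟩,
    fun y hy => ⟨(hinit y hy).1, (hinit y hy).2.1, (hinit y hy).2.2.1⟩⟩
  have h4 : (fun q => g q (U q)) =ᶠ[𝓝 p] β := by
    filter_upwards [hS.mem_nhds hp] with q hq using hβU q hq
  obtain ⟨s1, s2, s3⟩ := hsys p hp
  refine parallelAt_of_system (hga p hp).differentiableAt (hUa p hp).differentiableAt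
    (hua p hp).differentiableAt (hu0 p hp) ?_ ?_ ?_ ?_ s2 ?_
  · filter_upwards [hS.mem_nhds hp] with q hq using hsymmS q hq
  · filter_upwards [hS.mem_nhds hp] with q hq using hNS q hq
  · rw [dx_congr h4]
    exact hclosedS p hp
  · rw [dt_congr h4]
    exact s1
  · rw [dx_congr h4]
    exact s3

end LocalGeom

end

/-! ### Geometry at fixed time and the Codazzi identity -/

noncomputable section

namespace LocalGeom

open CauchyKovalevskaya Filter

section

variable {E K : Type*} [NormedAddCommGroup E] [NormedSpace ℝ E] [NormedAddCommGroup K]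
  [NormedSpace ℝ K]

lemma analyticAt_clm_comp {Z G : Type*} [NormedAddCommGroup Z] [NormedSpace ℝ Z]
    [NormedAddCommGroup G] [NormedSpace ℝ G] {A : Z → K →L[ℝ] G} {B : Z → E →L[ℝ] K} {z : Z}
    (hA : AnalyticAt ℝ A z) (hB : AnalyticAt ℝ B z) : AnalyticAt ℝ (fun z => (A z).comp (B z)) z :=
  ((ContinuousLinearMap.compL ℝ E K G).analyticAt_bilinear _).comp₂ hA hB

lemma analyticAt_symmetrized {Z : Type*} [NormedAddCommGroup Z] [NormedSpace ℝ Z]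
    (τ : (E →L[ℝ] K) →L[ℝ] (E →L[ℝ] K)) {D : Z → E →L[ℝ] E →L[ℝ] K} {z : Z}
    (hD : AnalyticAt ℝ D z) :
    AnalyticAt ℝ (fun z => (1 / 2 : ℝ) • (D z + (D z).flip - τ.comp (D z).flip)) z := by
  have h1 : AnalyticAt ℝ (fun z => (D z).flip) z := AnalyticAt.clm_const
    ((ContinuousLinearMap.flipₗᵢ ℝ E E K).toContinuousLinearEquiv.toContinuousLinearMap) hD
  exact analyticAt_const.fun_smul ((hD.fun_add h1).fun_sub
    (AnalyticAt.clm_const (ContinuousLinearMap.compL ℝ E (E →L[ℝ] K) (E →L[ℝ] K) τ) h1))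

end

universe u

variable {E : Type u} [NormedAddCommGroup E] [NormedSpace ℝ E] [FiniteDimensional ℝ E]

lemma analyticAt_firstKind {Z : Type*} [NormedAddCommGroup Z] [NormedSpace ℝ Z]
    {D : Z → E →L[ℝ] E →L[ℝ] E →L[ℝ] ℝ} {z : Z} (hD : AnalyticAt ℝ D z) :
    AnalyticAt ℝ (fun z => firstKind (D z)) z :=
  analyticAt_symmetrized _ hD

lemma analyticAt_secondKind {Z : Type*} [NormedAddCommGroup Z] [NormedSpace ℝ Z]
    {B : Z → E →L[ℝ] E →L[ℝ] ℝ} {D : Z → E →L[ℝ] E →L[ℝ] E →L[ℝ] ℝ} {z : Z}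
    (hB : AnalyticAt ℝ B z) (hn : Nondeg (B z)) (hD : AnalyticAt ℝ D z) :
    AnalyticAt ℝ (fun z => secondKind (B z) (D z)) z := by
  have := FiniteDimensional.complete ℝ E
  have h3 : AnalyticAt ℝ (ContinuousLinearMap.inverse : (E →L[ℝ] E →L[ℝ] ℝ) → _) (B z) :=
    (hn.isInvertible.contDiffAt_map_inverse (n := ω)).analyticAt
  have h4 : AnalyticAt ℝ (fun z => (B z).inverse) z := AnalyticAt.comp (f := B) h3 hB
  exact analyticAt_clm_comp (AnalyticAt.clm_const (ContinuousLinearMap.compL ℝ E (E →L[ℝ] ℝ) E) h4)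
    (analyticAt_firstKind hD)

lemma analyticAt_inverse_clm {Z : Type*} [NormedAddCommGroup Z] [NormedSpace ℝ Z]
    {B : Z → E →L[ℝ] E →L[ℝ] ℝ} {β : Z → E →L[ℝ] ℝ} {z : Z}
    (hB : AnalyticAt ℝ B z) (hn : Nondeg (B z)) (hβ : AnalyticAt ℝ β z) :
    AnalyticAt ℝ (fun z => (B z).inverse (β z)) z := by
  have := FiniteDimensional.complete ℝ E
  have h3 : AnalyticAt ℝ (ContinuousLinearMap.inverse : (E →L[ℝ] E →L[ℝ] ℝ) → _) (B z) :=
    (hn.isInvertible.contDiffAt_map_inverse (n := ω)).analyticAt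
  have h4 : AnalyticAt ℝ (fun z => (B z).inverse) z := AnalyticAt.comp (f := B) h3 hB
  exact h4.clm_app hβ

lemma fderiv_bilin {B : ℝ × E → E →L[ℝ] E →L[ℝ] ℝ} {X : ℝ × E → E} {p : ℝ × E}
    (hB : DifferentiableAt ℝ B p) (hX : DifferentiableAt ℝ X p) (a : ℝ × E) (y : E) :
    fderiv ℝ (fun q => B q (X q) y) p a = fderiv ℝ B p a (X p) y + B p (fderiv ℝ X p a) y := by
  rw [((hasFDerivAt_lower hB hX).clm_apply (hasFDerivAt_const y p)).fderiv]
  simp [add_comm]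

lemma fderiv_clm_const {G H : Type*} [NormedAddCommGroup G] [NormedSpace ℝ G]
    [NormedAddCommGroup H] [NormedSpace ℝ H] {B : ℝ × E → G →L[ℝ] H} {p : ℝ × E}
    (hB : DifferentiableAt ℝ B p) (a : ℝ × E) (y : G) :
    fderiv ℝ (fun q => B q y) p a = fderiv ℝ B p a y := by
  rw [(hB.hasFDerivAt.clm_apply (hasFDerivAt_const y p)).fderiv]
  simp

lemma fderiv_clm_apply' {G H : Type*} [NormedAddCommGroup G] [NormedSpace ℝ G]
    [NormedAddCommGroup H] [NormedSpace ℝ H] {B : ℝ × E → G →L[ℝ] H} {X : ℝ × E → G} {p : ℝ × E}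
    (hB : DifferentiableAt ℝ B p) (hX : DifferentiableAt ℝ X p) (a : ℝ × E) :
    fderiv ℝ (fun q => B q (X q)) p a = fderiv ℝ B p a (X p) + B p (fderiv ℝ X p a) := by
  rw [(hB.hasFDerivAt.clm_apply hX.hasFDerivAt).fderiv]
  simp [add_comm]

lemma fderiv_mul_apply {f f' : ℝ × E → ℝ} {p : ℝ × E} (hf : DifferentiableAt ℝ f p)
    (hf' : DifferentiableAt ℝ f' p) (a : ℝ × E) :
    fderiv ℝ (fun q => f q * f' q) p a = fderiv ℝ f p a * f' p + f p * fderiv ℝ f' p a := by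
  rw [(hf.hasFDerivAt.fun_mul hf'.hasFDerivAt).fderiv]
  simp
  ring

/-- Christoffel symbols at fixed time. -/
def Gam (g : ℝ × E → E →L[ℝ] E →L[ℝ] ℝ) (q : ℝ × E) : E →L[ℝ] E →L[ℝ] E :=
  secondKind (g q) (dx g q)

/-- The field `ġ / λ`. -/
def hform (lam : ℝ × E → ℝ) (g : ℝ × E → E →L[ℝ] E →L[ℝ] ℝ) (q : ℝ × E) :
    E →L[ℝ] E →L[ℝ] ℝ :=
  (lam q)⁻¹ • dt g q

/-- Covariant derivative of bilinear forms at fixed time. -/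
def covh (g h : ℝ × E → E →L[ℝ] E →L[ℝ] ℝ) (q : ℝ × E) (v a b : E) : ℝ :=
  dx h q v a b - h q (Gam g q v a) b - h q a (Gam g q v b)

/-- Hessian at fixed time. -/
def hessx (g : ℝ × E → E →L[ℝ] E →L[ℝ] ℝ) (f : ℝ × E → ℝ) (q : ℝ × E) (v w : E) : ℝ :=
  dx (dx f) q v w - dx f q (Gam g q v w)

/-- Curvature at fixed time. -/
def curvx (g : ℝ × E → E →L[ℝ] E →L[ℝ] ℝ) (q : ℝ × E) (v w a : E) : E :=
  dx (Gam g) q v w a + Gam g q v (Gam g q w a) - (dx (Gam g) q w v a + Gam g q w (Gam g q v a))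

namespace ParallelFamily

variable {lam : ℝ × E → ℝ} {S : Set (ℝ × E)} {g : ℝ × E → E →L[ℝ] E →L[ℝ] ℝ}
    {U : ℝ × E → E} {u : ℝ × E → ℝ} (h : ParallelFamily lam S g U u) (hS : IsOpen S)
    (hlam : AnalyticOnNhd ℝ lam S) (hlam0 : ∀ p ∈ S, lam p ≠ 0) {p : ℝ × E} (hp : p ∈ S)

section

include h hp

lemma nondeg : Nondeg (g p) := nondeg_of_pos (h.pos p hp)

lemma analyticAt_Gam : AnalyticAt ℝ (Gam g) p :=
  analyticAt_secondKind (h.analytic_g p hp) (h.nondeg hp) (analyticAt_dx (h.analytic_g p hp))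

lemma apply_Gam (v w z : E) :
    g p (Gam g p v w) z = 1 / 2 * (dx g p v w z + dx g p w v z - dx g p z v w) :=
  (h.nondeg hp).apply_secondKind _ v w z

include hS

lemma fderiv_g_symm (a : ℝ × E) (v w : E) : fderiv ℝ g p a v w = fderiv ℝ g p a w v :=
  fderiv_symm (h.analytic_g p hp).differentiableAt
    (by filter_upwards [hS.mem_nhds hp] with q hq using h.symm q hq) a v w

lemma Gam_symm (v w : E) : Gam g p v w = Gam g p w v := by
  refine (h.nondeg hp).eq_of_forall fun z => ?_
  rw [h.apply_Gam hp, h.apply_Gam hp, dx_apply g p z, h.fderiv_g_symm hS hp (0, z) v w, ← dx_apply]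
  ring

/-- Metric compatibility, which turns derivatives of `g(∇U, ·)` into covariant ones in `codazzi` and
`dx_dt_U`. -/
lemma compat (v a b : E) : dx g p v a b = g p (Gam g p v a) b + g p a (Gam g p v b) := by
  rw [h.symm p hp a, h.apply_Gam hp, h.apply_Gam hp]
  simp only [dx_apply]
  rw [h.fderiv_g_symm hS hp (0, v) b a, h.fderiv_g_symm hS hp (0, a) v b,
    h.fderiv_g_symm hS hp (0, b) v a]
  ring

lemma hform_symm (v w : E) : hform lam g p v w = hform lam g p w v := by
  simp only [hform, smul_apply, dt, h.fderiv_g_symm hS hp (1, 0) v w]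

end

include h hlam hlam0 hp in
lemma analyticAt_hform : AnalyticAt ℝ (hform lam g) p :=
  ((hlam p hp).fun_inv (hlam0 p hp)).fun_smul (analyticAt_dt (h.analytic_g p hp))

include hlam0 hp in
lemma dt_g_eq : dt g p = lam p • hform lam g p := by
  rw [hform, smul_smul, mul_inv_cancel₀ (hlam0 p hp), one_smul]

include h hlam0 hp in
lemma hform_U (x : E) : hform lam g p x (U p) = 2 * dx u p x := by
  have h1 := (h.parallel p hp).dx_u x
  rw [dt_g_eq hlam0 hp, smul_apply, smul_apply, smul_eq_mul] at h1
  exact mul_left_cancel₀ (hlam0 p hp) (by rw [h1]; ring)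

/-- The covariant differential of `U`. -/
def covU (g : ℝ × E → E →L[ℝ] E →L[ℝ] ℝ) (U : ℝ × E → E) (q : ℝ × E) : E →L[ℝ] E :=
  dx U q + (Gam g q).flip (U q)

include h hlam0 hp in
-- The last parallel equation in invariant form, `u h = 2 g(∇U, ·)` with `h = ġ/λ`. Its space
-- derivative gives `codazzi` and its time derivative gives `dt_hform`.
lemma apply_covU (x y : E) : u p * hform lam g p x y = 2 * g p (covU g U p x) y := by
  have h1 := (h.parallel p hp).dx_U x y
  rw [dt_g_eq hlam0 hp, smul_apply, smul_apply, smul_eq_mul] at h1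
  refine mul_left_cancel₀ (hlam0 p hp) ?_
  rw [covU, add_apply, map_add, add_apply, ContinuousLinearMap.flip_apply, h.apply_Gam hp]
  linear_combination h1

include h hp in
lemma analyticAt_covU : AnalyticAt ℝ (covU g U) p := by
  have := FiniteDimensional.complete ℝ E
  have h1 : AnalyticAt ℝ (fun q => (Gam g q).flip) p := AnalyticAt.clm_const
    ((ContinuousLinearMap.flipₗᵢ ℝ E E E).toContinuousLinearEquiv.toContinuousLinearMap)
    (h.analyticAt_Gam hp)
  exact (analyticAt_dx (h.analytic_U p hp)).fun_add (h1.clm_app (h.analytic_U p hp))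

include h hp in
lemma fderiv_covU (a : ℝ × E) (x : E) : fderiv ℝ (covU g U) p a x =
    fderiv ℝ (dx U) p a x + fderiv ℝ (Gam g) p a x (U p) + Gam g p x (fderiv ℝ U p a) := by
  have := FiniteDimensional.complete ℝ E
  have hG := (h.analyticAt_Gam hp).differentiableAt
  have hU := (h.analytic_U p hp).differentiableAt
  have hdU := (analyticAt_dx (h.analytic_U p hp)).differentiableAt
  rw [← fderiv_clm_const (h.analyticAt_covU hp).differentiableAt]
  have h1 : (fun q => covU g U q x) = fun q => dx U q x + Gam g q x (U q) := rfl
  have h2 : DifferentiableAt ℝ (fun q => Gam g q x) p := hG.clm_apply (differentiableAt_const _)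
  have h3 : DifferentiableAt ℝ (fun q => dx U q x) p := hdU.clm_apply (differentiableAt_const _)
  rw [h1, fderiv_fun_add h3 (h2.clm_apply hU), add_apply, fderiv_clm_apply' h2 hU,
    fderiv_clm_const hG, fderiv_clm_const hdU]
  abel

include h hS hlam hlam0 hp in
/-- Derivative of `u h = 2 g(∇U, ·)`. -/
lemma fderiv_apply_covU (a : ℝ × E) (x y : E) :
    fderiv ℝ u p a * hform lam g p x y + u p * fderiv ℝ (hform lam g) p a x y =
      2 * (fderiv ℝ g p a (covU g U p x) y + g p (fderiv ℝ (covU g U) p a x) y) := by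
  have := FiniteDimensional.complete ℝ E
  have hh := (h.analyticAt_hform hlam hlam0 hp).differentiableAt
  have hc := (h.analyticAt_covU hp).differentiableAt
  have hg := (h.analytic_g p hp).differentiableAt
  have h1 : (fun q => u q * hform lam g q x y) =ᶠ[𝓝 p] fun q => 2 * g q (covU g U q x) y := by
    filter_upwards [hS.mem_nhds hp] with q hq using h.apply_covU hlam0 hq x y
  have h2 : DifferentiableAt ℝ (fun q => hform lam g q x y) p :=
    (hh.clm_apply (differentiableAt_const _)).clm_apply (differentiableAt_const _)
  have h3 : DifferentiableAt ℝ (fun q => covU g U q x) p := hc.clm_apply (differentiableAt_const _)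
  have h4 : DifferentiableAt ℝ (fun q => g q (covU g U q x) y) p :=
    (hg.clm_apply h3).clm_apply (differentiableAt_const _)
  have h5 := congr($(h1.fderiv_eq (𝕜 := ℝ)) a)
  have h6 : fderiv ℝ (fun q => 2 * g q (covU g U q x) y) p =
    (2 : ℝ) • fderiv ℝ (fun q => g q (covU g U q x) y) p := fderiv_const_mul h4 2
  rw [fderiv_mul_apply (h.analytic_u p hp).differentiableAt h2, fderiv_bilin_apply hh,
    h6, smul_apply, fderiv_bilin hg h3, fderiv_clm_const hc] at h5
  exact h5

include h hS hlam hlam0 hp in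
/-- The Codazzi type equation relating `d^∇ h` and the curvature. -/
lemma codazzi (X Y : E) :
    u p * (covh g (hform lam g) p (U p) X Y - covh g (hform lam g) p X (U p) Y) =
      -2 * g p (curvx g p X (U p) (U p)) Y - 1 / 2 * (hform lam g p X Y * hform lam g p (U p) (U p)
        - hform lam g p X (U p) * hform lam g p Y (U p)) := by
  -- The identity `u h = 2 g(∇U, ·)` is differentiated along `U` with argument `X` and along `X`
  -- with argument `U`. In the difference the second derivatives of `U` cancel and leave the
  -- curvature; the terms with `du` become quadratic in `h` because `h(·, U) = 2 du`.
  have := FiniteDimensional.complete ℝ E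
  have e1 := h.fderiv_apply_covU hS hlam hlam0 hp (0, U p) X Y
  have e2 := h.fderiv_apply_covU hS hlam hlam0 hp (0, X) (U p) Y
  rw [h.fderiv_covU hp] at e1 e2
  simp only [← dx_apply] at e1 e2
  rw [h.compat hS hp] at e1 e2
  have a1 := h.apply_covU hlam0 hp X (Gam g p (U p) Y)
  have a2 := h.apply_covU hlam0 hp (U p) (Gam g p X Y)
  have c1 : covU g U p X = dx U p X + Gam g p X (U p) := rfl
  have c2 : covU g U p (U p) = dx U p (U p) + Gam g p (U p) (U p) := rfl
  have d1 : g p (Gam g p (U p) (covU g U p X)) Y =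
      g p (Gam g p (U p) (dx U p X)) Y + g p (Gam g p (U p) (Gam g p X (U p))) Y := by
    simp only [c1, map_add, add_apply]
  have d2 : g p (Gam g p X (covU g U p (U p))) Y =
      g p (Gam g p X (dx U p (U p))) Y + g p (Gam g p X (Gam g p (U p) (U p))) Y := by
    simp only [c2, map_add, add_apply]
  have s1 := dx_dx_comm (h.analytic_U p hp) X (U p)
  have u1 := h.hform_U hlam0 hp X
  have u2 := h.hform_U hlam0 hp (U p)
  have y1 := h.hform_symm (lam := lam) hS hp Y (U p)
  rw [s1] at e2
  simp only [covh, curvx, map_add, map_sub, add_apply, sub_apply] at e1 e2 ⊢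
  simp only [h.Gam_symm hS hp X (U p), y1] at e1 e2 d1 d2 ⊢
  linear_combination e1 - e2 + 2 * d1 - 2 * d2 - a1 + a2 + 1 / 2 * hform lam g p X Y * u2
    - 1 / 2 * hform lam g p (U p) Y * u1

end ParallelFamily

end LocalGeom

end

/-! ### The second order evolution equations -/

noncomputable section

namespace LocalGeom

open CauchyKovalevskaya Filter

universe u

variable {E : Type u} [NormedAddCommGroup E] [NormedSpace ℝ E] [FiniteDimensional ℝ E]

namespace ParallelFamily

variable {lam : ℝ × E → ℝ} {S : Set (ℝ × E)} {g : ℝ × E → E →L[ℝ] E →L[ℝ] ℝ}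
    {U : ℝ × E → E} {u : ℝ × E → ℝ} (h : ParallelFamily lam S g U u) (hS : IsOpen S)
    (hlam : AnalyticOnNhd ℝ lam S) (hlam0 : ∀ p ∈ S, lam p ≠ 0) {p : ℝ × E} (hp : p ∈ S)

section

include h hS hlam hlam0 hp

lemma fderiv_dt_g (a : ℝ × E) (x y : E) : fderiv ℝ (dt g) p a x y =
    fderiv ℝ lam p a * hform lam g p x y + lam p * fderiv ℝ (hform lam g) p a x y := by
  have hh := (h.analyticAt_hform hlam hlam0 hp).differentiableAt
  have h1 : dt g =ᶠ[𝓝 p] fun q => lam q • hform lam g q := by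
    filter_upwards [hS.mem_nhds hp] with q hq using dt_g_eq hlam0 hq
  rw [h1.fderiv_eq, ((hlam p hp).differentiableAt.hasFDerivAt.fun_smul hh.hasFDerivAt).fderiv]
  simp [add_comm]

lemma dt_dx_g (x a y : E) : fderiv ℝ (fun q => dx g q x a y) p (1, 0) =
    dx lam p x * hform lam g p a y + lam p * dx (hform lam g) p x a y := by
  have h1 := (analyticAt_dx (h.analytic_g p hp)).differentiableAt
  have h2 : DifferentiableAt ℝ (fun q => dx g q x) p := h1.clm_apply (differentiableAt_const _)
  rw [fderiv_bilin_apply h2, fderiv_clm_const h1, ← dt, dt_dx (h.analytic_g p hp), dx_apply,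
    h.fderiv_dt_g hS hlam hlam0 hp]
  rfl

/-- Variation of the Christoffel symbols. -/
lemma dt_Gam (x a y : E) : g p (fderiv ℝ (Gam g) p (1, 0) x a) y =
    1 / 2 * (dx lam p x * hform lam g p a y + dx lam p a * hform lam g p x y
      - dx lam p y * hform lam g p x a) + 1 / 2 * lam p * (covh g (hform lam g) p x a y
      + covh g (hform lam g) p a x y - covh g (hform lam g) p y x a) := by
  have := FiniteDimensional.complete ℝ E
  have hG := (h.analyticAt_Gam hp).differentiableAt
  have hg := (h.analytic_g p hp).differentiableAt
  have hdg := (analyticAt_dx (h.analytic_g p hp)).differentiableAt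
  have hd : ∀ x a y, DifferentiableAt ℝ (fun q => dx g q x a y) p := fun x a y =>
    ((hdg.clm_apply (differentiableAt_const _)).clm_apply
      (differentiableAt_const _)).clm_apply (differentiableAt_const _)
  -- Differentiating the symbols of the first kind avoids the derivative of the inverse metric.
  have h1 : (fun q => g q (Gam g q x a) y) =ᶠ[𝓝 p] fun q =>
      1 / 2 * (dx g q x a y + dx g q a x y - dx g q y x a) := by
    filter_upwards [hS.mem_nhds hp] with q hq using h.apply_Gam hq x a y
  have h2 : DifferentiableAt ℝ (fun q => Gam g q x) p := hG.clm_apply (differentiableAt_const _)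
  have h3 : DifferentiableAt ℝ (fun q => Gam g q x a) p := h2.clm_apply (differentiableAt_const _)
  have h4 : HasFDerivAt (fun q => 1 / 2 * (dx g q x a y + dx g q a x y - dx g q y x a)) _ p :=
    (((hd x a y).hasFDerivAt.add (hd a x y).hasFDerivAt).sub (hd y x a).hasFDerivAt).const_mul
      (1 / 2 : ℝ)
  have h5 := congr($(h1.fderiv_eq (𝕜 := ℝ)) ((1 : ℝ), (0 : E)))
  rw [fderiv_bilin hg h3, fderiv_clm_const h2, fderiv_clm_const hG, h4.fderiv, smul_apply,
    sub_apply, add_apply, h.dt_dx_g hS hlam hlam0 hp, h.dt_dx_g hS hlam hlam0 hp,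
    h.dt_dx_g hS hlam hlam0 hp, ← dt, dt_g_eq hlam0 hp] at h5
  simp only [smul_apply, smul_eq_mul] at h5
  simp only [covh, h.Gam_symm hS hp a x, h.Gam_symm hS hp y x, h.Gam_symm hS hp y a]
  have s3 := h.hform_symm (lam := lam) hS hp a (Gam g p x y)
  linear_combination h5 + 1 / 2 * lam p * s3

/-- Spatial derivative of the evolution equation of `U`. -/
lemma dx_dt_U (x y : E) : g p (dx (dt U) p x + Gam g p x (dt U p)) y =
    dx u p x * dx lam p y - dx lam p x * dx u p y + u p * hessx g lam p x y
      - 1 / 2 * lam p * (covh g (hform lam g) p x (U p) y + hform lam g p (covU g U p x) y) := by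
  have := FiniteDimensional.complete ℝ E
  have hg := (h.analytic_g p hp).differentiableAt
  have hU := (h.analytic_U p hp).differentiableAt
  have hu := (h.analytic_u p hp).differentiableAt
  have hl := (hlam p hp).differentiableAt
  have hh := (h.analyticAt_hform hlam hlam0 hp).differentiableAt
  have hdU := (analyticAt_dt (h.analytic_U p hp)).differentiableAt
  have hdl := (analyticAt_dx (hlam p hp)).differentiableAt
  have h1 : (fun q => g q (dt U q) y) =ᶠ[𝓝 p] fun q =>
      u q * dx lam q y - 1 / 2 * (lam q * hform lam g q (U q) y) := by
    filter_upwards [hS.mem_nhds hp] with q hq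
    rw [(h.parallel q hq).dt_U y, dt_g_eq hlam0 hq]
    rfl
  have h2 : DifferentiableAt ℝ (fun q => dx lam q y) p := hdl.clm_apply (differentiableAt_const _)
  have h3 : DifferentiableAt ℝ (fun q => hform lam g q (U q) y) p :=
    (hh.clm_apply hU).clm_apply (differentiableAt_const _)
  have h4 := congr($(h1.fderiv_eq (𝕜 := ℝ)) ((0 : ℝ), x))
  have h5 : HasFDerivAt (fun q => u q * dx lam q y - 1 / 2 * (lam q * hform lam g q (U q) y)) _ p :=
    (hu.fun_mul h2).hasFDerivAt.fun_sub ((hl.fun_mul h3).hasFDerivAt.const_mul (1 / 2 : ℝ))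
  rw [fderiv_bilin hg hdU, h5.fderiv, sub_apply, smul_apply, fderiv_mul_apply hu h2,
    fderiv_mul_apply hl h3, fderiv_bilin hh hU, fderiv_clm_const hdl, smul_eq_mul] at h4
  simp only [← dx_apply] at h4
  rw [h.compat hS hp, (h.parallel p hp).dt_U, dt_g_eq hlam0 hp] at h4
  simp only [smul_apply, smul_eq_mul] at h4
  have s1 := h.hform_symm (lam := lam) hS hp (U p) y
  rw [h.hform_U hlam0 hp] at s1
  simp only [covh, hessx, covU, map_add, add_apply, ContinuousLinearMap.flip_apply]
  linear_combination h4 - 1 / 2 * dx lam p x * s1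

/-- First form of the evolution equation for `h`. -/
lemma dt_hform (x y : E) : u p * dt (hform lam g) p x y =
    lam p * hform lam g p (covU g U p x) y + 2 * u p * hessx g lam p x y
      + lam p * (covh g (hform lam g) p (U p) y x - covh g (hform lam g) p y (U p) x) := by
  have := FiniteDimensional.complete ℝ E
  -- The time derivative of `∇U` is `∇U̇ + Γ̇(·, U)`. The first term is known from the equation for
  -- `U̇` and brings in the Hessian of `λ`, the second from the variation of the Christoffel
  -- symbols.
  have e1 := h.fderiv_apply_covU hS hlam hlam0 hp (1, 0) x y
  rw [h.fderiv_covU hp, ← dt, ← dt, ← dt, ← dt, ← dt, ← dt] at e1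
  rw [dt_dx (h.analytic_U p hp), (h.parallel p hp).dt_u, dt_g_eq (g := g) hlam0 hp] at e1
  have e2 := h.dx_dt_U hS hlam hlam0 hp x y
  have e3 := h.dt_Gam hS hlam hlam0 hp x (U p) y
  rw [← dt] at e3
  simp only [map_add, add_apply, smul_apply, smul_eq_mul] at e1 e2
  have s1 := h.hform_symm (lam := lam) hS hp (U p) y
  have hd : ∀ a x y, dx (hform lam g) p a x y = dx (hform lam g) p a y x := fun a x y =>
    fderiv_symm (h.analyticAt_hform hlam hlam0 hp).differentiableAt
      (by filter_upwards [hS.mem_nhds hp] with q hq using h.hform_symm hS hq) (0, a) x y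
  have s2 : ∀ v a b, covh g (hform lam g) p v a b = covh g (hform lam g) p v b a :=
    fun v a b => by
      rw [covh, covh, hd, h.hform_symm hS hp (Gam g p v a), h.hform_symm hS hp a]
      ring
  rw [h.hform_U hlam0 hp] at s1 e3
  rw [s1] at e3
  rw [s2 (U p) y x, s2 y (U p) x]
  linear_combination e1 + 2 * e2 + 2 * e3

lemma apply_inverse (Y z : E) : g p ((g p).inverse (dt g p Y)) z = dt g p Y z := by
  rw [(h.nondeg hp).apply_inverse]

lemma dt_g_inverse_comm (X Y : E) :
    dt g p X ((g p).inverse (dt g p Y)) = dt g p ((g p).inverse (dt g p X)) Y := by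
  rw [← h.apply_inverse hS hlam hlam0 hp, h.symm p hp, h.apply_inverse hS hlam hlam0 hp]
  exact h.fderiv_g_symm hS hp _ _ _

/-- The equation `u h = 2 g(∇U, ·)` says `∇_x U = (u / 2λ) ġ^♯(x)`; this produces the term quadratic
in `ġ` in the evolution equation. -/
lemma hform_covU (x y : E) : lam p ^ 2 * hform lam g p (covU g U p x) y =
    1 / 2 * u p * dt g p ((g p).inverse (dt g p x)) y := by
  have h1 : covU g U p x = (1 / 2 * (u p * (lam p)⁻¹)) • (g p).inverse (dt g p x) := by
    refine (h.nondeg hp).eq_of_forall fun z => ?_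
    rw [map_smul, smul_apply, h.apply_inverse hS hlam hlam0 hp, smul_eq_mul]
    have := h.apply_covU hlam0 hp x z
    rw [hform, smul_apply, smul_apply, smul_eq_mul] at this
    linear_combination -1 / 2 * this
  have := hlam0 p hp
  rw [h1, hform, map_smul, smul_apply, smul_apply, smul_apply, smul_eq_mul, smul_eq_mul]
  field_simp

/-- Evolution equation of the metric before the use of the Codazzi equation. -/
lemma dt_dt_g (x y : E) : dt (dt g) p x y =
    dt lam p / lam p * dt g p x y + 1 / 2 * dt g p ((g p).inverse (dt g p x)) y
      + 2 * lam p * hessx g lam p x y + lam p ^ 2 / u p *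
        (covh g (hform lam g) p (U p) y x - covh g (hform lam g) p y (U p) x) := by
  have e1 := h.fderiv_dt_g hS hlam hlam0 hp (1, 0) x y
  have e2 := h.dt_hform hS hlam hlam0 hp x y
  have e3 := h.hform_covU hS hlam hlam0 hp x y
  rw [← dt, ← dt, ← dt] at e1
  have h0 := hlam0 p hp
  have hu := h.u_ne p hp
  rw [e1, dt_g_eq (g := g) hlam0 hp]
  rw [dt_g_eq (g := g) hlam0 hp] at e3
  simp only [smul_apply, smul_eq_mul] at e3 ⊢
  field_simp
  linear_combination 2 * lam p * e2 + 2 * e3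

/-- By the Codazzi identity multiplied by `λ²/u²`, the first `d^∇ h` term, the curvature term and
the last quadratic term add up to zero, so they may be added to `dt_dt_g`. They make the right hand
side symmetric in `X` and `Y`. -/
theorem metric_evolution (X Y : E) : dt (dt g) p X Y =
    lam p ^ 2 / u p * ((covh g (hform lam g) p (U p) X Y - covh g (hform lam g) p X (U p) Y)
        + (covh g (hform lam g) p (U p) Y X - covh g (hform lam g) p Y (U p) X))
      + 1 / 2 * dt g p X ((g p).inverse (dt g p Y))
      + dt lam p / lam p * dt g p X Y
      + 2 * lam p * hessx g lam p X Y
      + 2 * (lam p ^ 2 / u p ^ 2) * g p (curvx g p X (U p) (U p)) Y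
      + 1 / (2 * u p ^ 2) * (dt g p X Y * dt g p (U p) (U p)
        - dt g p X (U p) * dt g p Y (U p)) := by
  have hu := h.u_ne p hp
  have e1 := h.codazzi hS hlam hlam0 hp X Y
  rw [h.dt_dt_g hS hlam hlam0 hp, h.dt_g_inverse_comm hS hlam hlam0 hp]
  have e2 : lam p ^ 2 * (hform lam g p X Y * hform lam g p (U p) (U p)
        - hform lam g p X (U p) * hform lam g p Y (U p)) = dt g p X Y * dt g p (U p) (U p)
        - dt g p X (U p) * dt g p Y (U p) := by
    rw [dt_g_eq (g := g) hlam0 hp]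
    simp only [smul_apply, smul_eq_mul]
    ring
  rw [← e2]
  field_simp
  linear_combination -2 * lam p ^ 2 * e1

/-- The time derivative of the identity `g(grad λ, ·) = dλ`. -/
lemma dt_dx_lam (y : E) : dt (dx lam) p y = dt g p ((g p).inverse (dx lam p)) y
    + g p (dt (fun q => (g q).inverse (dx lam q)) p) y := by
  have := FiniteDimensional.complete ℝ E
  have hg := (h.analytic_g p hp).differentiableAt
  have hdl := (analyticAt_dx (hlam p hp)).differentiableAt
  have hG := (analyticAt_inverse_clm (h.analytic_g p hp) (h.nondeg hp)
    (analyticAt_dx (hlam p hp))).differentiableAt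
  have h1 : (fun q => g q ((g q).inverse (dx lam q)) y) =ᶠ[𝓝 p] fun q => dx lam q y := by
    filter_upwards [hS.mem_nhds hp] with q hq
    rw [(h.nondeg hq).apply_inverse]
  have h4 := congr($(h1.fderiv_eq (𝕜 := ℝ)) ((1 : ℝ), (0 : E)))
  rw [fderiv_bilin hg hG, fderiv_clm_const hdl] at h4
  exact h4.symm

/-- The time derivative of `g(U̇, X) = u dλ(X) - ½ ġ(U, X)`, with `dt_dt_g` inserted for `g̈(U, X)`.
The term `½ ġ(ġ^♯ U, X)` is eliminated through `U̇ = u grad λ - ½ ġ^♯ U`, and the last coefficient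
`2 u̇ - dλ(U)` is just `u̇`, since `u̇ = dλ(U)`. -/
theorem vector_evolution (X : E) : g p (dt (dt U) p) X =
    - (lam p ^ 2 / (2 * u p)) *
        (covh g (hform lam g) p (U p) X (U p) - covh g (hform lam g) p X (U p) (U p))
      - 1 / 2 * (dt lam p / lam p) * dt g p (U p) X
      - lam p * hessx g lam p (U p) X
      - dt g p (dt U p) X
      + u p * g p (dt (fun q => (g q).inverse (dx lam q)) p) X
      + u p / 2 * dt g p ((g p).inverse (dx lam p)) X
      + (2 * dt u p - dx lam p (U p)) * dx lam p X := by
  have := FiniteDimensional.complete ℝ E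
  have hg := (h.analytic_g p hp).differentiableAt
  have hU := (h.analytic_U p hp).differentiableAt
  have hu := (h.analytic_u p hp).differentiableAt
  have hdg := (analyticAt_dt (h.analytic_g p hp)).differentiableAt
  have hdU := (analyticAt_dt (h.analytic_U p hp)).differentiableAt
  have hdl := (analyticAt_dx (hlam p hp)).differentiableAt
  have h1 : (fun q => g q (dt U q) X) =ᶠ[𝓝 p] fun q =>
      u q * dx lam q X - 1 / 2 * dt g q (U q) X := by
    filter_upwards [hS.mem_nhds hp] with q hq
    exact (h.parallel q hq).dt_U X
  have h2 : DifferentiableAt ℝ (fun q => dx lam q X) p := hdl.clm_apply (differentiableAt_const _)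
  have h3 : DifferentiableAt ℝ (fun q => dt g q (U q) X) p :=
    (hdg.clm_apply hU).clm_apply (differentiableAt_const _)
  have h4 := congr($(h1.fderiv_eq (𝕜 := ℝ)) ((1 : ℝ), (0 : E)))
  have h5 : HasFDerivAt (fun q => u q * dx lam q X - 1 / 2 * dt g q (U q) X) _ p :=
    (hu.fun_mul h2).hasFDerivAt.fun_sub (h3.hasFDerivAt.const_mul (1 / 2 : ℝ))
  rw [fderiv_bilin hg hdU, h5.fderiv, sub_apply, smul_apply, fderiv_mul_apply hu h2,
    fderiv_bilin hdg hU, fderiv_clm_const hdl, smul_eq_mul] at h4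
  have h4' : dt g p (dt U p) X + g p (dt (dt U) p) X = dt u p * dx lam p X
      + u p * dt (dx lam) p X - 1 / 2 * (dt (dt g) p (U p) X + dt g p (dt U p) X) := h4
  rw [h.dt_dx_lam hS hlam hlam0 hp, h.dt_dt_g hS hlam hlam0 hp] at h4'
  have h6 : dt U p = u p • (g p).inverse (dx lam p) - (1 / 2 : ℝ) • (g p).inverse (dt g p (U p)) := by
    refine (h.nondeg hp).eq_of_forall fun z => ?_
    rw [(h.parallel p hp).dt_U, map_sub, map_smul, map_smul, (h.nondeg hp).apply_inverse,
      (h.nondeg hp).apply_inverse]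
    rfl
  have h7 : dt g p (dt U p) X = u p * dt g p ((g p).inverse (dx lam p)) X
      - 1 / 2 * dt g p ((g p).inverse (dt g p (U p))) X := by
    conv_lhs => rw [h6]
    simp only [map_sub, map_smul, sub_apply, smul_apply, smul_eq_mul]
  have h8 := (h.parallel p hp).dt_u
  have h9 : lam p ^ 2 / (2 * u p) = 1 / 2 * (lam p ^ 2 / u p) := by ring
  rw [h9]
  linear_combination h4' - 1 / 2 * h7 - dx lam p X * h8

/-- The time derivative of `u̇ = dλ(U)`. The coefficients `2` and `3/2` arise by adding the equation
`dλ(U̇) = u |grad λ|² - ½ ġ(grad λ, U)`, written as an expression that vanishes. -/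
theorem scalar_evolution : dt (dt u) p =
    g p (dt (fun q => (g q).inverse (dx lam q)) p) (U p)
      + 2 * dx lam p (dt U p) + 3 / 2 * dt g p ((g p).inverse (dx lam p)) (U p)
      - u p * g p ((g p).inverse (dx lam p)) ((g p).inverse (dx lam p)) := by
  have hU := (h.analytic_U p hp).differentiableAt
  have hdl := (analyticAt_dx (hlam p hp)).differentiableAt
  have h1 : dt u =ᶠ[𝓝 p] fun q => dx lam q (U q) := by
    filter_upwards [hS.mem_nhds hp] with q hq using (h.parallel q hq).dt_u
  have h2 : dt (dt u) p = dt (dx lam) p (U p) + dx lam p (dt U p) := by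
    rw [dt_congr h1]
    exact fderiv_clm_apply' hdl hU (1, 0)
  have h3 : dx lam p (dt U p) = u p * dx lam p ((g p).inverse (dx lam p))
      - 1 / 2 * dt g p ((g p).inverse (dx lam p)) (U p) := by
    have e1 := (h.parallel p hp).dt_U ((g p).inverse (dx lam p))
    rw [h.symm p hp, (h.nondeg hp).apply_inverse] at e1
    rw [e1]
    simp only [dt, h.fderiv_g_symm hS hp (1, 0) (U p)]
  rw [h2, h.dt_dx_lam hS hlam hlam0 hp, (h.nondeg hp).apply_inverse]
  linear_combination -h3

end

end ParallelFamily

end LocalGeom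

end

/-! ### Change of charts and naturality of the connection on manifolds -/

noncomputable section

namespace Geom

open Filter

section Charts

variable {E : Type*} [NormedAddCommGroup E] [NormedSpace ℝ E]
  {H : Type*} [TopologicalSpace H] {I : ModelWithCorners ℝ E H} [I.Boundaryless]
  {M : Type*} [TopologicalSpace M] [ChartedSpace H M] [IsManifold I ω M]

/-- The isomorphism from the model space to the tangent space at `z` given by the chart
around `x₀`. -/
def fromChart (I : ModelWithCorners ℝ E H) [IsManifold I ω M] (x₀ z : M) : E →L[ℝ] E :=
  (trivializationAt E (TangentSpace I) x₀).symmL ℝ z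

/-- The isomorphism from the tangent space at `z` to the model space given by the chart
around `x₀`. -/
def toChart (I : ModelWithCorners ℝ E H) [IsManifold I ω M] (x₀ z : M) : E →L[ℝ] E :=
  (trivializationAt E (TangentSpace I) x₀).continuousLinearMapAt ℝ z

lemma fromChart_toChart {x₀ z : M} (hz : z ∈ (chartAt H x₀).source) (v : E) :
    fromChart I x₀ z (toChart I x₀ z v) = v :=
  (trivializationAt E (TangentSpace I) x₀).symmL_continuousLinearMapAt (R := ℝ) hz v

lemma toChart_fromChart {x₀ z : M} (hz : z ∈ (chartAt H x₀).source) (v : E) :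
    toChart I x₀ z (fromChart I x₀ z v) = v :=
  (trivializationAt E (TangentSpace I) x₀).continuousLinearMapAt_symmL (R := ℝ) hz v

lemma toChart_eq {x₀ z : M} (hz : z ∈ (chartAt H x₀).source) :
    toChart I x₀ z = tangentCoordChange I z x₀ z :=
  TangentBundle.continuousLinearMapAt_trivializationAt_eq_core hz

lemma fromChart_eq {x₀ z : M} (hz : z ∈ (chartAt H x₀).source) :
    fromChart I x₀ z = tangentCoordChange I x₀ z z :=
  TangentBundle.symmL_trivializationAt_eq_core hz

lemma fromChart_self (x : M) : fromChart I x x = ContinuousLinearMap.id ℝ E := by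
  ext v
  rw [fromChart_eq (mem_chart_source H x)]
  exact tangentCoordChange_self (mem_extChartAt_source x)

lemma toChart_self (x : M) : toChart I x x = ContinuousLinearMap.id ℝ E := by
  ext v
  rw [toChart_eq (mem_chart_source H x)]
  exact tangentCoordChange_self (mem_extChartAt_source x)

lemma extChartAt_symm_apply {x₀ z : M} (hz : z ∈ (chartAt H x₀).source) :
    (extChartAt I x₀).symm (extChartAt I x₀ z) = z :=
  (extChartAt I x₀).left_inv (by rwa [extChartAt_source])

/-- The change of coordinates between the charts around `x` and `x₀`. -/
def chartChange (I : ModelWithCorners ℝ E H) (x x₀ : M) : E → E :=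
  extChartAt I x₀ ∘ (extChartAt I x).symm

lemma analyticAt_chartChange [CompleteSpace E] {x x₀ z : M} (hx : z ∈ (chartAt H x).source)
    (hx₀ : z ∈ (chartAt H x₀).source) : AnalyticAt ℝ (chartChange I x x₀) (extChartAt I x z) := by
  have h' : extChartAt I x z ∈ ((extChartAt I x).symm ≫ (extChartAt I x₀)).source := by
    rw [PartialEquiv.trans_source'', PartialEquiv.symm_symm, PartialEquiv.symm_target]
    exact Set.mem_image_of_mem _ ⟨by rwa [extChartAt_source], by rwa [extChartAt_source]⟩
  have h1 := contDiffWithinAt_ext_coord_change (n := ω) (I := I) x₀ x h'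
  rw [I.range_eq_univ, contDiffWithinAt_univ] at h1
  exact h1.analyticAt

/-- Connects the bundle trivializations in the definitions with actual derivatives of coordinate
changes, as needed for `koszul_pullback`. -/
lemma fderiv_chartChange {x x₀ z : M} (hx : z ∈ (chartAt H x).source)
    (hx₀ : z ∈ (chartAt H x₀).source) (v : E) :
    fderiv ℝ (chartChange I x x₀) (extChartAt I x z) v =
      toChart I x₀ z (fromChart I x z v) := by
  rw [toChart_eq hx₀, fromChart_eq hx, tangentCoordChange_comp, tangentCoordChange_def,
    I.range_eq_univ, fderivWithin_univ]
  · rfl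
  · simp only [extChartAt_source]
    exact ⟨⟨hx, mem_chart_source H z⟩, hx₀⟩

/-- The value of a field of bilinear forms, as a form on the model space. -/
def formVal (g : BilinField I M) (z : M) : E →L[ℝ] E →L[ℝ] ℝ := g z

/-- The value of a vector field, as a vector of the model space. -/
def vecVal (X : VecField I M) (z : M) : E := X z

/-- Reading of a field of bilinear forms in the chart around `x₀`. -/
def readForm (x₀ : M) (g : BilinField I M) (y : E) : E →L[ℝ] E →L[ℝ] ℝ :=
  ContinuousLinearMap.bilinearComp (formVal g ((extChartAt I x₀).symm y))
    (fromChart I x₀ ((extChartAt I x₀).symm y)) (fromChart I x₀ ((extChartAt I x₀).symm y))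

lemma vecInChart_eq (x₀ : M) (X : VecField I M) (y : E) :
    vecInChart x₀ X y = toChart I x₀ ((extChartAt I x₀).symm y) (vecVal X ((extChartAt I x₀).symm y)) :=
  rfl

lemma eventually_chartChange {x x₀ : M} {z : M} (hx : z ∈ (chartAt H x).source)
    (hx₀ : z ∈ (chartAt H x₀).source) : ∀ᶠ y in 𝓝 (extChartAt I x z),
      ∃ z' ∈ (chartAt H x).source, z' ∈ (chartAt H x₀).source ∧ extChartAt I x z' = y := by
  have hx' : z ∈ (extChartAt I x).source := by rwa [extChartAt_source]
  have h1 : ∀ᶠ y in 𝓝 (extChartAt I x z), y ∈ (extChartAt I x).target :=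
    extChartAt_target_mem_nhds' ((extChartAt I x).map_source hx')
  have h2 : ∀ᶠ y in 𝓝 (extChartAt I x z), (extChartAt I x).symm y ∈ (chartAt H x₀).source := by
    refine (continuousAt_extChartAt_symm' hx').eventually ?_
    rw [(extChartAt I x).left_inv hx']
    exact (chartAt H x₀).open_source.mem_nhds hx₀
  filter_upwards [h1, h2] with y hy1 hy2
  exact ⟨_, by rw [← extChartAt_source I]; exact (extChartAt I x).map_target hy1, hy2,
    (extChartAt I x).right_inv hy1⟩

lemma readForm_chartChange {x x₀ z : M} (hx : z ∈ (chartAt H x).source)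
    (hx₀ : z ∈ (chartAt H x₀).source) (g : BilinField I M) (v w : E) :
    readForm x g (extChartAt I x z) v w = readForm x₀ g (chartChange I x x₀ (extChartAt I x z))
      (fderiv ℝ (chartChange I x x₀) (extChartAt I x z) v)
      (fderiv ℝ (chartChange I x x₀) (extChartAt I x z) w) := by
  have e1 : (extChartAt I x).symm (extChartAt I x z) = z := extChartAt_symm_apply hx
  have e2 : (extChartAt I x₀).symm (chartChange I x x₀ (extChartAt I x z)) = z := by
    rw [chartChange, Function.comp_apply, e1]
    exact extChartAt_symm_apply hx₀
  rw [fderiv_chartChange hx hx₀, fderiv_chartChange hx hx₀]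
  simp only [readForm, ContinuousLinearMap.bilinearComp_apply]
  rw [e1, e2, fromChart_toChart hx₀, fromChart_toChart hx₀]

lemma vecInChart_chartChange {x x₀ z : M} (hx : z ∈ (chartAt H x).source)
    (hx₀ : z ∈ (chartAt H x₀).source) (X : VecField I M) :
    vecInChart x₀ X (chartChange I x x₀ (extChartAt I x z)) =
      fderiv ℝ (chartChange I x x₀) (extChartAt I x z) (vecInChart x X (extChartAt I x z)) := by
  have e1 : (extChartAt I x).symm (extChartAt I x z) = z := extChartAt_symm_apply hx
  have e2 : (extChartAt I x₀).symm (chartChange I x x₀ (extChartAt I x z)) = z := by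
    rw [chartChange, Function.comp_apply, e1]
    exact extChartAt_symm_apply hx₀
  rw [fderiv_chartChange hx hx₀, vecInChart_eq, vecInChart_eq, e1, e2, fromChart_toChart hx]

/-- Naturality of the Levi-Civita connection. -/
lemma koszul_chartChange [FiniteDimensional ℝ E] {x₀ x : M} (hx₀ : x ∈ (chartAt H x₀).source)
    {g : BilinField I M} {X : VecField I M}
    (hg : DifferentiableAt ℝ (readForm x₀ g) (extChartAt I x₀ x))
    (hX : DifferentiableAt ℝ (vecInChart x₀ X) (extChartAt I x₀ x))
    (hX' : DifferentiableAt ℝ (vecInChart x X) (extChartAt I x x))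
    (hsymm : ∀ v w, g x v w = g x w v) (v w : E) :
    LocalGeom.koszul (readForm x g) (vecInChart x X) (extChartAt I x x) v w =
      LocalGeom.koszul (readForm x₀ g) (vecInChart x₀ X) (extChartAt I x₀ x)
        (toChart I x₀ x v) (toChart I x₀ x w) := by
  have := FiniteDimensional.complete ℝ E
  have hx := mem_chart_source H x
  have e1 : (extChartAt I x).symm (extChartAt I x x) = x := extChartAt_symm_apply hx
  have e2 : chartChange I x x₀ (extChartAt I x x) = extChartAt I x₀ x := by
    rw [chartChange, Function.comp_apply, e1]
  have h1 := LocalGeom.koszul_pullback (B := readForm x₀ g) (B' := readForm x g)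
    (X := vecInChart x₀ X) (X' := vecInChart x X) (analyticAt_chartChange hx hx₀)
    (by rwa [e2]) (by rwa [e2]) hX' (fun v w => ?_) ?_ ?_ v w
  · rw [h1, fderiv_chartChange hx hx₀, fderiv_chartChange hx hx₀, e2, fromChart_self]
    rfl
  · rw [e2]
    simp only [readForm, ContinuousLinearMap.bilinearComp_apply]
    rw [extChartAt_symm_apply hx₀]
    exact hsymm _ _
  · filter_upwards [eventually_chartChange hx hx₀] with y hy v w
    obtain ⟨z, hz, hz₀, rfl⟩ := hy
    exact readForm_chartChange hz hz₀ g v w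
  · filter_upwards [eventually_chartChange hx hx₀] with y hy
    obtain ⟨z, hz, hz₀, rfl⟩ := hy
    exact vecInChart_chartChange hz hz₀ X

end Charts

end Geom

end

/-! ### Analyticity of sections read in charts -/

noncomputable section

namespace Geom

open Filter

section Regularity

variable {E : Type*} [NormedAddCommGroup E] [NormedSpace ℝ E]
  {H : Type*} [TopologicalSpace H] {I : ModelWithCorners ℝ E H} [I.Boundaryless]
  {M : Type*} [TopologicalSpace M] [ChartedSpace H M] [IsManifold I ω M]
  {E' : Type*} [NormedAddCommGroup E'] [NormedSpace ℝ E']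
  {H' : Type*} [TopologicalSpace H'] {I' : ModelWithCorners ℝ E' H'} [I'.Boundaryless]
  {N : Type*} [TopologicalSpace N] [ChartedSpace H' N] [IsManifold I' ω N]

lemma contMDiffAt_iff_analyticAt {F : Type*} [NormedAddCommGroup F] [NormedSpace ℝ F]
    [CompleteSpace F] {f : M → F} {x₀ x : M} (hx : x ∈ (chartAt H x₀).source) :
    ContMDiffAt I 𝓘(ℝ, F) ω f x ↔
      AnalyticAt ℝ (fun y => f ((extChartAt I x₀).symm y)) (extChartAt I x₀ x) := by
  rw [contMDiffAt_iff_source_of_mem_source hx, I.range_eq_univ, contMDiffWithinAt_univ,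
    contMDiffAt_iff_contDiffAt]
  exact ⟨fun h => h.analyticAt, fun h => h.contDiffAt⟩

/-- The base map `b` is the projection of `ℝ × M` to `M` for time-dependent fields and the identity
for fields on a manifold. Any chart whose domain contains the base point may be used. -/
lemma contMDiffAt_vec_iff {b : N → M} {X : (n : N) → TangentSpace I (b n)} {n : N} {x₀ : M}
    (hx : b n ∈ (chartAt H x₀).source) (hb : ContMDiffAt I' I ω b n) :
    ContMDiffAt I' I.tangent ω (fun n => (⟨b n, X n⟩ : TangentBundle I M)) n ↔
      ContMDiffAt I' 𝓘(ℝ, E) ω (fun n => toChart I x₀ (b n) (X n)) n := by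
  have h1 := (trivializationAt E (TangentSpace I) x₀).contMDiffAt_iff (IM := I') (IB := I) (n := ω)
    (f := fun n => (⟨b n, X n⟩ : TangentBundle I M)) (x₀ := n) (by
      rw [TangentBundle.trivializationAt_source]; exact hx)
  refine h1.trans ((and_iff_right hb).trans ?_)
  refine Filter.EventuallyEq.contMDiffAt_iff ?_
  filter_upwards [hb.continuousAt.eventually ((chartAt H x₀).open_source.mem_nhds hx)] with m hm
  exact ((trivializationAt E (TangentSpace I) x₀).continuousLinearMapAt_apply_of_mem (R := ℝ) hm
    _).symm

/-- A bilinear form on a tangent space, as a form on the model space. -/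
def asForm {x : M} (L : TangentSpace I x →L[ℝ] TangentSpace I x →L[ℝ] ℝ) : E →L[ℝ] E →L[ℝ] ℝ := L

lemma contMDiffAt_form_iff {b : N → M}
    {L : (n : N) → TangentSpace I (b n) →L[ℝ] TangentSpace I (b n) →L[ℝ] ℝ} {n : N} {x₀ : M}
    (hx : b n ∈ (chartAt H x₀).source) (hb : ContMDiffAt I' I ω b n) :
    ContMDiffAt I' (I.prod 𝓘(ℝ, E →L[ℝ] E →L[ℝ] ℝ)) ω
      (fun n => TotalSpace.mk' (E →L[ℝ] E →L[ℝ] ℝ)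
        (E := fun x : M => TangentSpace I x →L[ℝ] TangentSpace I x →L[ℝ] ℝ) (b n) (L n)) n ↔
      ContMDiffAt I' 𝓘(ℝ, E →L[ℝ] E →L[ℝ] ℝ) ω (fun n => ContinuousLinearMap.bilinearComp
        (asForm (L n)) (fromChart I x₀ (b n)) (fromChart I x₀ (b n))) n := by
  have h1 := (trivializationAt (E →L[ℝ] E →L[ℝ] ℝ)
    (fun x : M => TangentSpace I x →L[ℝ] TangentSpace I x →L[ℝ] ℝ) x₀).contMDiffAt_iff (IM := I')
    (IB := I) (n := ω)
    (f := fun n => TotalSpace.mk' (E →L[ℝ] E →L[ℝ] ℝ)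
        (E := fun x : M => TangentSpace I x →L[ℝ] TangentSpace I x →L[ℝ] ℝ) (b n) (L n))
    (x₀ := n) (by
      rw [Trivialization.mem_source, hom_trivializationAt_baseSet, hom_trivializationAt_baseSet]
      exact ⟨hx, hx, Set.mem_univ _⟩)
  refine h1.trans ((and_iff_right hb).trans ?_)
  refine Filter.EventuallyEq.contMDiffAt_iff ?_
  filter_upwards [hb.continuousAt.eventually ((chartAt H x₀).open_source.mem_nhds hx)] with m hm
  rw [hom_trivializationAt_apply]
  ext v w
  refine (inCoordinates_apply_eq₂ (F₁ := E) (F₂ := E) (E₁ := fun x : M => TangentSpace I x)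
    (E₂ := fun x : M => TangentSpace I x) (E₃ := Bundle.Trivial M ℝ) (F₃ := ℝ) (x₀ := x₀)
    (x := b m) (ϕ := L m) hm hm (Set.mem_univ _)).trans ?_
  have h2 : ∀ v, fromChart I x₀ (b m) v = (trivializationAt E (TangentSpace I) x₀).symm (b m) v :=
    (trivializationAt E (TangentSpace I) x₀).symmL_apply (R := ℝ) hm
  rw [ContinuousLinearMap.bilinearComp_apply, h2, h2]
  simp
  rfl

end Regularity

end Geom

end

/-! ### Product charts on `ℝ × M` -/

noncomputable section

namespace Geom

open Filter CauchyKovalevskaya LocalGeom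

section Spacetime

universe u

variable {E : Type u} [NormedAddCommGroup E] [NormedSpace ℝ E] [FiniteDimensional ℝ E]
  {M : Type*} [TopologicalSpace M] [ChartedSpace E M]

lemma mem_chart_source_spaceTime {q₀ q : ℝ × M} :
    q ∈ (chartAt (ModelProd ℝ E) q₀).source ↔ q.2 ∈ (chartAt E q₀.2).source :=
  ⟨fun h => h.2, fun h => ⟨Set.mem_univ _, h⟩⟩

variable [IsManifold 𝓘(ℝ, E) ω M]

/-- Relative to the chart centred at `q` the trivialization is the derivative of the coordinate
change, and coordinate changes of `ℝ × M` are products with the identity of `ℝ`. -/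
lemma toChart_spaceTime {q₀ q : ℝ × M} (hq : q.2 ∈ (chartAt E q₀.2).source) (v : ℝ × E) :
    toChart (spaceTimeModel E) q₀ q v = (v.1, toChart 𝓘(ℝ, E) q₀.2 q.2 v.2) := by
  have h1 := fderiv_chartChange (I := spaceTimeModel E)
    (mem_chart_source (ModelProd ℝ E) q) (mem_chart_source_spaceTime.2 hq) v
  have h2 := fderiv_chartChange (I := 𝓘(ℝ, E)) (mem_chart_source E q.2) hq v.2
  have h3 : DifferentiableAt ℝ (chartChange 𝓘(ℝ, E) q.2 q₀.2) (extChartAt 𝓘(ℝ, E) q.2 q.2) := by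
    have h4 := (hasFDerivWithinAt_tangentCoordChange (I := 𝓘(ℝ, E)) (x := q.2) (y := q₀.2)
      (z := q.2) ⟨mem_extChartAt_source q.2, by rwa [extChartAt_source]⟩)
    rw [ModelWithCorners.range_eq_univ, hasFDerivWithinAt_univ] at h4
    exact h4.differentiableAt
  rw [fromChart_self] at h1 h2
  have h5 : HasFDerivAt (chartChange (spaceTimeModel E) q q₀) _
    (extChartAt (spaceTimeModel E) q q) :=
    HasFDerivAt.prodMap (𝕜 := ℝ) (f := id) (f₂ := chartChange 𝓘(ℝ, E) q.2 q₀.2)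
      (extChartAt (spaceTimeModel E) q q) (hasFDerivAt_id _) h3.hasFDerivAt
  rw [h5.fderiv] at h1
  refine h1.symm.trans (Prod.ext rfl h2)

lemma fromChart_spaceTime {q₀ q : ℝ × M} (hq : q.2 ∈ (chartAt E q₀.2).source) (v : ℝ × E) :
    fromChart (spaceTimeModel E) q₀ q v = (v.1, fromChart 𝓘(ℝ, E) q₀.2 q.2 v.2) := by
  have hq' : q ∈ (chartAt (ModelProd ℝ E) q₀).source := mem_chart_source_spaceTime.2 hq
  rw [← fromChart_toChart (I := spaceTimeModel E) hq' (v.1, fromChart 𝓘(ℝ, E) q₀.2 q.2 v.2), toChart_spaceTime hq,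
    toChart_fromChart hq]

/-- Reading of a family of bilinear forms in the chart around `x₀`. -/
def readForms (x₀ : M) (g : ℝ → BilinField 𝓘(ℝ, E) M) (p : ℝ × E) : E →L[ℝ] E →L[ℝ] ℝ :=
  readForm x₀ (g p.1) p.2

/-- Reading of a family of vector fields in the chart around `x₀`. -/
def readVecs (x₀ : M) (U : ℝ → VecField 𝓘(ℝ, E) M) (p : ℝ × E) : E :=
  vecInChart x₀ (U p.1) p.2

/-- Reading of a family of functions in the chart around `x₀`. -/
def readFuns (x₀ : M) (f : ℝ → M → ℝ) (p : ℝ × E) : ℝ :=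
  f p.1 ((extChartAt 𝓘(ℝ, E) x₀).symm p.2)

/-- Reading of a subset of `ℝ × M` in the chart around `x₀`. -/
def readSet (x₀ : M) (𝓥 : Set (ℝ × M)) : Set (ℝ × E) :=
  {p | p.2 ∈ (extChartAt 𝓘(ℝ, E) x₀).target ∧ (p.1, (extChartAt 𝓘(ℝ, E) x₀).symm p.2) ∈ 𝓥}

lemma isOpen_readSet (x₀ : M) {𝓥 : Set (ℝ × M)} (h𝓥 : IsOpen 𝓥) :
    IsOpen (readSet (E := E) x₀ 𝓥) := by
  have h1 : IsOpen (extChartAt (spaceTimeModel E) ((0 : ℝ), x₀)).target :=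
    isOpen_extChartAt_target _
  have h2 := (continuousOn_extChartAt_symm (I := spaceTimeModel E) ((0 : ℝ), x₀)).isOpen_inter_preimage
    h1 h𝓥
  have h3 : readSet (E := E) x₀ 𝓥 = (extChartAt (spaceTimeModel E) ((0 : ℝ), x₀)).target ∩
      (extChartAt (spaceTimeModel E) ((0 : ℝ), x₀)).symm ⁻¹' 𝓥 := by
    ext p
    rw [extChartAt_prod]
    exact ⟨fun h => ⟨⟨by
      rw [extChartAt_model_space_eq_id]; exact Set.mem_univ _, h.1⟩, h.2⟩, fun h => ⟨h.1.2, h.2⟩⟩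
  rw [h3]
  exact h2

lemma mem_source_of_mem_target {x₀ : M} {y : E} (hy : y ∈ (extChartAt 𝓘(ℝ, E) x₀).target) :
    (extChartAt 𝓘(ℝ, E) x₀).symm y ∈ (chartAt E x₀).source := by
  rw [← extChartAt_source 𝓘(ℝ, E)]
  exact (extChartAt 𝓘(ℝ, E) x₀).map_target hy

lemma readForm_lorentzMetric {q₀ : ℝ × M} {p : ℝ × E}
    (hp : p.2 ∈ (extChartAt 𝓘(ℝ, E) q₀.2).target) (lam : ℝ → M → ℝ)
    (g : ℝ → BilinField 𝓘(ℝ, E) M) :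
    readForm q₀ (lorentzMetric lam g) p =
      lorentzForm (readFuns q₀.2 lam) (readForms q₀.2 g) p := by
  refine ContinuousLinearMap.ext fun v => ContinuousLinearMap.ext fun w => ?_
  have h1 : ((extChartAt (spaceTimeModel E) q₀).symm p).2 ∈ (chartAt E q₀.2).source :=
    mem_source_of_mem_target hp
  rw [readForm, ContinuousLinearMap.bilinearComp_apply, fromChart_spaceTime h1,
    fromChart_spaceTime h1, lorentzForm_apply]
  have h2 : ∀ (q : ℝ × M) (v w : ℝ × E), formVal (lorentzMetric lam g) q v w =
      -(lam q.1 q.2 ^ 2) * (v.1 * w.1) + formVal (g q.1) q.2 v.2 w.2 := fun q v w =>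
    lorentzForm_apply (fun _ => lam q.1 q.2) (fun _ => formVal (g q.1) q.2) ((0 : ℝ), (0 : E)) v w
  rw [h2]
  rfl

lemma vecInChart_nullField {q₀ : ℝ × M} {p : ℝ × E}
    (hp : p.2 ∈ (extChartAt 𝓘(ℝ, E) q₀.2).target) (lam : ℝ → M → ℝ)
    (U : ℝ → VecField 𝓘(ℝ, E) M) (u : ℝ → M → ℝ) :
    vecInChart q₀ (nullField lam U u) p =
      nullVec (readFuns q₀.2 lam) (readVecs q₀.2 U) (readFuns q₀.2 u) p := by
  have h1 : ((extChartAt (spaceTimeModel E) q₀).symm p).2 ∈ (chartAt E q₀.2).source :=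
    mem_source_of_mem_target hp
  rw [vecInChart_eq, toChart_spaceTime h1]
  refine Prod.ext rfl ?_
  exact map_neg (toChart 𝓘(ℝ, E) q₀.2 _) (vecVal (U p.1) ((extChartAt 𝓘(ℝ, E) q₀.2).symm p.2))

variable [CompleteSpace E]

lemma contMDiffAt_forms_iff {x₀ : M} {g : ℝ → BilinField 𝓘(ℝ, E) M} {q : ℝ × M}
    (hq : q.2 ∈ (chartAt E x₀).source) :
    ContMDiffAt (spaceTimeModel E) (𝓘(ℝ, E).prod 𝓘(ℝ, E →L[ℝ] E →L[ℝ] ℝ)) ω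
      (fun q : ℝ × M => TotalSpace.mk' (E →L[ℝ] E →L[ℝ] ℝ)
        (E := fun x : M => TangentSpace 𝓘(ℝ, E) x →L[ℝ] TangentSpace 𝓘(ℝ, E) x →L[ℝ] ℝ)
        q.2 (g q.1 q.2)) q ↔
      AnalyticAt ℝ (readForms x₀ g) (q.1, extChartAt 𝓘(ℝ, E) x₀ q.2) := by
  refine (contMDiffAt_form_iff (b := fun q : ℝ × M => q.2) (L := fun q => g q.1 q.2) hq
    contMDiffAt_snd).trans ?_
  exact contMDiffAt_iff_analyticAt (x₀ := ((0 : ℝ), x₀)) (mem_chart_source_spaceTime.2 hq)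

lemma contMDiffAt_vecs_iff {x₀ : M} {U : ℝ → VecField 𝓘(ℝ, E) M} {q : ℝ × M}
    (hq : q.2 ∈ (chartAt E x₀).source) :
    ContMDiffAt (spaceTimeModel E) 𝓘(ℝ, E).tangent ω
      (fun q : ℝ × M => (⟨q.2, U q.1 q.2⟩ : TangentBundle 𝓘(ℝ, E) M)) q ↔
      AnalyticAt ℝ (readVecs x₀ U) (q.1, extChartAt 𝓘(ℝ, E) x₀ q.2) := by
  refine (contMDiffAt_vec_iff (b := fun q : ℝ × M => q.2) (X := fun q => U q.1 q.2) hq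
    contMDiffAt_snd).trans ?_
  exact contMDiffAt_iff_analyticAt (x₀ := ((0 : ℝ), x₀)) (mem_chart_source_spaceTime.2 hq)

lemma contMDiffAt_funs_iff {x₀ : M} {f : ℝ → M → ℝ} {q : ℝ × M}
    (hq : q.2 ∈ (chartAt E x₀).source) :
    ContMDiffAt (spaceTimeModel E) 𝓘(ℝ, ℝ) ω (fun q : ℝ × M => f q.1 q.2) q ↔
      AnalyticAt ℝ (readFuns x₀ f) (q.1, extChartAt 𝓘(ℝ, E) x₀ q.2) :=
  contMDiffAt_iff_analyticAt (x₀ := ((0 : ℝ), x₀)) (mem_chart_source_spaceTime.2 hq)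

end Spacetime

end Geom

end

/-! ### The null and parallel conditions in arbitrary charts -/

noncomputable section

lemma LocalGeom.koszul_congr {E : Type*} [NormedAddCommGroup E] [NormedSpace ℝ E]
    [FiniteDimensional ℝ E] {B B' : E → E →L[ℝ] E →L[ℝ] ℝ} {X X' : E → E} {y : E}
    (hB : B =ᶠ[𝓝 y] B') (hX : X =ᶠ[𝓝 y] X') (v z : E) :
    koszul B X y v z = koszul B' X' y v z := by
  rw [koszul, koszul, hB.fderiv_eq, hX.fderiv_eq, hB.self_of_nhds, hX.self_of_nhds]

namespace Geom

open Filter CauchyKovalevskaya LocalGeom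

section Spacetime

universe u

variable {E : Type u} [NormedAddCommGroup E] [NormedSpace ℝ E] [FiniteDimensional ℝ E]
  {M : Type*} [TopologicalSpace M] [ChartedSpace E M] [IsManifold 𝓘(ℝ, E) ω M]

lemma extChartAt_symm_of_mem_target {x₀ : M} {y : E} (hy : y ∈ (extChartAt 𝓘(ℝ, E) x₀).target) :
    extChartAt 𝓘(ℝ, E) x₀ ((extChartAt 𝓘(ℝ, E) x₀).symm y) = y :=
  (extChartAt 𝓘(ℝ, E) x₀).right_inv hy

lemma eventually_mem_target {x₀ : M} {q : ℝ × M} (hq : q.2 ∈ (chartAt E x₀).source) :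
    ∀ᶠ p in 𝓝 (q.1, extChartAt 𝓘(ℝ, E) x₀ q.2), p.2 ∈ (extChartAt 𝓘(ℝ, E) x₀).target := by
  have h1 : (extChartAt 𝓘(ℝ, E) x₀).target ∈ 𝓝 (extChartAt 𝓘(ℝ, E) x₀ q.2) :=
    (isOpen_extChartAt_target x₀).mem_nhds
      ((extChartAt 𝓘(ℝ, E) x₀).map_source (by rwa [extChartAt_source]))
  exact continuous_snd.continuousAt.eventually h1

lemma readForms_apply {x₀ : M} {q : ℝ × M} (hq : q.2 ∈ (chartAt E x₀).source)
    (g : ℝ → BilinField 𝓘(ℝ, E) M) (v w : E) :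
    readForms x₀ g (q.1, extChartAt 𝓘(ℝ, E) x₀ q.2) v w =
      formVal (g q.1) q.2 (fromChart 𝓘(ℝ, E) x₀ q.2 v) (fromChart 𝓘(ℝ, E) x₀ q.2 w) := by
  rw [readForms, readForm, ContinuousLinearMap.bilinearComp_apply, extChartAt_symm_apply hq]

lemma readVecs_apply {x₀ : M} {q : ℝ × M} (hq : q.2 ∈ (chartAt E x₀).source)
    (U : ℝ → VecField 𝓘(ℝ, E) M) :
    readVecs x₀ U (q.1, extChartAt 𝓘(ℝ, E) x₀ q.2) =
      toChart 𝓘(ℝ, E) x₀ q.2 (vecVal (U q.1) q.2) := by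
  rw [readVecs, vecInChart_eq, extChartAt_symm_apply hq]

lemma readFuns_apply {x₀ : M} {q : ℝ × M} (hq : q.2 ∈ (chartAt E x₀).source)
    (f : ℝ → M → ℝ) :
    readFuns x₀ f (q.1, extChartAt 𝓘(ℝ, E) x₀ q.2) = f q.1 q.2 := by
  rw [readFuns, extChartAt_symm_apply hq]

lemma fromChart_ne_zero {x₀ z : M} (hz : z ∈ (chartAt E x₀).source) {v : E} (hv : v ≠ 0) :
    fromChart 𝓘(ℝ, E) x₀ z v ≠ 0 := fun h => hv (by
  rw [← toChart_fromChart (I := 𝓘(ℝ, E)) hz v, h, map_zero])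

lemma nondeg_readForms {x₀ : M} {q : ℝ × M} (hq : q.2 ∈ (chartAt E x₀).source)
    {g : ℝ → BilinField 𝓘(ℝ, E) M} (hpos : ∀ v : E, v ≠ 0 → 0 < formVal (g q.1) q.2 v v) :
    ∀ v, v ≠ 0 → 0 < readForms x₀ g (q.1, extChartAt 𝓘(ℝ, E) x₀ q.2) v v := fun v hv => by
  rw [readForms_apply hq]
  exact hpos _ (fromChart_ne_zero hq hv)

/-- The parallel condition in an arbitrary chart. -/
lemma cov_eq_zero_iff_parallelAt {lam : ℝ → M → ℝ} {g : ℝ → BilinField 𝓘(ℝ, E) M}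
    {U : ℝ → VecField 𝓘(ℝ, E) M} {u : ℝ → M → ℝ} {x₀ : M} {q : ℝ × M}
    (hq : q.2 ∈ (chartAt E x₀).source) (hlam : lam q.1 q.2 ≠ 0)
    (hlama : ContMDiffAt (spaceTimeModel E) 𝓘(ℝ, ℝ) ω (fun q : ℝ × M => lam q.1 q.2) q)
    (hg : ContMDiffAt (spaceTimeModel E) (𝓘(ℝ, E).prod 𝓘(ℝ, E →L[ℝ] E →L[ℝ] ℝ)) ω
      (fun q : ℝ × M => TotalSpace.mk' (E →L[ℝ] E →L[ℝ] ℝ)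
        (E := fun x : M => TangentSpace 𝓘(ℝ, E) x →L[ℝ] TangentSpace 𝓘(ℝ, E) x →L[ℝ] ℝ)
        q.2 (g q.1 q.2)) q)
    (hU : ContMDiffAt (spaceTimeModel E) 𝓘(ℝ, E).tangent ω
      (fun q : ℝ × M => (⟨q.2, U q.1 q.2⟩ : TangentBundle 𝓘(ℝ, E) M)) q)
    (hu : ContMDiffAt (spaceTimeModel E) 𝓘(ℝ, ℝ) ω (fun q : ℝ × M => u q.1 q.2) q)
    (hsymm : ∀ v w : E, formVal (g q.1) q.2 v w = formVal (g q.1) q.2 w v)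
    (hpos : ∀ v : E, v ≠ 0 → 0 < formVal (g q.1) q.2 v v) :
    (∀ v, cov (lorentzMetric lam g).form (nullField lam U u) q v = 0) ↔
      ParallelAt (readFuns x₀ lam) (readForms x₀ g) (readVecs x₀ U) (readFuns x₀ u)
        (q.1, extChartAt 𝓘(ℝ, E) x₀ q.2) := by
  have := FiniteDimensional.complete ℝ E
  -- Two charts are needed: the one around `q`, in which `cov` is defined, and the given one around
  -- `x₀`.
  have key : ∀ x₀ : M, q.2 ∈ (chartAt E x₀).source → ∀ t₀ : ℝ,
      readForm (t₀, x₀) (lorentzMetric lam g) =ᶠ[𝓝 (q.1, extChartAt 𝓘(ℝ, E) x₀ q.2)]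
        lorentzForm (readFuns x₀ lam) (readForms x₀ g) ∧
      vecInChart (t₀, x₀) (nullField lam U u) =ᶠ[𝓝 (q.1, extChartAt 𝓘(ℝ, E) x₀ q.2)]
        nullVec (readFuns x₀ lam) (readVecs x₀ U) (readFuns x₀ u) ∧
      DifferentiableAt ℝ (readForm (t₀, x₀) (lorentzMetric lam g))
        (q.1, extChartAt 𝓘(ℝ, E) x₀ q.2) ∧
      DifferentiableAt ℝ (vecInChart (t₀, x₀) (nullField lam U u))
        (q.1, extChartAt 𝓘(ℝ, E) x₀ q.2) := by
    intro x₀ hq t₀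
    have h1 : readForm (t₀, x₀) (lorentzMetric lam g) =ᶠ[𝓝 (q.1, extChartAt 𝓘(ℝ, E) x₀ q.2)]
        lorentzForm (readFuns x₀ lam) (readForms x₀ g) := by
      filter_upwards [eventually_mem_target hq] with p hp
      exact readForm_lorentzMetric (q₀ := (t₀, x₀)) hp lam g
    have h2 : vecInChart (t₀, x₀) (nullField lam U u) =ᶠ[𝓝 (q.1, extChartAt 𝓘(ℝ, E) x₀ q.2)]
        nullVec (readFuns x₀ lam) (readVecs x₀ U) (readFuns x₀ u) := by
      filter_upwards [eventually_mem_target hq] with p hp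
      exact vecInChart_nullField (q₀ := (t₀, x₀)) hp lam U u
    have h3 := ((contMDiffAt_funs_iff hq).1 hlama).differentiableAt
    have h4 := ((contMDiffAt_forms_iff hq).1 hg).differentiableAt
    have h5 := ((contMDiffAt_vecs_iff hq).1 hU).differentiableAt
    have h6 := ((contMDiffAt_funs_iff hq).1 hu).differentiableAt
    refine ⟨h1, h2, h1.differentiableAt_iff.2 (differentiableAt_lorentzForm h3 h4),
      h2.differentiableAt_iff.2 (hasFDerivAt_nullVec h3 h5 h6 ?_).differentiableAt⟩
    rwa [readFuns_apply hq]
  have hself : q.2 ∈ (chartAt E q.2).source := mem_chart_source E q.2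
  obtain ⟨k1, k2, k3, k4⟩ := key q.2 hself q.1
  obtain ⟨l1, l2, l3, l4⟩ := key x₀ hq q.1
  have hn : Nondeg (readForm q (lorentzMetric lam g) (q.1, extChartAt 𝓘(ℝ, E) q.2 q.2)) := by
    have h1 := k1.self_of_nhds
    rw [Prod.mk.eta] at h1
    rw [h1]
    exact nondeg_lorentzForm (by rwa [readFuns_apply hself])
      (nondeg_of_pos (nondeg_readForms hself hpos))
  have h1 : (∀ v, cov (lorentzMetric lam g).form (nullField lam U u) q v = 0) ↔
      ∀ v z, koszul (readForm q (lorentzMetric lam g)) (vecInChart q (nullField lam U u))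
        (extChartAt (spaceTimeModel E) q q) v z = 0 :=
    cov_eq_zero_iff k3 hn _
  rw [h1]
  have hlsymm : ∀ v w : ℝ × E, formVal (lorentzMetric lam g) q v w =
      formVal (lorentzMetric lam g) q w v := fun v w => by
    have h2 : ∀ v w : ℝ × E, formVal (lorentzMetric lam g) q v w =
      -(lam q.1 q.2 ^ 2) * (v.1 * w.1) + formVal (g q.1) q.2 v.2 w.2 := fun v w =>
      lorentzForm_apply (fun _ => lam q.1 q.2) (fun _ => formVal (g q.1) q.2) ((0 : ℝ), (0 : E)) v w
    rw [h2, h2, hsymm, mul_comm v.1]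
  -- The Koszul expressions in the two charts differ by the isomorphism `toChart` in both arguments,
  -- so they vanish identically together.
  have h2 := koszul_chartChange (I := spaceTimeModel E) (x₀ := (q.1, x₀)) (x := q)
    (mem_chart_source_spaceTime.2 hq) (g := lorentzMetric lam g) (X := nullField lam U u)
    l3 l4 k4 hlsymm
  have hlam' : readFuns x₀ lam (q.1, extChartAt 𝓘(ℝ, E) x₀ q.2) ≠ 0 := by rwa [readFuns_apply hq]
  rw [← koszul_lorentzForm_eq_zero_iff ((contMDiffAt_funs_iff hq).1 hlama).differentiableAt
    ((contMDiffAt_forms_iff hq).1 hg).differentiableAt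
    ((contMDiffAt_vecs_iff hq).1 hU).differentiableAt
    ((contMDiffAt_funs_iff hq).1 hu).differentiableAt hlam']
  simp only [h2]
  have hs : q ∈ (chartAt (ModelProd ℝ E) (q.1, x₀)).source := mem_chart_source_spaceTime.2 hq
  constructor
  · intro h v z
    have h3 := h (fromChart (spaceTimeModel E) (q.1, x₀) q v)
      (fromChart (spaceTimeModel E) (q.1, x₀) q z)
    rw [toChart_fromChart hs, toChart_fromChart hs] at h3
    rw [← koszul_congr l1 l2]
    exact h3
  · intro h v z
    exact (koszul_congr l1 l2 _ _).trans (h _ _)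

/-- Length zero means `u² = g(U, U)`. Under this equation `u = 0` forces `U = 0` by positivity, so
`V ≠ 0` amounts to `u ≠ 0`. -/
lemma null_iff {lam : ℝ → M → ℝ} {g : ℝ → BilinField 𝓘(ℝ, E) M}
    {U : ℝ → VecField 𝓘(ℝ, E) M} {u : ℝ → M → ℝ} {q : ℝ × M} (hlam : lam q.1 q.2 ≠ 0)
    (hpos : ∀ v : E, v ≠ 0 → 0 < formVal (g q.1) q.2 v v) :
    (nullField lam U u q ≠ 0 ∧
      (lorentzMetric lam g).form q (nullField lam U u q) (nullField lam U u q) = 0) ↔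
    u q.1 q.2 ≠ 0 ∧ u q.1 q.2 ^ 2 =
      formVal (g q.1) q.2 (vecVal (U q.1) q.2) (vecVal (U q.1) q.2) := by
  have h1 : (lorentzMetric lam g).form q (nullField lam U u q) (nullField lam U u q) =
      -(lam q.1 q.2 ^ 2) * (u q.1 q.2 / lam q.1 q.2 * (u q.1 q.2 / lam q.1 q.2)) +
        formVal (g q.1) q.2 (-vecVal (U q.1) q.2) (-vecVal (U q.1) q.2) :=
    lorentzForm_apply (fun _ => lam q.1 q.2) (fun _ => formVal (g q.1) q.2) ((0 : ℝ), (0 : E))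
      (u q.1 q.2 / lam q.1 q.2, -vecVal (U q.1) q.2) (u q.1 q.2 / lam q.1 q.2, -vecVal (U q.1) q.2)
  have h2 : -(lam q.1 q.2 ^ 2) * (u q.1 q.2 / lam q.1 q.2 * (u q.1 q.2 / lam q.1 q.2)) =
      -(u q.1 q.2 ^ 2) := by field_simp
  rw [h1, h2]
  simp only [map_neg, neg_apply, neg_neg]
  have h3 : nullField lam U u q = 0 ↔ u q.1 q.2 / lam q.1 q.2 = 0 ∧ -vecVal (U q.1) q.2 = 0 :=
    Prod.ext_iff
  rw [ne_eq, h3, neg_add_eq_zero]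
  refine and_congr_left fun h => ?_
  rw [not_iff_not]
  refine ⟨fun h' => by simpa [hlam] using h'.1, fun h' => ?_⟩
  rw [h'] at h ⊢
  refine ⟨by simp, ?_⟩
  by_contra h4
  exact absurd h (by simpa using (hpos _ (fun h5 => h4 (by rw [h5, neg_zero]))).ne)

end Spacetime

end Geom

end

/-! ### Transfer between the manifold and charts; uniqueness along fibres and locality -/

noncomputable section

namespace LocalGeom

open CauchyKovalevskaya

lemma ParallelAt.congr {E : Type*} [NormedAddCommGroup E] [NormedSpace ℝ E]
    [FiniteDimensional ℝ E] {lam : ℝ × E → ℝ} {g g' : ℝ × E → E →L[ℝ] E →L[ℝ] ℝ} {U U' : ℝ × E → E}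
    {u u' : ℝ × E → ℝ} {p : ℝ × E} (h : ParallelAt lam g U u p) (hg : g' =ᶠ[𝓝 p] g)
    (hU : U' =ᶠ[𝓝 p] U) (hu : u' =ᶠ[𝓝 p] u) : ParallelAt lam g' U' u' p := by
  obtain ⟨h1, h2, h3, h4⟩ := h
  have e1 : dt g' p = dt g p := by rw [dt, hg.fderiv_eq]; rfl
  have e2 : dx g' p = dx g p := by rw [dx, hg.fderiv_eq]; rfl
  have e3 : dt U' p = dt U p := by rw [dt, hU.fderiv_eq]; rfl
  have e4 : dx U' p = dx U p := by rw [dx, hU.fderiv_eq]; rfl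
  have e5 : dt u' p = dt u p := by rw [dt, hu.fderiv_eq]; rfl
  have e6 : dx u' p = dx u p := by rw [dx, hu.fderiv_eq]; rfl
  constructor
  · rwa [e5, hU.self_of_nhds]
  · rwa [e1, e3, hU.self_of_nhds, hu.self_of_nhds, hg.self_of_nhds]
  · rwa [e1, e6, hU.self_of_nhds]
  · rwa [e1, e2, e4, hU.self_of_nhds, hu.self_of_nhds, hg.self_of_nhds]

lemma ParallelFamily.congr {E : Type*} [NormedAddCommGroup E] [NormedSpace ℝ E]
    [FiniteDimensional ℝ E] {lam : ℝ × E → ℝ} {g g' : ℝ × E → E →L[ℝ] E →L[ℝ] ℝ} {U U' : ℝ × E → E}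
    {u u' : ℝ × E → ℝ} {S : Set (ℝ × E)} (h : ParallelFamily lam S g U u) (hS : IsOpen S)
    (hg : Set.EqOn g' g S) (hU : Set.EqOn U' U S) (hu : Set.EqOn u' u S) :
    ParallelFamily lam S g' U' u' where
  analytic_g p hp := (h.analytic_g p hp).congr (hg.symm.eventuallyEq_of_mem (hS.mem_nhds hp))
  analytic_U p hp := (h.analytic_U p hp).congr (hU.symm.eventuallyEq_of_mem (hS.mem_nhds hp))
  analytic_u p hp := (h.analytic_u p hp).congr (hu.symm.eventuallyEq_of_mem (hS.mem_nhds hp))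
  symm p hp := by rw [hg hp]; exact h.symm p hp
  pos p hp := by rw [hg hp]; exact h.pos p hp
  sq_u p hp := by rw [hg hp, hU hp, hu hp]; exact h.sq_u p hp
  u_ne p hp := by rw [hu hp]; exact h.u_ne p hp
  parallel p hp := (h.parallel p hp).congr (hg.eventuallyEq_of_mem (hS.mem_nhds hp))
    (hU.eventuallyEq_of_mem (hS.mem_nhds hp)) (hu.eventuallyEq_of_mem (hS.mem_nhds hp))

lemma ParallelFamily.mono {E : Type*} [NormedAddCommGroup E] [NormedSpace ℝ E]
    [FiniteDimensional ℝ E] {lam : ℝ × E → ℝ} {g : ℝ × E → E →L[ℝ] E →L[ℝ] ℝ} {U : ℝ × E → E}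
    {u : ℝ × E → ℝ} {S S' : Set (ℝ × E)} (h : ParallelFamily lam S g U u) (hS : S' ⊆ S) :
    ParallelFamily lam S' g U u where
  analytic_g p hp := h.analytic_g p (hS hp)
  analytic_U p hp := h.analytic_U p (hS hp)
  analytic_u p hp := h.analytic_u p (hS hp)
  symm p hp := h.symm p (hS hp)
  pos p hp := h.pos p (hS hp)
  sq_u p hp := h.sq_u p (hS hp)
  u_ne p hp := h.u_ne p (hS hp)
  parallel p hp := h.parallel p (hS hp)

/-- The connection depends only on germs; this makes the parallel condition local, as needed for
gluing. -/
lemma cov_congr {E : Type*} [NormedAddCommGroup E] [NormedSpace ℝ E] {G G' : E → E → E → ℝ}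
    {X X' : E → E} {y : E} (hG : G =ᶠ[𝓝 y] G') (hX : X =ᶠ[𝓝 y] X') (v : E) :
    cov G X y v = cov G' X' y v := by
  have h1 : ∀ a b, fderiv ℝ (fun p => G p a b) y = fderiv ℝ (fun p => G' p a b) y := fun a b =>
    Filter.EventuallyEq.fderiv_eq (by filter_upwards [hG] with p hp; rw [hp])
  simp only [cov, christoffel, h1, hX.fderiv_eq, hX.self_of_nhds, hG.self_of_nhds]

end LocalGeom

namespace Geom

open Filter CauchyKovalevskaya LocalGeom

section Spacetime

universe u

variable {E : Type u} [NormedAddCommGroup E] [NormedSpace ℝ E] [FiniteDimensional ℝ E]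
  {M : Type*} [TopologicalSpace M] [ChartedSpace E M] [IsManifold 𝓘(ℝ, E) ω M]
  {lam : ℝ → M → ℝ} {𝓥 : Set (ℝ × M)} {g g' : ℝ → BilinField 𝓘(ℝ, E) M}
  {U U' : ℝ → VecField 𝓘(ℝ, E) M} {u u' : ℝ → M → ℝ}

lemma mem_readSet {x₀ : M} {q : ℝ × M} (hq : q.2 ∈ (chartAt E x₀).source) :
    (q.1, extChartAt 𝓘(ℝ, E) x₀ q.2) ∈ readSet (E := E) x₀ 𝓥 ↔ q ∈ 𝓥 := by
  simp only [readSet, Set.mem_ofPred_eq, extChartAt_symm_apply hq, Prod.mk.eta, and_iff_right_iff_imp]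
  exact fun _ => (extChartAt 𝓘(ℝ, E) x₀).map_source (by rwa [extChartAt_source])

lemma exists_of_mem_readSet {x₀ : M} {p : ℝ × E} (hp : p ∈ readSet (E := E) x₀ 𝓥) :
    ∃ q ∈ 𝓥, q.2 ∈ (chartAt E x₀).source ∧ p = (q.1, extChartAt 𝓘(ℝ, E) x₀ q.2) :=
  ⟨_, hp.2, mem_source_of_mem_target hp.1,
    Prod.ext rfl (extChartAt_symm_of_mem_target hp.1).symm⟩

lemma analyticOnNhd_readFuns
    (hlam : ContMDiff (spaceTimeModel E) 𝓘(ℝ, ℝ) ω (fun q : ℝ × M => lam q.1 q.2)) (x₀ : M) :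
    AnalyticOnNhd ℝ (readFuns x₀ lam) (readSet (E := E) x₀ 𝓥) := fun p hp => by
  have := FiniteDimensional.complete ℝ E
  obtain ⟨q, -, hq, rfl⟩ := exists_of_mem_readSet hp
  exact (contMDiffAt_funs_iff hq).1 (hlam q)

/-- Families with a parallel null field in charts. -/
theorem IsParallelNullFamily.read (h : IsParallelNullFamily lam 𝓥 g U u) (h𝓥 : IsOpen 𝓥)
    (hlam0 : ∀ t x, lam t x ≠ 0)
    (hlam : ContMDiff (spaceTimeModel E) 𝓘(ℝ, ℝ) ω (fun q : ℝ × M => lam q.1 q.2)) (x₀ : M) :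
    ParallelFamily (readFuns x₀ lam) (readSet x₀ 𝓥) (readForms x₀ g) (readVecs x₀ U)
      (readFuns x₀ u) := by
  have := FiniteDimensional.complete ℝ E
  have hnull := fun q hq => (null_iff (U := U) (u := u) (hlam0 q.1 q.2) (h.pos q hq)).1 (h.null q hq)
  constructor
  all_goals
    intro p hp
    obtain ⟨q, hq𝓥, hq, rfl⟩ := exists_of_mem_readSet hp
  · exact (contMDiffAt_forms_iff hq).1 ((h.analytic_metric q hq𝓥).contMDiffAt (h𝓥.mem_nhds hq𝓥))
  · exact (contMDiffAt_vecs_iff hq).1 ((h.analytic_vector q hq𝓥).contMDiffAt (h𝓥.mem_nhds hq𝓥))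
  · exact (contMDiffAt_funs_iff hq).1 ((h.analytic_scalar q hq𝓥).contMDiffAt (h𝓥.mem_nhds hq𝓥))
  · intro v w
    rw [readForms_apply hq, readForms_apply hq]
    exact h.symm q hq𝓥 _ _
  · exact nondeg_readForms hq (h.pos q hq𝓥)
  · rw [readForms_apply hq, readVecs_apply hq, readFuns_apply hq, fromChart_toChart hq]
    exact (hnull q hq𝓥).2
  · rw [readFuns_apply hq]
    exact (hnull q hq𝓥).1
  · exact (cov_eq_zero_iff_parallelAt hq (hlam0 _ _) (hlam q)
      ((h.analytic_metric q hq𝓥).contMDiffAt (h𝓥.mem_nhds hq𝓥))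
      ((h.analytic_vector q hq𝓥).contMDiffAt (h𝓥.mem_nhds hq𝓥))
      ((h.analytic_scalar q hq𝓥).contMDiffAt (h𝓥.mem_nhds hq𝓥))
      (h.symm q hq𝓥) (h.pos q hq𝓥)).1 (h.parallel q hq𝓥)

/-- Families with a parallel null field from their reading in one chart. -/
theorem IsParallelNullFamily.of_read {x₀ : M}
    (h : ParallelFamily (readFuns x₀ lam) (readSet x₀ 𝓥) (readForms x₀ g) (readVecs x₀ U)
      (readFuns x₀ u)) (hsub : ∀ q ∈ 𝓥, q.2 ∈ (chartAt E x₀).source)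
    (hlam0 : ∀ t x, lam t x ≠ 0)
    (hlam : ContMDiff (spaceTimeModel E) 𝓘(ℝ, ℝ) ω (fun q : ℝ × M => lam q.1 q.2)) :
    IsParallelNullFamily lam 𝓥 g U u := by
  have := FiniteDimensional.complete ℝ E
  have hsymm : ∀ q ∈ 𝓥, ∀ v w : E, formVal (g q.1) q.2 v w = formVal (g q.1) q.2 w v := by
    intro q hq v w
    have h1 := h.symm _ ((mem_readSet (hsub q hq)).2 hq) (toChart 𝓘(ℝ, E) x₀ q.2 v)
      (toChart 𝓘(ℝ, E) x₀ q.2 w)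
    rwa [readForms_apply (hsub q hq), readForms_apply (hsub q hq), fromChart_toChart (hsub q hq),
      fromChart_toChart (hsub q hq)] at h1
  have hpos : ∀ q ∈ 𝓥, ∀ v : E, v ≠ 0 → 0 < formVal (g q.1) q.2 v v := by
    intro q hq v hv
    have h1 := h.pos _ ((mem_readSet (hsub q hq)).2 hq) (toChart 𝓘(ℝ, E) x₀ q.2 v) fun h0 => hv (by
      rw [← fromChart_toChart (I := 𝓘(ℝ, E)) (hsub q hq) v, h0, map_zero])
    rwa [readForms_apply (hsub q hq), fromChart_toChart (hsub q hq)] at h1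
  have hg := fun q hq => (contMDiffAt_forms_iff (hsub q hq)).2
    (h.analytic_g _ ((mem_readSet (hsub q hq)).2 hq))
  have hU := fun q hq => (contMDiffAt_vecs_iff (hsub q hq)).2
    (h.analytic_U _ ((mem_readSet (hsub q hq)).2 hq))
  have hu := fun q hq => (contMDiffAt_funs_iff (hsub q hq)).2
    (h.analytic_u _ ((mem_readSet (hsub q hq)).2 hq))
  refine ⟨hsymm, hpos, fun q hq => (hg q hq).contMDiffWithinAt,
    fun q hq => (hU q hq).contMDiffWithinAt, fun q hq => (hu q hq).contMDiffWithinAt,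
    fun q hq => ?_, fun q hq => ?_⟩
  · refine (null_iff (U := U) (u := u) (hlam0 q.1 q.2) (hpos q hq)).2 ⟨?_, ?_⟩
    · rw [← readFuns_apply (hsub q hq) u]
      exact h.u_ne _ ((mem_readSet (hsub q hq)).2 hq)
    · have h1 := h.sq_u _ ((mem_readSet (hsub q hq)).2 hq)
      rwa [readForms_apply (hsub q hq), readVecs_apply (hsub q hq), readFuns_apply (hsub q hq),
        fromChart_toChart (hsub q hq)] at h1
  · exact (cov_eq_zero_iff_parallelAt (hsub q hq) (hlam0 _ _) (hlam q) (hg q hq) (hU q hq)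
      (hu q hq) (hsymm q hq) (hpos q hq)).2 (h.parallel _ ((mem_readSet (hsub q hq)).2 hq))

lemma IsParallelNullFamily.mono {𝓥' : Set (ℝ × M)} (h : IsParallelNullFamily lam 𝓥 g U u)
    (hs : 𝓥' ⊆ 𝓥) : IsParallelNullFamily lam 𝓥' g U u where
  symm q hq := h.symm q (hs hq)
  pos q hq := h.pos q (hs hq)
  analytic_metric := h.analytic_metric.mono hs
  analytic_vector := h.analytic_vector.mono hs
  analytic_scalar := h.analytic_scalar.mono hs
  null q hq := h.null q (hs hq)
  parallel q hq := h.parallel q (hs hq)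

/-- Uniqueness along the `t`-fibres. -/
theorem IsParallelNullFamily.eq_of_initial (h : IsParallelNullFamily lam 𝓥 g U u)
    (h' : IsParallelNullFamily lam 𝓥 g' U' u') (h𝓥 : IsOpen 𝓥) (hlam0 : ∀ t x, lam t x ≠ 0)
    (hlam : ContMDiff (spaceTimeModel E) 𝓘(ℝ, ℝ) ω (fun q : ℝ × M => lam q.1 q.2))
    (hi : ∀ x, ((0 : ℝ), x) ∈ 𝓥 → g 0 x = g' 0 x ∧ U 0 x = U' 0 x ∧ u 0 x = u' 0 x)
    {q : ℝ × M} (hq : q ∈ 𝓥) (hT : IsPreconnected {t : ℝ | (t, q.2) ∈ 𝓥})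
    (h0 : ((0 : ℝ), q.2) ∈ 𝓥) :
    g q.1 q.2 = g' q.1 q.2 ∧ U q.1 q.2 = U' q.1 q.2 ∧ u q.1 q.2 = u' q.1 q.2 := by
  have hs := mem_chart_source E q.2
  have hcont : Continuous fun y : E => ((0 : ℝ), y) := by fun_prop
  obtain ⟨e1, e2, e3⟩ := (h.read h𝓥 hlam0 hlam q.2).eq_of_initial (h'.read h𝓥 hlam0 hlam q.2)
    (isOpen_readSet q.2 h𝓥) (analyticOnNhd_readFuns hlam q.2)
    (s := (fun y : E => ((0 : ℝ), y)) ⁻¹' readSet q.2 𝓥) ((isOpen_readSet q.2 h𝓥).preimage hcont)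
    (fun y hy => hy) (fun y hy => by
      obtain ⟨i1, i2, i3⟩ := hi _ hy.2
      refine ⟨?_, ?_, ?_⟩
      · simp only [readForms, readForm, formVal, i1]
      · simp only [readVecs, vecInChart, i2]
      · simp only [readFuns, i3])
    (y := extChartAt 𝓘(ℝ, E) q.2 q.2) ((mem_readSet (q := (0, q.2)) hs).2 h0) hT h0
    (fun t ht => (mem_readSet (q := (t, q.2)) hs).2 ht) (t := q.1) hq
  refine ⟨?_, ?_, ?_⟩
  · have h1 : ∀ v w : E, formVal (g q.1) q.2 v w = formVal (g' q.1) q.2 v w := fun v w => by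
      have h1 := congr($e1 v w)
      rw [readForms_apply hs, readForms_apply hs, fromChart_self] at h1
      exact h1
    exact ContinuousLinearMap.ext fun v => ContinuousLinearMap.ext fun w => h1 v w
  · rw [readVecs_apply hs, readVecs_apply hs, toChart_self] at e2
    exact e2
  · rwa [readFuns_apply hs, readFuns_apply hs] at e3

/-- The notion of a family with a parallel null field is local. -/
theorem IsParallelNullFamily.of_locally
    (h : ∀ q ∈ 𝓥, ∃ 𝓦 : Set (ℝ × M), IsOpen 𝓦 ∧ q ∈ 𝓦 ∧ ∃ g' U' u',
      IsParallelNullFamily lam 𝓦 g' U' u' ∧ ∀ r ∈ 𝓦, g r.1 r.2 = g' r.1 r.2 ∧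
        U r.1 r.2 = U' r.1 r.2 ∧ u r.1 r.2 = u' r.1 r.2) :
    IsParallelNullFamily lam 𝓥 g U u := by
  constructor
  all_goals
    intro q hq
    obtain ⟨𝓦, h𝓦, hq𝓦, g', U', u', h', he⟩ := h q hq
  · rw [(he q hq𝓦).1]
    exact h'.symm q hq𝓦
  · rw [(he q hq𝓦).1]
    exact h'.pos q hq𝓦
  · refine (((h'.analytic_metric q hq𝓦).contMDiffAt (h𝓦.mem_nhds hq𝓦)).congr_of_eventuallyEq
      ?_).contMDiffWithinAt
    filter_upwards [h𝓦.mem_nhds hq𝓦] with r hr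
    rw [(he r hr).1]
  · refine (((h'.analytic_vector q hq𝓦).contMDiffAt (h𝓦.mem_nhds hq𝓦)).congr_of_eventuallyEq
      ?_).contMDiffWithinAt
    filter_upwards [h𝓦.mem_nhds hq𝓦] with r hr
    rw [(he r hr).2.1]
  · refine (((h'.analytic_scalar q hq𝓦).contMDiffAt (h𝓦.mem_nhds hq𝓦)).congr_of_eventuallyEq
      ?_).contMDiffWithinAt
    filter_upwards [h𝓦.mem_nhds hq𝓦] with r hr
    rw [(he r hr).2.2]
  all_goals
    have e1 : ∀ r ∈ 𝓦, lorentzMetric lam g r = lorentzMetric lam g' r := fun r hr => by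
      simp only [lorentzMetric, (he r hr).1]; rfl
    have e2 : ∀ r ∈ 𝓦, nullField lam U u r = nullField lam U' u' r := fun r hr => by
      simp only [nullField, (he r hr).2.1, (he r hr).2.2]; rfl
  · rw [BilinField.form, e1 q hq𝓦, e2 q hq𝓦]
    exact h'.null q hq𝓦
  · intro v
    rw [← h'.parallel q hq𝓦 v]
    have h1 : ∀ᶠ p in 𝓝 (extChartAt (spaceTimeModel E) q q),
        (extChartAt (spaceTimeModel E) q).symm p ∈ 𝓦 := by
      refine (continuousAt_extChartAt_symm q).eventually ?_
      rw [extChartAt_to_inv]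
      exact h𝓦.mem_nhds hq𝓦
    refine cov_congr (E := ℝ × E) ?_ ?_ v
    · filter_upwards [h1] with p hp
      funext v w
      simp only [formInChart, BilinField.form, e1 _ hp]
    · filter_upwards [h1] with p hp
      simp only [vecInChart, e2 _ hp]

end Spacetime

end Geom

end

/-! ### Restriction to time slices and the evolution equations on the manifold -/

noncomputable section

namespace LocalGeom

open CauchyKovalevskaya Filter

universe u

variable {E : Type u} [NormedAddCommGroup E] [NormedSpace ℝ E] [FiniteDimensional ℝ E]

lemma hasFDerivAt_slice {G : Type*} [NormedAddCommGroup G] [NormedSpace ℝ G] {f : ℝ × E → G}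
    {t : ℝ} {y : E} (hf : DifferentiableAt ℝ f (t, y)) :
    HasFDerivAt (fun z => f (t, z)) (dx f (t, y)) y := by
  have h1 : HasFDerivAt (fun z : E => (t, z)) (ContinuousLinearMap.inr ℝ ℝ E) y := by
    simpa using! hasFDerivAt_prodMk_right t y
  exact hf.hasFDerivAt.comp y h1

lemma eventually_slice {S : Set (ℝ × E)} (hS : IsOpen S) {t : ℝ} {y : E} (hp : (t, y) ∈ S) :
    ∀ᶠ z in 𝓝 y, (t, z) ∈ S :=
  (Continuous.prodMk_right t).continuousAt.eventually (hS.mem_nhds hp)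

lemma eventually_time {S : Set (ℝ × E)} (hS : IsOpen S) {t : ℝ} {y : E} (hp : (t, y) ∈ S) :
    ∀ᶠ s in 𝓝 t, (s, y) ∈ S :=
  (Continuous.prodMk_left y).continuousAt.eventually (hS.mem_nhds hp)

namespace ParallelFamily

variable {lam : ℝ × E → ℝ} {S : Set (ℝ × E)} {g : ℝ × E → E →L[ℝ] E →L[ℝ] ℝ}
    {U : ℝ × E → E} {u : ℝ × E → ℝ} (h : ParallelFamily lam S g U u) (hS : IsOpen S)
    (hlam : AnalyticOnNhd ℝ lam S) (hlam0 : ∀ p ∈ S, lam p ≠ 0) {t : ℝ} {y : E}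
    (hp : (t, y) ∈ S)

include h hp

/-- This and the following lemmas translate the definitions for a single metric, applied at fixed
`t`, into partial derivatives of the whole family. -/
lemma christoffel_slice (v w : E) :
    christoffel (fun z v w => g (t, z) v w) y v w = Gam g (t, y) v w := by
  have h1 := hasFDerivAt_slice (h.analytic_g _ hp).differentiableAt
  rw [christoffel_eq (B := fun z => g (t, z)) h1.differentiableAt (h.nondeg hp), h1.fderiv, Gam]

lemma deriv_form (v w : E) : deriv (fun s => g (s, y) v w) t = dt g (t, y) v w := by
  have hg := (h.analytic_g _ hp).differentiableAt
  have h1 : DifferentiableAt ℝ (fun q => g q v w) (t, y) :=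
    (hg.clm_apply (differentiableAt_const _)).clm_apply (differentiableAt_const _)
  rw [deriv_slice (f := fun q => g q v w) h1, dt, fderiv_bilin_apply hg]
  rfl

include hS

lemma deriv_deriv_form (v w : E) :
    deriv (fun s => deriv (fun r => g (r, y) v w) s) t = dt (dt g) (t, y) v w := by
  have hg := (analyticAt_dt (h.analytic_g _ hp)).differentiableAt
  have h1 : DifferentiableAt ℝ (fun q => dt g q v w) (t, y) :=
    (hg.clm_apply (differentiableAt_const _)).clm_apply (differentiableAt_const _)
  have h2 : (fun s => deriv (fun r => g (r, y) v w) s) =ᶠ[𝓝 t] fun s => dt g (s, y) v w := by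
    filter_upwards [eventually_time hS hp] with s hs using h.deriv_form hs v w
  rw [h2.deriv_eq, deriv_slice (f := fun q => dt g q v w) h1, dt, fderiv_bilin_apply hg]
  rfl

lemma curv_slice (v w a : E) :
    curv (fun z v w => g (t, z) v w) y v w a = curvx g (t, y) v w a := by
  have := FiniteDimensional.complete ℝ E
  have h1 : ∀ w : E, (fun z => cov (fun z v w => g (t, z) v w) (fun _ => a) z w) =ᶠ[𝓝 y]
      fun z => Gam g (t, z) w a := fun w => by
    filter_upwards [eventually_slice hS hp] with z hz
    rw [cov, h.christoffel_slice hz]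
    simp
  have hG := (h.analyticAt_Gam hp).differentiableAt
  have h2 : ∀ v w : E, cov (fun z v w => g (t, z) v w)
      (fun z => cov (fun z v w => g (t, z) v w) (fun _ => a) z w) y v =
      dx (Gam g) (t, y) v w a + Gam g (t, y) v (Gam g (t, y) w a) := fun v w => by
    have h3 : DifferentiableAt ℝ (fun q => Gam g q w) (t, y) :=
      hG.clm_apply (differentiableAt_const _)
    have h4 : DifferentiableAt ℝ (fun q => Gam g q w a) (t, y) :=
      h3.clm_apply (differentiableAt_const _)
    have h5 : cov (fun z v w => g (t, z) v w) (fun _ => a) y w = Gam g (t, y) w a :=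
      (h1 w).self_of_nhds
    rw [cov, (h1 w).fderiv_eq, h5, h.christoffel_slice hp,
      (hasFDerivAt_slice (f := fun q => Gam g q w a) h4).fderiv, dx_apply, fderiv_clm_const h3,
      fderiv_clm_const hG]
    rfl
  rw [curv, h2, h2, curvx]

include hlam

lemma hess_slice (v w : E) :
    hess (fun z v w => g (t, z) v w) (fun z => lam (t, z)) y v w = hessx g lam (t, y) v w := by
  have hl := (hlam _ hp).differentiableAt
  have hdl := (analyticAt_dx (hlam _ hp)).differentiableAt
  have h1 : (fun z => fderiv ℝ (fun z => lam (t, z)) z w) =ᶠ[𝓝 y] fun z => dx lam (t, z) w := by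
    filter_upwards [eventually_slice hS hp] with z hz
    rw [(hasFDerivAt_slice (hlam _ hz).differentiableAt).fderiv]
  have h2 : DifferentiableAt ℝ (fun q => dx lam q w) (t, y) :=
    hdl.clm_apply (differentiableAt_const _)
  rw [hess, h1.fderiv_eq, h.christoffel_slice hp, (hasFDerivAt_slice hl).fderiv,
    (hasFDerivAt_slice (f := fun q => dx lam q w) h2).fderiv, dx_apply, fderiv_clm_const hdl]
  rfl

include hlam0

lemma covForm_slice (v a b : E) :
    covForm (fun z v w => g (t, z) v w)
      (fun z v w => deriv (fun s => g (s, z) v w) t / lam (t, z)) y v a b =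
      covh g (hform lam g) (t, y) v a b := by
  have hh := (h.analyticAt_hform hlam hlam0 hp).differentiableAt
  have h0 : ∀ z, (t, z) ∈ S → ∀ a b, deriv (fun s => g (s, z) a b) t / lam (t, z) =
      hform lam g (t, z) a b := fun z hz a b => by
    rw [h.deriv_form hz, hform, smul_apply, smul_apply, smul_eq_mul, div_eq_inv_mul]
  have h1 : (fun z => deriv (fun s => g (s, z) a b) t / lam (t, z)) =ᶠ[𝓝 y]
      fun z => hform lam g (t, z) a b := by
    filter_upwards [eventually_slice hS hp] with z hz using h0 z hz a b
  have h2 : DifferentiableAt ℝ (fun q => hform lam g q a b) (t, y) :=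
    (hh.clm_apply (differentiableAt_const _)).clm_apply (differentiableAt_const _)
  rw [covForm, h1.fderiv_eq, h.christoffel_slice hp, h.christoffel_slice hp, h0 y hp, h0 y hp,
    (hasFDerivAt_slice (f := fun q => hform lam g q a b) h2).fderiv, dx_apply,
    fderiv_bilin_apply hh]
  rfl

end ParallelFamily

end LocalGeom

namespace Geom

open Filter CauchyKovalevskaya LocalGeom

section Spacetime

universe u

variable {E : Type u} [NormedAddCommGroup E] [NormedSpace ℝ E] [FiniteDimensional ℝ E]
  {M : Type*} [TopologicalSpace M] [ChartedSpace E M] [IsManifold 𝓘(ℝ, E) ω M]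
  {lam : ℝ → M → ℝ} {𝓥 : Set (ℝ × M)} {g g' : ℝ → BilinField 𝓘(ℝ, E) M}
  {U U' : ℝ → VecField 𝓘(ℝ, E) M} {u u' : ℝ → M → ℝ}

lemma readForms_self (g : ℝ → BilinField 𝓘(ℝ, E) M) (t : ℝ) (x : M) (v w : E) :
    readForms x g (t, extChartAt 𝓘(ℝ, E) x x) v w = formVal (g t) x v w := by
  rw [readForms_apply (q := (t, x)) (mem_chart_source E x), fromChart_self]
  rfl

lemma readVecs_self (U : ℝ → VecField 𝓘(ℝ, E) M) (t : ℝ) (x : M) :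
    readVecs x U (t, extChartAt 𝓘(ℝ, E) x x) = vecVal (U t) x := by
  rw [readVecs_apply (q := (t, x)) (mem_chart_source E x), toChart_self]
  rfl

lemma readFuns_self (f : ℝ → M → ℝ) (t : ℝ) (x : M) :
    readFuns (E := E) x f (t, extChartAt 𝓘(ℝ, E) x x) = f t x :=
  readFuns_apply (q := (t, x)) (mem_chart_source E x) f

lemma diff_eq
    (hlam : ContMDiff (spaceTimeModel E) 𝓘(ℝ, ℝ) ω (fun q : ℝ × M => lam q.1 q.2)) (t : ℝ) (x : M)
    (X : E) : diff (I := 𝓘(ℝ, E)) (lam t) x X =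
      dx (readFuns (E := E) x lam) (t, extChartAt 𝓘(ℝ, E) x x) X := by
  have := FiniteDimensional.complete ℝ E
  have h1 : AnalyticAt ℝ (readFuns x lam) (t, extChartAt 𝓘(ℝ, E) x x) :=
    (contMDiffAt_funs_iff (q := (t, x)) (mem_chart_source E x)).1 (hlam (t, x))
  have h2 := hasFDerivAt_slice h1.differentiableAt
  have h3 : MDifferentiableAt 𝓘(ℝ, E) 𝓘(ℝ, ℝ) (lam t) x := by
    have h4 : ContMDiff 𝓘(ℝ, E) (spaceTimeModel E) ω fun x : M => (t, x) :=
      contMDiff_const.prodMk contMDiff_id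
    exact ((hlam.comp h4) x).mdifferentiableAt (by simp)
  have h5 : mfderiv 𝓘(ℝ, E) 𝓘(ℝ, ℝ) (lam t) x = fderiv ℝ
      (fun y => lam t ((extChartAt 𝓘(ℝ, E) x).symm y)) (extChartAt 𝓘(ℝ, E) x x) := by
    rw [h3.mfderiv, ModelWithCorners.range_eq_univ, fderivWithin_univ]
    rfl
  exact (congrArg (fun L : E →L[ℝ] ℝ => L X) h5).trans congr($(h2.fderiv) X)

/-- Families with a parallel null field satisfy the evolution equations. -/
theorem IsParallelNullFamily.evolutionAt (h : IsParallelNullFamily lam 𝓥 g U u) (h𝓥 : IsOpen 𝓥)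
    (hlam0 : ∀ t x, lam t x ≠ 0)
    (hlam : ContMDiff (spaceTimeModel E) 𝓘(ℝ, ℝ) ω (fun q : ℝ × M => lam q.1 q.2))
    {t : ℝ} {x : M} (hq : (t, x) ∈ 𝓥) : EvolutionAt lam (fun t => (g t).form) U u t x := by
  have := FiniteDimensional.complete ℝ E
  have hF := h.read h𝓥 hlam0 hlam x
  have hS := isOpen_readSet (E := E) x h𝓥
  have hL := analyticOnNhd_readFuns (𝓥 := 𝓥) hlam x
  have hL0 : ∀ p ∈ readSet (E := E) x 𝓥, readFuns x lam p ≠ 0 := fun p _ => hlam0 _ _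
  set y := extChartAt 𝓘(ℝ, E) x x with hy
  set S := readSet (E := E) x 𝓥 with hSdef
  set G := readForms x g with hG
  set L := readFuns (E := E) x lam with hLdef
  have hp : (t, y) ∈ S := (mem_readSet (q := (t, x)) (mem_chart_source E x)).2 hq
  -- The dictionary is set up at the centre of the chart around `x`, where the trivialization is the
  -- identity. Tensors at `x` then coincide with their coordinate expressions.
  have gv : ∀ s, ∀ X Y : E, (g s).form x X Y = G (s, y) X Y := fun s X Y =>
    (readForms_self g s x X Y).symm
  have Uv : ∀ s, vecVal (U s) x = readVecs x U (s, y) := fun s => (readVecs_self U s x).symm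
  have uv : ∀ s, u s x = readFuns x u (s, y) := fun s => (readFuns_self u s x).symm
  have lv : ∀ s, lam s x = L (s, y) := fun s => (readFuns_self lam s x).symm
  have d1 : ∀ s, (s, y) ∈ S → ∀ X Y : E, dotForm (fun t => (g t).form) s x X Y =
      dt G (s, y) X Y := fun s hs X Y => by
    rw [← hF.deriv_form hs X Y]
    exact congrArg (fun f => deriv f s) (funext fun s => gv s X Y)
  have d2 : ∀ X Y : E, dotForm (dotForm fun t => (g t).form) t x X Y = dt (dt G) (t, y) X Y :=
    fun X Y => by
      rw [← hF.deriv_deriv_form hS hp X Y]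
      exact congrArg (fun f => deriv f t) (funext fun s =>
        congrArg (fun f => deriv f s) (funext fun s => gv s X Y))
  have d3 : ∀ a X Y : E, dNabla (g t).form
      (fun z v w => dotForm (fun t => (g t).form) t z v w / lam t z) x a X Y =
      covh G (hform L G) (t, y) a X Y - covh G (hform L G) (t, y) X a Y := fun a X Y => by
    rw [← hF.covForm_slice hS hL hL0 hp, ← hF.covForm_slice hS hL hL0 hp]
    rfl
  have d4 : ∀ X Y : E, hess (g t).form (lam t) x X Y = hessx G L (t, y) X Y := fun X Y => by
    rw [← hF.hess_slice hS hL hp]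
    rfl
  have d5 : ∀ X Y Z W : E, riem (g t).form x X Y Z W = G (t, y) (curvx G (t, y) X Y Z) W :=
    fun X Y Z W => by
      rw [← hF.curv_slice hS hp]
      exact gv t _ W
  have d6 : ∀ s, ∀ X : E, diff (I := 𝓘(ℝ, E)) (lam s) x X = dx L (s, y) X := fun s X =>
    diff_eq hlam s x X
  have d7 : ∀ s, (s, y) ∈ S → vecVal (grad (g s).form (lam s)) x =
      (G (s, y)).inverse (dx L (s, y)) := fun s hs => by
    rw [← sharp_eq_inverse (hF.nondeg hs)]
    exact congrArg₂ (sharp (E := E)) (funext fun v => funext fun w => gv s v w)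
      (funext fun v => d6 s v)
  -- The gradient has its coordinate expression only at times with `(s, y)` in `S`; these form a
  -- neighbourhood of `t`, which suffices for the derivative.
  have d8 : vecVal (dotVec (fun s => grad (g s).form (lam s)) t) x =
      dt (fun q => (G q).inverse (dx L q)) (t, y) := by
    have h1 := (analyticAt_inverse_clm (hF.analytic_g _ hp) (hF.nondeg hp)
      (analyticAt_dx (hL _ hp))).differentiableAt
    rw [← deriv_slice h1]
    exact Filter.EventuallyEq.deriv_eq (F := E) ((eventually_time hS hp).mono d7)
  have d9 : ∀ s, (s, y) ∈ S → vecVal (dotVec U s) x = dt (readVecs x U) (s, y) := fun s hs => by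
    rw [← deriv_slice (hF.analytic_U _ hs).differentiableAt]
    exact congrArg (fun f : ℝ → E => deriv f s) (funext fun s => Uv s)
  have d10 : vecVal (dotVec (dotVec U) t) x = dt (dt (readVecs x U)) (t, y) := by
    rw [← deriv_slice (analyticAt_dt (hF.analytic_U _ hp)).differentiableAt]
    exact Filter.EventuallyEq.deriv_eq (F := E) ((eventually_time hS hp).mono d9)
  have d11 : ∀ s, (s, y) ∈ S → dotFun u s x = dt (readFuns x u) (s, y) := fun s hs => by
    rw [← deriv_slice (hF.analytic_u _ hs).differentiableAt]
    exact congrArg (fun f => deriv f s) (funext fun s => uv s)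
  have d12 : dotFun (dotFun u) t x = dt (dt (readFuns x u)) (t, y) := by
    rw [← deriv_slice (analyticAt_dt (hF.analytic_u _ hp)).differentiableAt]
    exact Filter.EventuallyEq.deriv_eq ((eventually_time hS hp).mono d11)
  have d13 : dotFun (fun s z => Real.log (lam s z)) t x = dt L (t, y) / L (t, y) := by
    have h1 : DifferentiableAt ℝ (fun s => L (s, y)) t :=
      DifferentiableAt.comp (g := L) t (hL _ hp).differentiableAt
        (differentiableAt_id.prodMk (differentiableAt_const y))
    rw [← deriv_slice (hL _ hp).differentiableAt, ← deriv.log h1 (hL0 _ hp)]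
    exact congrArg (fun f => deriv f t) (funext fun s => congrArg Real.log (lv s))
  have d14 : ∀ Y : E, (sharp (E := E) ((g t).form x) (dotForm (fun t => (g t).form) t x Y)) =
      (G (t, y)).inverse (dt G (t, y) Y) := fun Y => by
    rw [← sharp_eq_inverse (hF.nondeg hp)]
    exact congrArg₂ (sharp (E := E)) (funext fun v => funext fun w => gv t v w)
      (funext fun v => d1 t hp Y v)
  set A : E := vecVal (U t) x with hA
  refine ⟨fun (X Y : E) => ?_, fun (X : E) => ?_, ?_⟩
  · have h1 := hF.metric_evolution hS hL hL0 hp X Y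
    rw [← d13, ← Uv t, ← uv, ← lv, ← d14 Y, ← d2 X Y, ← d3 A X Y, ← d3 A Y X, ← d1 t hp X _,
      ← d1 t hp X Y, ← d1 t hp A A, ← d1 t hp X A, ← d1 t hp Y A, ← d4 X Y, ← d5 X A A Y] at h1
    exact h1
  · have h1 := hF.vector_evolution hS hL hL0 hp X
    rw [← d13, ← Uv t, ← uv, ← lv, ← d10, ← d8, ← d7 t hp, ← d9 t hp, ← d11 t hp,
      ← d3 A X A, ← d1 t hp A X, ← d1 t hp _ X, ← d1 t hp _ X, ← d4 A X, ← d6 t A, ← d6 t X,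
      ← gv, ← gv] at h1
    exact h1
  · have h1 := hF.scalar_evolution hS hL hL0 hp
    rw [← Uv t, ← uv, ← d12, ← d8, ← d7 t hp, ← d9 t hp, ← d1 t hp _ A, ← d6, ← gv, ← gv] at h1
    exact h1

end Spacetime

end Geom

end

/-! ### Initial data in charts and closedness of the one-form dual to `U` -/

noncomputable section

namespace LocalGeom

/-- The Levi-Civita connection is torsion free and metric, so the exterior derivative of the
one-form dual to `X` is the antisymmetric part of `∇X`. -/
lemma fderiv_lower_symm {E : Type*} [NormedAddCommGroup E] [NormedSpace ℝ E]
    [FiniteDimensional ℝ E] {B : E → E →L[ℝ] E →L[ℝ] ℝ} {X : E → E} {y : E}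
    (hB : DifferentiableAt ℝ B y) (hX : DifferentiableAt ℝ X y)
    (hs : ∀ᶠ z in 𝓝 y, ∀ v w, B z v w = B z w v)
    (hk : ∀ v w, koszul B X y v w = koszul B X y w v) (v w : E) :
    fderiv ℝ (fun z => B z (X z)) y v w = fderiv ℝ (fun z => B z (X z)) y w v := by
  have h1 := hk v w
  rw [(hB.hasFDerivAt.clm_apply hX.hasFDerivAt).fderiv]
  simp only [koszul, add_apply, ContinuousLinearMap.comp_apply,
    ContinuousLinearMap.flip_apply] at h1 ⊢
  linear_combination h1 + 1 / 2 * (fderiv_symm hB hs v (X y) w) -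
    1 / 2 * (fderiv_symm hB hs w (X y) v) - 1 / 2 * (fderiv_symm hB hs (X y) v w)

end LocalGeom

namespace Geom

open Filter CauchyKovalevskaya LocalGeom

section Spacetime

universe u

variable {E : Type u} [NormedAddCommGroup E] [NormedSpace ℝ E] [FiniteDimensional ℝ E]
  {M : Type*} [TopologicalSpace M] [ChartedSpace E M] [IsManifold 𝓘(ℝ, E) ω M]

lemma readForm_apply {x₀ z : M} (hz : z ∈ (chartAt E x₀).source)
    (g : BilinField 𝓘(ℝ, E) M) (v w : E) :
    readForm x₀ g (extChartAt 𝓘(ℝ, E) x₀ z) v w =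
      formVal g z (fromChart 𝓘(ℝ, E) x₀ z v) (fromChart 𝓘(ℝ, E) x₀ z w) :=
  readForms_apply (q := (0, z)) hz (fun _ => g) v w

lemma vecInChart_apply {x₀ z : M} (hz : z ∈ (chartAt E x₀).source)
    (X : VecField 𝓘(ℝ, E) M) :
    vecInChart x₀ X (extChartAt 𝓘(ℝ, E) x₀ z) = toChart 𝓘(ℝ, E) x₀ z (vecVal X z) :=
  readVecs_apply (q := (0, z)) hz (fun _ => X)

lemma eventually_source {x₀ z : M} (hz : z ∈ (chartAt E x₀).source) :
    ∀ᶠ y in 𝓝 (extChartAt 𝓘(ℝ, E) x₀ z), ∃ z' ∈ (chartAt E x₀).source,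
      extChartAt 𝓘(ℝ, E) x₀ z' = y :=
  (eventually_chartChange (I := 𝓘(ℝ, E)) hz hz).mono fun _ ⟨z', h1, _, h2⟩ => ⟨z', h1, h2⟩

/-- Analytic initial data for a Lorentzian metric with parallel null vector field. -/
structure IsInitialData (g₀ : BilinField 𝓘(ℝ, E) M)
    (W : (x : M) → TangentSpace 𝓘(ℝ, E) x →L[ℝ] TangentSpace 𝓘(ℝ, E) x)
    (U₀ : VecField 𝓘(ℝ, E) M) (u₀ : M → ℝ) : Prop where
  symm : ∀ x, ∀ v w : E, formVal g₀ x v w = formVal g₀ x w v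
  pos : ∀ x, ∀ v : E, v ≠ 0 → 0 < formVal g₀ x v v
  analytic_metric : ContMDiff 𝓘(ℝ, E) (𝓘(ℝ, E).prod 𝓘(ℝ, E →L[ℝ] E →L[ℝ] ℝ)) ω
    (fun x : M => TotalSpace.mk' (E →L[ℝ] E →L[ℝ] ℝ)
      (E := fun x : M => TangentSpace 𝓘(ℝ, E) x →L[ℝ] TangentSpace 𝓘(ℝ, E) x →L[ℝ] ℝ) x (g₀ x))
  analytic_vector : ContMDiff 𝓘(ℝ, E) 𝓘(ℝ, E).tangent ω
    (fun x : M => (⟨x, U₀ x⟩ : TangentBundle 𝓘(ℝ, E) M))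
  symm_W : ∀ x, ∀ X Y : TangentSpace 𝓘(ℝ, E) x, g₀ x (W x X) Y = g₀ x X (W x Y)
  u_pos : ∀ x, 0 < u₀ x
  sq_u : ∀ x, u₀ x ^ 2 = g₀ x (U₀ x) (U₀ x)
  constraint : ∀ x, ∀ X : TangentSpace 𝓘(ℝ, E) x, cov g₀.form U₀ x X + u₀ x • W x X = 0

namespace IsInitialData

variable {g₀ : BilinField 𝓘(ℝ, E) M}
  {W : (x : M) → TangentSpace 𝓘(ℝ, E) x →L[ℝ] TangentSpace 𝓘(ℝ, E) x}
  {U₀ : VecField 𝓘(ℝ, E) M} {u₀ : M → ℝ} (h : IsInitialData g₀ W U₀ u₀)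

include h

lemma analyticAt_readForm {x₀ z : M} (hz : z ∈ (chartAt E x₀).source) :
    AnalyticAt ℝ (readForm x₀ g₀) (extChartAt 𝓘(ℝ, E) x₀ z) := by
  have := FiniteDimensional.complete ℝ E
  have h1 := (contMDiffAt_form_iff (I := 𝓘(ℝ, E)) (b := fun x : M => x) (L := fun x => g₀ x) hz
    contMDiffAt_id).1 (h.analytic_metric z)
  exact (contMDiffAt_iff_analyticAt (I := 𝓘(ℝ, E)) hz).1 h1

lemma analyticAt_vecInChart {x₀ z : M} (hz : z ∈ (chartAt E x₀).source) :
    AnalyticAt ℝ (vecInChart x₀ U₀) (extChartAt 𝓘(ℝ, E) x₀ z) := by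
  have := FiniteDimensional.complete ℝ E
  have h1 := (contMDiffAt_vec_iff (I := 𝓘(ℝ, E)) (b := fun x : M => x) (X := fun x => U₀ x) hz
    contMDiffAt_id).1 (h.analytic_vector z)
  exact (contMDiffAt_iff_analyticAt (I := 𝓘(ℝ, E)) hz).1 h1

lemma symm_readForm {x₀ z : M} (hz : z ∈ (chartAt E x₀).source) :
    ∀ᶠ y in 𝓝 (extChartAt 𝓘(ℝ, E) x₀ z), ∀ v w, readForm x₀ g₀ y v w = readForm x₀ g₀ y w v := by
  filter_upwards [eventually_source hz] with y ⟨z', hz', e⟩ v w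
  rw [← e, readForm_apply hz', readForm_apply hz', h.symm]

lemma pos_readForm {x₀ z : M} (hz : z ∈ (chartAt E x₀).source) (v : E) (hv : v ≠ 0) :
    0 < readForm x₀ g₀ (extChartAt 𝓘(ℝ, E) x₀ z) v v := by
  rw [readForm_apply hz]
  exact h.pos z _ (fromChart_ne_zero hz hv)

lemma sq_readFun {x₀ z : M} (hz : z ∈ (chartAt E x₀).source) :
    ∀ᶠ y in 𝓝 (extChartAt 𝓘(ℝ, E) x₀ z), u₀ ((extChartAt 𝓘(ℝ, E) x₀).symm y) ^ 2 =
      readForm x₀ g₀ y (vecInChart x₀ U₀ y) (vecInChart x₀ U₀ y) := by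
  filter_upwards [eventually_source hz] with y ⟨z', hz', e⟩
  rw [← e, readForm_apply hz', vecInChart_apply hz', fromChart_toChart hz',
    extChartAt_symm_apply hz']
  exact h.sq_u z'

/-- `u₀` is the square root of the analytic function `g₀(U₀, U₀)`, which is positive. -/
lemma analyticAt_readFun {x₀ z : M} (hz : z ∈ (chartAt E x₀).source) :
    AnalyticAt ℝ (fun y => u₀ ((extChartAt 𝓘(ℝ, E) x₀).symm y)) (extChartAt 𝓘(ℝ, E) x₀ z) := by
  have := FiniteDimensional.complete ℝ E
  have h1 := h.analyticAt_vecInChart hz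
  have h2 : AnalyticAt ℝ (fun y => readForm x₀ g₀ y (vecInChart x₀ U₀ y) (vecInChart x₀ U₀ y))
      (extChartAt 𝓘(ℝ, E) x₀ z) := ((h.analyticAt_readForm hz).clm_app h1).clm_app h1
  have h0 := (h.sq_readFun hz).self_of_nhds
  have h3 : readForm x₀ g₀ (extChartAt 𝓘(ℝ, E) x₀ z) (vecInChart x₀ U₀ (extChartAt 𝓘(ℝ, E) x₀ z))
      (vecInChart x₀ U₀ (extChartAt 𝓘(ℝ, E) x₀ z)) ≠ 0 := by
    rw [← h0]
    exact pow_ne_zero 2 (h.u_pos _).ne'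
  have h4 : AnalyticAt ℝ Real.sqrt (readForm x₀ g₀ (extChartAt 𝓘(ℝ, E) x₀ z)
      (vecInChart x₀ U₀ (extChartAt 𝓘(ℝ, E) x₀ z)) (vecInChart x₀ U₀ (extChartAt 𝓘(ℝ, E) x₀ z))) :=
    (Real.contDiffAt_sqrt h3).analyticAt
  refine (AnalyticAt.comp (f := fun y => readForm x₀ g₀ y (vecInChart x₀ U₀ y)
    (vecInChart x₀ U₀ y)) h4 h2).congr ?_
  filter_upwards [h.sq_readFun hz] with y hy
  rw [Function.comp_apply, ← hy, Real.sqrt_sq (h.u_pos _).le]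

lemma koszul_eq (z : M) (v w : E) :
    koszul (readForm z g₀) (vecInChart z U₀) (extChartAt 𝓘(ℝ, E) z z) v w =
      - (u₀ z * g₀ z (W z v) w) := by
  have hz := mem_chart_source E z
  have h1 := apply_cov (h.analyticAt_readForm hz).differentiableAt
    (nondeg_of_pos (h.pos_readForm hz)) (vecInChart z U₀) v w
  rw [← h1, readForm_apply hz, fromChart_self]
  have h2 : g₀ z (cov g₀.form U₀ z v) w = - (u₀ z * g₀ z (W z v) w) := by
    rw [eq_neg_of_add_eq_zero_left (h.constraint z v), map_neg, map_smul]
    rfl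
  exact h2

/-- By the constraint the lowered derivative of `U₀` is `-u₀ g₀(W ·, ·)`, which is symmetric. The
constraint is formulated in the chart centred at `z` and is carried to the chart around `x₀` by
naturality. -/
lemma koszul_symm {x₀ z : M} (hz : z ∈ (chartAt E x₀).source) (v w : E) :
    koszul (readForm x₀ g₀) (vecInChart x₀ U₀) (extChartAt 𝓘(ℝ, E) x₀ z) v w =
      koszul (readForm x₀ g₀) (vecInChart x₀ U₀) (extChartAt 𝓘(ℝ, E) x₀ z) w v := by
  have h1 := koszul_chartChange hz (h.analyticAt_readForm hz).differentiableAt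
    (h.analyticAt_vecInChart hz).differentiableAt
    (h.analyticAt_vecInChart (mem_chart_source E z)).differentiableAt (h.symm z)
  rw [← toChart_fromChart (I := 𝓘(ℝ, E)) hz v, ← toChart_fromChart (I := 𝓘(ℝ, E)) hz w, ← h1, ← h1,
    h.koszul_eq, h.koszul_eq]
  have h2 := h.symm_W z (fromChart 𝓘(ℝ, E) x₀ z v) (fromChart 𝓘(ℝ, E) x₀ z w)
  have h3 := h.symm z (fromChart 𝓘(ℝ, E) x₀ z v) (W z (fromChart 𝓘(ℝ, E) x₀ z w))
  exact congrArg (fun r : ℝ => - (u₀ z * r)) (h2.trans h3)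

lemma fderiv_lower_symm {x₀ z : M} (hz : z ∈ (chartAt E x₀).source) :
    ∀ᶠ y in 𝓝 (extChartAt 𝓘(ℝ, E) x₀ z), ∀ v w,
      fderiv ℝ (fun y => readForm x₀ g₀ y (vecInChart x₀ U₀ y)) y v w =
        fderiv ℝ (fun y => readForm x₀ g₀ y (vecInChart x₀ U₀ y)) y w v := by
  filter_upwards [eventually_source hz] with y ⟨z', hz', e⟩ v w
  rw [← e]
  exact LocalGeom.fderiv_lower_symm (h.analyticAt_readForm hz').differentiableAt
    (h.analyticAt_vecInChart hz').differentiableAt (h.symm_readForm hz') (h.koszul_symm hz') v w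

end IsInitialData

end Spacetime

end Geom

end

/-! ### Local existence and gluing -/

noncomputable section

namespace Geom

open Filter CauchyKovalevskaya LocalGeom

section Spacetime

universe u

variable {E : Type u} [NormedAddCommGroup E] [NormedSpace ℝ E] [FiniteDimensional ℝ E]
  {M : Type*} [TopologicalSpace M] [ChartedSpace E M] [IsManifold 𝓘(ℝ, E) ω M]

/-- Families of forms from their reading in the chart around `x₀`. -/
def formsOfChart (x₀ : M) (g : ℝ × E → E →L[ℝ] E →L[ℝ] ℝ) (t : ℝ) : BilinField 𝓘(ℝ, E) M :=
  fun z => ((g (t, extChartAt 𝓘(ℝ, E) x₀ z)).bilinearComp (toChart 𝓘(ℝ, E) x₀ z)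
    (toChart 𝓘(ℝ, E) x₀ z) : E →L[ℝ] E →L[ℝ] ℝ)

/-- Families of vector fields from their reading in the chart around `x₀`. -/
def vecsOfChart (x₀ : M) (U : ℝ × E → E) (t : ℝ) : VecField 𝓘(ℝ, E) M :=
  fun z => (fromChart 𝓘(ℝ, E) x₀ z (U (t, extChartAt 𝓘(ℝ, E) x₀ z)) : E)

lemma readForms_formsOfChart {x₀ : M} (g : ℝ × E → E →L[ℝ] E →L[ℝ] ℝ) {q : ℝ × M}
    (hq : q.2 ∈ (chartAt E x₀).source) :
    readForms x₀ (formsOfChart x₀ g) (q.1, extChartAt 𝓘(ℝ, E) x₀ q.2) =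
      g (q.1, extChartAt 𝓘(ℝ, E) x₀ q.2) := by
  refine ContinuousLinearMap.ext fun v => ContinuousLinearMap.ext fun w => ?_
  rw [readForms_apply hq, formVal, formsOfChart, ContinuousLinearMap.bilinearComp_apply,
    toChart_fromChart hq, toChart_fromChart hq]

lemma readVecs_vecsOfChart {x₀ : M} (U : ℝ × E → E) {q : ℝ × M}
    (hq : q.2 ∈ (chartAt E x₀).source) :
    readVecs x₀ (vecsOfChart x₀ U) (q.1, extChartAt 𝓘(ℝ, E) x₀ q.2) =
      U (q.1, extChartAt 𝓘(ℝ, E) x₀ q.2) := by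
  rw [readVecs_apply hq, vecVal, vecsOfChart, toChart_fromChart hq]

variable {g₀ : BilinField 𝓘(ℝ, E) M}
  {W : (x : M) → TangentSpace 𝓘(ℝ, E) x →L[ℝ] TangentSpace 𝓘(ℝ, E) x}
  {U₀ : VecField 𝓘(ℝ, E) M} {u₀ : M → ℝ} {lam : ℝ → M → ℝ}

/-- Local existence. -/
theorem IsInitialData.exists_local (h : IsInitialData g₀ W U₀ u₀) (hlam0 : ∀ t x, lam t x ≠ 0)
    (hlam : ContMDiff (spaceTimeModel E) 𝓘(ℝ, ℝ) ω (fun q : ℝ × M => lam q.1 q.2)) (x₀ : M) :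
    ∃ 𝓑 : Set (ℝ × M), IsOpen 𝓑 ∧ ((0 : ℝ), x₀) ∈ 𝓑 ∧ (∀ q ∈ 𝓑, ((0 : ℝ), q.2) ∈ 𝓑) ∧
      (∀ x, Set.OrdConnected {t : ℝ | (t, x) ∈ 𝓑}) ∧ ∃ g U u, IsParallelNullFamily lam 𝓑 g U u ∧
        ∀ x, ((0 : ℝ), x) ∈ 𝓑 → g 0 x = g₀ x ∧ U 0 x = U₀ x ∧ u 0 x = u₀ x := by
  have := FiniteDimensional.complete ℝ E
  have hx₀ := mem_chart_source E x₀
  have hla : AnalyticAt ℝ (readFuns x₀ lam) (0, extChartAt 𝓘(ℝ, E) x₀ x₀) :=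
    (contMDiffAt_funs_iff (q := (0, x₀)) hx₀).1 (hlam (0, x₀))
  obtain ⟨r, hr, g, U, u, hF, hi⟩ := exists_parallelFamily hla (h.analyticAt_readForm hx₀)
    (h.analyticAt_vecInChart hx₀) (h.analyticAt_readFun hx₀) (h.u_pos _).ne'
    (h.symm_readForm hx₀) (h.pos_readForm hx₀) (h.sq_readFun hx₀) (h.fderiv_lower_symm hx₀)
  set φ := extChartAt 𝓘(ℝ, E) x₀
  set D : Set M := (chartAt E x₀).source ∩ φ ⁻¹' Metric.ball (φ x₀) r with hD
  have hDo : IsOpen D := by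
    have h1 := (continuousOn_extChartAt (I := 𝓘(ℝ, E)) x₀).isOpen_inter_preimage
      (isOpen_extChartAt_source x₀) (Metric.isOpen_ball (x := φ x₀) (ε := r))
    rwa [extChartAt_source] at h1
  -- For a product every fibre in time is empty or an interval around zero. Order connectedness,
  -- unlike preconnectedness in general, passes to intersections of such fibres, which is what
  -- gluing requires.
  set 𝓑 : Set (ℝ × M) := Metric.ball (0 : ℝ) r ×ˢ D with h𝓑
  have hsub : ∀ q ∈ 𝓑, q.2 ∈ (chartAt E x₀).source := fun q hq => hq.2.1
  have hball : ∀ q ∈ 𝓑, (q.1, φ q.2) ∈ Metric.ball ((0 : ℝ), φ x₀) r := fun q hq => by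
    rw [← ball_prod_same]
    exact ⟨hq.1, hq.2.2⟩
  have h0 : (0 : ℝ) ∈ Metric.ball (0 : ℝ) r := Metric.mem_ball_self hr
  refine ⟨𝓑, Metric.isOpen_ball.prod hDo, ⟨h0, hx₀, Metric.mem_ball_self hr⟩,
    fun q hq => ⟨h0, hq.2⟩, fun x => ?_, formsOfChart x₀ g, vecsOfChart x₀ U,
    fun t z => u (t, φ z), ?_, fun x hx => ?_⟩
  · by_cases hx : x ∈ D
    · have : {t : ℝ | (t, x) ∈ 𝓑} = Metric.ball (0 : ℝ) r := by
        ext t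
        simp [h𝓑, hx]
      rw [this]
      exact (convex_ball (0 : ℝ) r).ordConnected
    · have : {t : ℝ | (t, x) ∈ 𝓑} = ∅ := by
        ext t
        simp [h𝓑, hx]
      rw [this]
      exact Set.ordConnected_empty
  · refine IsParallelNullFamily.of_read (x₀ := x₀) ?_ hsub hlam0 hlam
    have hmem : ∀ p ∈ readSet (E := E) x₀ 𝓑, p ∈ Metric.ball ((0 : ℝ), φ x₀) r := fun p hp => by
      obtain ⟨q, hq, -, rfl⟩ := exists_of_mem_readSet hp
      exact hball q hq
    refine (hF.mono hmem).congr (isOpen_readSet x₀ (Metric.isOpen_ball.prod hDo)) ?_ ?_ ?_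
    all_goals
      intro p hp
      obtain ⟨q, -, hq, rfl⟩ := exists_of_mem_readSet hp
    · exact readForms_formsOfChart g hq
    · exact readVecs_vecsOfChart U hq
    · exact readFuns_apply hq _
  · have hs : x ∈ (chartAt E x₀).source := hx.2.1
    obtain ⟨e1, e2, e3⟩ := hi (φ x) hx.2.2
    refine ⟨?_, ?_, ?_⟩
    · have h1 : ∀ v w : E, formVal (formsOfChart x₀ g 0) x v w = formVal g₀ x v w := fun v w => by
        rw [formVal, formsOfChart, ContinuousLinearMap.bilinearComp_apply, e1,
          readForm_apply hs, fromChart_toChart hs, fromChart_toChart hs]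
      exact ContinuousLinearMap.ext fun v => ContinuousLinearMap.ext fun w => h1 v w
    · have h1 : vecVal (vecsOfChart x₀ U 0) x = vecVal U₀ x := by
        rw [vecVal, vecsOfChart, e2, vecInChart_apply hs, fromChart_toChart hs]
      exact h1
    · change u (0, φ x) = u₀ x
      rw [e3]
      exact congrArg u₀ (extChartAt_symm_apply hs)

/-- Global existence near the initial hypersurface. -/
theorem IsInitialData.exists_family (h : IsInitialData g₀ W U₀ u₀) (hlam0 : ∀ t x, lam t x ≠ 0)
    (hlam : ContMDiff (spaceTimeModel E) 𝓘(ℝ, ℝ) ω (fun q : ℝ × M => lam q.1 q.2)) :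
    ∃ 𝓤 : Set (ℝ × M), IsOpen 𝓤 ∧ (∀ x, ((0 : ℝ), x) ∈ 𝓤) ∧
      (∀ x, IsPreconnected {t : ℝ | (t, x) ∈ 𝓤}) ∧ ∃ g U u, IsParallelNullFamily lam 𝓤 g U u ∧
        ∀ x, g 0 x = g₀ x ∧ U 0 x = U₀ x ∧ u 0 x = u₀ x := by
  classical
  choose 𝓑 ho hmem h0 hc g U u hF hi using h.exists_local hlam0 hlam
  -- The implication makes the choice of a local piece total; outside the union the piece is
  -- arbitrary.
  have hex : ∀ q : ℝ × M, ∃ a, q ∈ (⋃ a, 𝓑 a) → q ∈ 𝓑 a := fun q => by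
    by_cases hq : q ∈ ⋃ a, 𝓑 a
    · obtain ⟨a, ha⟩ := Set.mem_iUnion.1 hq
      exact ⟨a, fun _ => ha⟩
    · exact ⟨q.2, fun h => absurd h hq⟩
  choose c hcs using hex
  have hagree : ∀ a b, ∀ q ∈ 𝓑 a, q ∈ 𝓑 b → g a q.1 q.2 = g b q.1 q.2 ∧ U a q.1 q.2 = U b q.1 q.2 ∧
      u a q.1 q.2 = u b q.1 q.2 := fun a b q ha hb => by
    -- On the overlap of two pieces the fibres are intervals containing zero, and both families have
    -- the same initial values there.
    refine ((hF a).mono Set.inter_subset_left).eq_of_initial ((hF b).mono Set.inter_subset_right)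
      ((ho a).inter (ho b)) hlam0 hlam (fun x hx => ?_) ⟨ha, hb⟩ ?_ ⟨h0 a q ha, h0 b q hb⟩
    · obtain ⟨a1, a2, a3⟩ := hi a x hx.1
      obtain ⟨b1, b2, b3⟩ := hi b x hx.2
      exact ⟨a1.trans b1.symm, a2.trans b2.symm, a3.trans b3.symm⟩
    · have := ((hc a q.2).inter (hc b q.2)).isPreconnected
      exact this
  have hagree' : ∀ a, ∀ q ∈ 𝓑 a, g (c q) q.1 q.2 = g a q.1 q.2 ∧ U (c q) q.1 q.2 = U a q.1 q.2 ∧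
      u (c q) q.1 q.2 = u a q.1 q.2 := fun a q hq =>
    hagree (c q) a q (hcs q (Set.mem_iUnion.2 ⟨a, hq⟩)) hq
  refine ⟨⋃ a, 𝓑 a, isOpen_iUnion ho, fun x => Set.mem_iUnion.2 ⟨x, hmem x⟩, fun x => ?_,
    fun t x => g (c (t, x)) t x, fun t x => U (c (t, x)) t x, fun t x => u (c (t, x)) t x,
    IsParallelNullFamily.of_locally fun q hq => ?_, fun x => ?_⟩
  -- A fibre of the union is a union of intervals that all contain zero.
  · refine isPreconnected_of_forall (0 : ℝ) fun t ht => ?_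
    obtain ⟨a, ha⟩ := Set.mem_iUnion.1 ht
    exact ⟨{t | (t, x) ∈ 𝓑 a}, fun s hs => Set.mem_iUnion.2 ⟨a, hs⟩, h0 a _ ha, ha,
      (hc a x).isPreconnected⟩
  · obtain ⟨a, ha⟩ := Set.mem_iUnion.1 hq
    exact ⟨𝓑 a, ho a, ha, g a, U a, u a, hF a, hagree' a⟩
  · exact hi _ x (hcs _ (Set.mem_iUnion.2 ⟨x, hmem x⟩))

end Spacetime

end Geom

end

/-! ### Analyticity of the Lorentzian metric and of the null field; initial conditions -/

noncomputable section

namespace LocalGeom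

variable {E : Type*} [NormedAddCommGroup E] [NormedSpace ℝ E] [FiniteDimensional ℝ E]

lemma analyticAt_lorentzForm {lam : ℝ × E → ℝ} {g : ℝ × E → E →L[ℝ] E →L[ℝ] ℝ} {p : ℝ × E}
    (hlam : AnalyticAt ℝ lam p) (hg : AnalyticAt ℝ g p) : AnalyticAt ℝ (lorentzForm lam g) p := by
  have h1 : AnalyticAt ℝ (fun p => (g p).bilinearComp (ContinuousLinearMap.snd ℝ ℝ E)
      (ContinuousLinearMap.snd ℝ ℝ E)) p := by
    let L : (E →L[ℝ] E →L[ℝ] ℝ) →L[ℝ] ((ℝ × E) →L[ℝ] (ℝ × E) →L[ℝ] ℝ) :=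
      (ContinuousLinearMap.compL ℝ (ℝ × E) (E →L[ℝ] ℝ) ((ℝ × E) →L[ℝ] ℝ)
        ((ContinuousLinearMap.compL ℝ (ℝ × E) E ℝ).flip (ContinuousLinearMap.snd ℝ ℝ E))).comp
      ((ContinuousLinearMap.compL ℝ (ℝ × E) E (E →L[ℝ] ℝ)).flip (ContinuousLinearMap.snd ℝ ℝ E))
    exact (L.analyticAt (g p)).comp hg
  unfold lorentzForm
  exact ((hlam.pow 2).neg.smul analyticAt_const).add h1

lemma analyticAt_nullVec {lam : ℝ × E → ℝ} {U : ℝ × E → E} {u : ℝ × E → ℝ} {p : ℝ × E}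
    (hlam : AnalyticAt ℝ lam p) (hlam0 : lam p ≠ 0) (hU : AnalyticAt ℝ U p)
    (hu : AnalyticAt ℝ u p) : AnalyticAt ℝ (nullVec lam U u) p := by
  unfold nullVec
  exact (hu.div hlam hlam0).prod hU.neg

end LocalGeom

namespace Geom

open Filter CauchyKovalevskaya LocalGeom

section Spacetime

universe u

variable {E : Type u} [NormedAddCommGroup E] [NormedSpace ℝ E] [FiniteDimensional ℝ E]
  {M : Type*} [TopologicalSpace M] [ChartedSpace E M] [IsManifold 𝓘(ℝ, E) ω M]
  {g₀ : BilinField 𝓘(ℝ, E) M}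
  {W : (x : M) → TangentSpace 𝓘(ℝ, E) x →L[ℝ] TangentSpace 𝓘(ℝ, E) x}
  {U₀ : VecField 𝓘(ℝ, E) M} {u₀ : M → ℝ} {lam : ℝ → M → ℝ} {𝓥 : Set (ℝ × M)}
  {g : ℝ → BilinField 𝓘(ℝ, E) M} {U : ℝ → VecField 𝓘(ℝ, E) M} {u : ℝ → M → ℝ}

theorem IsParallelNullFamily.isAnalyticLorentzMetricOn (h : IsParallelNullFamily lam 𝓥 g U u)
    (h𝓥 : IsOpen 𝓥) (hlam0 : ∀ t x, lam t x ≠ 0)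
    (hlam : ContMDiff (spaceTimeModel E) 𝓘(ℝ, ℝ) ω (fun q : ℝ × M => lam q.1 q.2)) :
    IsAnalyticLorentzMetricOn (lorentzMetric lam g) 𝓥 := by
  have := FiniteDimensional.complete ℝ E
  refine ⟨fun q hq => ?_, fun q hq => ContMDiffAt.contMDiffWithinAt ?_⟩
  · have e : ∀ v w : ℝ × E, (lorentzMetric lam g).form q v w =
        -(lam q.1 q.2 ^ 2) * (v.1 * w.1) + formVal (g q.1) q.2 v.2 w.2 := fun v w => rfl
    have hl : 0 < lam q.1 q.2 ^ 2 := by have := hlam0 q.1 q.2; positivity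
    -- The timelike vector is `∂_t`; its orthogonal complement is the tangent space of `M`, where
    -- the form is `g_t`.
    refine ⟨fun (v w : ℝ × E) => ?_, ((1, 0) : ℝ × E), ?_, fun (v : ℝ × E) h0 hv => ?_⟩
    · rw [e, e, mul_comm v.1]
      exact congrArg _ (h.symm q hq v.2 w.2)
    · rw [e]
      simpa using hl
    · rw [e] at h0 ⊢
      have h1 : v.1 = 0 := by simpa [hlam0] using h0
      have h2 : v.2 ≠ 0 := fun h2 => hv (Prod.ext h1 h2)
      have h3 : 0 < formVal (g q.1) q.2 v.2 v.2 := h.pos q hq v.2 h2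
      simpa [h1] using h3
  · have hq' := mem_chart_source E q.2
    refine (contMDiffAt_form_iff (I := spaceTimeModel E) (b := fun q : ℝ × M => q) (x₀ := q)
      (mem_chart_source_spaceTime.2 hq') contMDiffAt_id).2 ?_
    refine (contMDiffAt_iff_analyticAt (I := spaceTimeModel E) (x₀ := q)
      (mem_chart_source_spaceTime.2 hq')).2 ?_
    have h1 := analyticAt_lorentzForm ((contMDiffAt_funs_iff hq').1 (hlam q))
      ((contMDiffAt_forms_iff hq').1 ((h.analytic_metric q hq).contMDiffAt (h𝓥.mem_nhds hq)))
    refine h1.congr ?_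
    filter_upwards [eventually_mem_target hq'] with p hp
    exact (readForm_lorentzMetric hp lam g).symm

theorem IsParallelNullFamily.isAnalyticVecFieldOn (h : IsParallelNullFamily lam 𝓥 g U u)
    (h𝓥 : IsOpen 𝓥) (hlam0 : ∀ t x, lam t x ≠ 0)
    (hlam : ContMDiff (spaceTimeModel E) 𝓘(ℝ, ℝ) ω (fun q : ℝ × M => lam q.1 q.2)) :
    IsAnalyticVecFieldOn (nullField lam U u) 𝓥 := by
  have := FiniteDimensional.complete ℝ E
  refine fun q hq => ContMDiffAt.contMDiffWithinAt ?_
  have hq' := mem_chart_source E q.2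
  refine (contMDiffAt_vec_iff (I := spaceTimeModel E) (b := fun q : ℝ × M => q) (x₀ := q)
    (mem_chart_source_spaceTime.2 hq') contMDiffAt_id).2 ?_
  refine (contMDiffAt_iff_analyticAt (I := spaceTimeModel E) (x₀ := q)
    (mem_chart_source_spaceTime.2 hq')).2 ?_
  have h1 := analyticAt_nullVec ((contMDiffAt_funs_iff hq').1 (hlam q)) (hlam0 _ _)
    ((contMDiffAt_vecs_iff hq').1 ((h.analytic_vector q hq).contMDiffAt (h𝓥.mem_nhds hq)))
    ((contMDiffAt_funs_iff hq').1 ((h.analytic_scalar q hq).contMDiffAt (h𝓥.mem_nhds hq)))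
  refine h1.congr ?_
  filter_upwards [eventually_mem_target hq'] with p hp
  exact (vecInChart_nullField hp lam U u).symm

/-- The conditions on the time derivatives are the parallel equations at `t = 0`. There `u ġ = 2λ
g(∇U, ·)` and `∇U = -uW` give `ġ = -2λ g(W ·, ·)`, and inserting this into `g(U̇, ·) = u dλ - ½ ġ(U,
·)` gives `U̇ = u grad λ + λ W(U)`. -/
theorem IsInitialData.initialConditions (h : IsInitialData g₀ W U₀ u₀)
    (hF : IsParallelNullFamily lam 𝓥 g U u) (h𝓥 : IsOpen 𝓥) (h0 : ∀ x, ((0 : ℝ), x) ∈ 𝓥)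
    (hlam0 : ∀ t x, lam t x ≠ 0)
    (hlam : ContMDiff (spaceTimeModel E) 𝓘(ℝ, ℝ) ω (fun q : ℝ × M => lam q.1 q.2))
    (hi : ∀ x, g 0 x = g₀ x ∧ U 0 x = U₀ x ∧ u 0 x = u₀ x) :
    InitialConditions g₀ W U₀ u₀ lam g U u := by
  have := FiniteDimensional.complete ℝ E
  have hg : g 0 = g₀ := funext fun x => (hi x).1
  have hU : U 0 = U₀ := funext fun x => (hi x).2.1
  have hu : u 0 = u₀ := funext fun x => (hi x).2.2
  have hp : ∀ x, ((0 : ℝ), extChartAt 𝓘(ℝ, E) x x) ∈ readSet (E := E) x 𝓥 := fun x =>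
    (mem_readSet (q := (0, x)) (mem_chart_source E x)).2 (h0 x)
  have hR := hF.read h𝓥 hlam0 hlam
  have gv : ∀ s x, ∀ X Y : E, (g s).form x X Y = readForms x g (s, extChartAt 𝓘(ℝ, E) x x) X Y :=
    fun s x X Y => (readForms_self g s x X Y).symm
  have dg : ∀ x, ∀ X Y : E, dotForm (fun t => (g t).form) 0 x X Y =
      dt (readForms x g) (0, extChartAt 𝓘(ℝ, E) x x) X Y := fun x X Y => by
    rw [← (hR x).deriv_form (hp x) X Y]
    exact congrArg (fun f => deriv f 0) (funext fun s => gv s x X Y)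
  have hdot : ∀ x, ∀ X Y : E, dotForm (fun t => (g t).form) 0 x X Y =
      -2 * lam 0 x * g₀ x (W x X) Y := fun x X Y => by
    have h1 := ((hR x).parallel _ (hp x)).dx_U X Y
    have h2 := h.koszul_eq x X Y
    rw [koszul] at h2
    have e1 : dx (readForms x g) (0, extChartAt 𝓘(ℝ, E) x x) =
        fderiv ℝ (readForm x g₀) (extChartAt 𝓘(ℝ, E) x x) := by
      rw [← (hasFDerivAt_slice ((hR x).analytic_g _ (hp x)).differentiableAt).fderiv, ← hg]
      rfl
    have e2 : dx (readVecs x U) (0, extChartAt 𝓘(ℝ, E) x x) =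
        fderiv ℝ (vecInChart x U₀) (extChartAt 𝓘(ℝ, E) x x) := by
      rw [← (hasFDerivAt_slice ((hR x).analytic_U _ (hp x)).differentiableAt).fderiv, ← hU]
      rfl
    have e3 : readForms x g (0, extChartAt 𝓘(ℝ, E) x x) =
        readForm x g₀ (extChartAt 𝓘(ℝ, E) x x) := by rw [← hg]; rfl
    have e4 : readVecs x U (0, extChartAt 𝓘(ℝ, E) x x) =
        vecInChart x U₀ (extChartAt 𝓘(ℝ, E) x x) := by rw [← hU]; rfl
    rw [← dg, e1, e2, e3, e4, readFuns_self, readFuns_self, hu] at h1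
    refine mul_left_cancel₀ (h.u_pos x).ne' ?_
    linear_combination h1 + 2 * lam 0 x * h2
  refine ⟨fun x => (hi x).1, hdot, fun x => (hi x).2.1, fun x => ?_, fun x => (hi x).2.2,
    fun x => ?_⟩
  · have hn : Nondeg (formVal g₀ x) := nondeg_of_pos (h.pos x)
    have e1 : vecVal (dotVec U 0) x = dt (readVecs x U) (0, extChartAt 𝓘(ℝ, E) x x) := by
      rw [← deriv_slice ((hR x).analytic_U _ (hp x)).differentiableAt]
      exact congrArg (fun f : ℝ → E => deriv f 0) (funext fun s => (readVecs_self U s x).symm)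
    have e2 : vecVal (grad g₀.form (lam 0)) x = (formVal g₀ x).inverse
        (dx (readFuns (E := E) x lam) (0, extChartAt 𝓘(ℝ, E) x x)) := by
      rw [← sharp_eq_inverse hn]
      exact congrArg (sharp (E := E) _) (funext fun v => diff_eq hlam 0 x v)
    have e3 : readForms x g (0, extChartAt 𝓘(ℝ, E) x x) = formVal g₀ x := by
      rw [← hg]
      exact ContinuousLinearMap.ext fun v => ContinuousLinearMap.ext fun w =>
        readForms_self g 0 x v w
    let wU : E := W x (U₀ x)
    have e4 : vecVal (dotVec U 0) x = u₀ x • vecVal (grad g₀.form (lam 0)) x +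
        lam 0 x • wU := by
      refine Nondeg.eq_of_forall (E := E) hn fun z => ?_
      have h1 := ((hR x).parallel _ (hp x)).dt_U z
      rw [← e1, e3, readFuns_self, readVecs_self, ← dg, hdot, hu, hU] at h1
      rw [h1, map_add, map_smul, map_smul, add_apply, smul_apply, smul_apply, e2,
        hn.apply_inverse, smul_eq_mul, smul_eq_mul]
      have h2 : formVal g₀ x wU z = g₀ x (W x (vecVal (E := E) U₀ x)) z := rfl
      rw [h2]
      ring
    exact e4
  · have h1 := ((hR x).parallel _ (hp x)).dt_u
    rw [readVecs_self, ← diff_eq hlam, hU,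
      ← deriv_slice ((hR x).analytic_u _ (hp x)).differentiableAt] at h1
    refine Eq.trans ?_ h1
    exact congrArg (fun f => deriv f 0) (funext fun s => (readFuns_self u s x).symm)

end Spacetime

end Geom

end

end

/-! ### The main theorem -/

theorem theorem1
    {E : Type*} [NormedAddCommGroup E] [NormedSpace ℝ E] [FiniteDimensional ℝ E]
    {M : Type*} [TopologicalSpace M] [T2Space M] [ChartedSpace E M] [IsManifold 𝓘(ℝ, E) ω M]
    (g₀ : ContMDiffRiemannianMetric 𝓘(ℝ, E) ω E (fun x : M => TangentSpace 𝓘(ℝ, E) x))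
    (W : (x : M) → TangentSpace 𝓘(ℝ, E) x →L[ℝ] TangentSpace 𝓘(ℝ, E) x)
    (hW : ContMDiff 𝓘(ℝ, E) (𝓘(ℝ, E).prod 𝓘(ℝ, E →L[ℝ] E)) ω
      (fun x : M => TotalSpace.mk' (E →L[ℝ] E)
        (E := fun x : M => TangentSpace 𝓘(ℝ, E) x →L[ℝ] TangentSpace 𝓘(ℝ, E) x) x (W x)))
    (hWsymm : ∀ x, ∀ X Y : TangentSpace 𝓘(ℝ, E) x,
      g₀.inner x (W x X) Y = g₀.inner x X (W x Y))
    (U₀ : (x : M) → TangentSpace 𝓘(ℝ, E) x)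
    (hU₀ : ContMDiff 𝓘(ℝ, E) 𝓘(ℝ, E).tangent ω
      (fun x : M => (⟨x, U₀ x⟩ : TangentBundle 𝓘(ℝ, E) M)))
    (u₀ : M → ℝ) (hu₀ : ∀ x, 0 < u₀ x) (hu₀sq : ∀ x, (u₀ x) ^ 2 = g₀.inner x (U₀ x) (U₀ x))
    (constraint : ∀ x, ∀ X : TangentSpace 𝓘(ℝ, E) x,
      Geom.cov (Geom.BilinField.form g₀.inner) U₀ x X + u₀ x • W x X = 0)
    (lam : ℝ → M → ℝ) (hlam : ∀ t x, 0 < lam t x)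
    (hlam_analytic : ContMDiff (Geom.spaceTimeModel E) 𝓘(ℝ, ℝ) ω
      (fun q : ℝ × M => lam q.1 q.2)) :
    ∃ 𝓤 : Set (ℝ × M), IsOpen 𝓤 ∧ (∀ x, ((0 : ℝ), x) ∈ 𝓤) ∧
      ∃ (g : ℝ → Geom.BilinField 𝓘(ℝ, E) M) (U : ℝ → Geom.VecField 𝓘(ℝ, E) M) (u : ℝ → M → ℝ),
        Geom.IsParallelNullFamily lam 𝓤 g U u ∧
        Geom.InitialConditions g₀.inner W U₀ u₀ lam g U u ∧
        Geom.IsAnalyticLorentzMetricOn (Geom.lorentzMetric lam g) 𝓤 ∧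
        Geom.IsAnalyticVecFieldOn (Geom.nullField lam U u) 𝓤 ∧
        (∀ q ∈ 𝓤, Geom.EvolutionAt lam (fun t => (g t).form) U u q.1 q.2) ∧
        ∀ (g' : ℝ → Geom.BilinField 𝓘(ℝ, E) M) (U' : ℝ → Geom.VecField 𝓘(ℝ, E) M)
          (u' : ℝ → M → ℝ),
          Geom.IsParallelNullFamily lam 𝓤 g' U' u' →
          Geom.InitialConditions g₀.inner W U₀ u₀ lam g' U' u' →
          ∀ q ∈ 𝓤, g' q.1 q.2 = g q.1 q.2 ∧ U' q.1 q.2 = U q.1 q.2 ∧ u' q.1 q.2 = u q.1 q.2 := by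
  have hd : Geom.IsInitialData g₀.inner W U₀ u₀ := {
    symm := g₀.symm
    pos := g₀.pos
    analytic_metric := g₀.contMDiff
    analytic_vector := hU₀
    symm_W := hWsymm
    u_pos := hu₀
    sq_u := hu₀sq
    constraint := constraint }
  have hlam0 : ∀ t x, lam t x ≠ 0 := fun t x => (hlam t x).ne'
  obtain ⟨𝓤, ho, h0, hc, g, U, u, hF, hi⟩ := hd.exists_family hlam0 hlam_analytic
  refine ⟨𝓤, ho, h0, g, U, u, hF, hd.initialConditions hF ho h0 hlam0 hlam_analytic hi,
    hF.isAnalyticLorentzMetricOn ho hlam0 hlam_analytic,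
    hF.isAnalyticVecFieldOn ho hlam0 hlam_analytic,
    fun q hq => hF.evolutionAt ho hlam0 hlam_analytic hq, fun g' U' u' hF' hi' q hq => ?_⟩
  -- The set `𝓤` was built with every fibre in time preconnected and containing zero, so uniqueness
  -- along fibres reaches every point of `𝓤`.
  exact hF'.eq_of_initial hF ho hlam0 hlam_analytic (fun x _ => ⟨(hi'.metric x).trans (hi x).1.symm,
    (hi'.vector x).trans (hi x).2.1.symm, (hi'.scalar x).trans (hi x).2.2.symm⟩) hq (hc q.2) (h0 q.2)
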